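/- **Setting.** Let $g\in C^\infty([0,\infty),\mathbb R)$ with $g(0)=0$ and, for some $p<2$, $|g^{(n)}(s)|\le C_n s^{p-n}$ for all $s\ge 1$ and $n\ge 0$. Let $\mathcal O\subset(0,\infty)$ be an open interval and $\mathcal O\ni\omega\mapsto\phi_\omega\in H^1_{\mathrm{rad}}(\mathbb R^3,\mathbb R)$ a $C^2$ map such that each $\phi_\omega$ is positive and (weakly) solves $-\Delta\phi_\omega+\omega\phi_\omega+g(\phi_\omega^2)\phi_\omega=0$. Put $q(\omega)=\frac12\|\phi_\omega\|_{L^2}^2$ and $d(\omega)=E(\phi_\omega)+\omega q(\omega)$, where $E(u)=\frac12\|\nabla u\|_{L^2}^2+\frac12\int_{\mathbb R^3} G(|u|^2)\,dx$ and $G(s)=\int_0^s g$. Assume that $\omega_*\in\mathcal O$ satisfies $q'(\omega_*)=0$ and $q''(\omega_*)>0$. For $u:\mathbb R^3\to\mathbb C$ let $\mathcal L_\omega u=-i\big(-\Delta u+\omega u+g(\phi_\omega^2)u+g'(\phi_\omega^2)\phi_\omega^2(u+\bar u)\big)$ be the linearization at $\phi_\omega$, and let $\Omega(u,v)=\mathrm{Re}\int_{\mathbb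 R^3} i u\bar v\,dx$. For $\omega$ near $\omega_*$ let $\Psi_2(\omega)=\partial_\omega\phi_\omega$ and let $\Psi_3(\omega),\Psi_4(\omega)\in H^1_{\mathrm{rad}}(\mathbb R^3,\mathbb C)$ depend smoothly on $\omega$ and satisfy (in the sense of distributions) $\mathcal L_\omega\Psi_4=\Psi_3$ and $\mathcal L_\omega\Psi_3=\Psi_2+a\Psi_4$, where $a(\omega)=-A(\omega)^{-1}q'(\omega)$ and $A(\omega)=\Omega(\Psi_2(\omega),\Psi_3(\omega))$. Fix $N\ge2$ and real functions $e_m(Q,\omega,\rho)$, $2\le m\le N$, that are smooth and bounded near $(q(\omega_*),\omega_*,0)$, with moreover $|e_2(Q,\omega,\rho)|\lesssim |Q-q(\omega_*)|^{1/2}+|\omega-\omega_*|+|\rho|^{1/2}$ there. Let $$E_{f,N}(Q,\omega,\lambda,\rho)=d(\omega)-\omega Q+(\omega-\omega_*)\rho+\tfrac12A(\omega)\lambda^2+\sum_{m=2}^N\lambda^m e_m(Q,\omega,\rho),\qquad V_Q(\omega)=d(\omega)-\omega Q .$$ **Proposition 2.8.** There exist $\delta>0$ with $(\omega_*-\delta,\omega_*+\delta)\subset\mathcal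 O$ and $\epsilon_0>0$ such that the following holds for all $Q$ with $0<Q-q(\omega_*)<\epsilon_0^2$. The equation $q(\omega)=Q$ has exactly two solutions $\omega_\pm=\omega_{Q,\pm}$ with $|\omega-\omega_*|<\delta$, and $\omega_-<\omega_*<\omega_+$. Write $E_Q(\omega,\lambda)=E_{f,N}(Q,\omega,\lambda,0)-V_Q(\omega_+)$. Let $c\in(0,1)$ and let $(\omega_0,\lambda_0)$ satisfy $|\omega_0-\omega_*|<\delta$, $|\lambda_0|<\delta$, $$\omega_0>\omega_-\quad\text{and}\quad 0<E_Q(\omega_0,\lambda_0)<c\,\big(V_Q(\omega_-)-V_Q(\omega_+)\big).$$ Then the system $$\dot\omega_f=A(\omega_f)^{-1}\partial_\lambda E_{f,N}(Q,\omega_f,\lambda_f,0),\qquad \dot\lambda_f=-A(\omega_f)^{-1}\partial_\omega E_{f,N}(Q,\omega_f,\lambda_f,0),\qquad (\omega_f,\lambda_f)(0)=(\omega_0,\lambda_0)$$ has exactly one solution defined for all $t\in\mathbb R$; it is periodic and non-constant, and its least period $T_f>0$ satisfies $$C^{-1}(Q-q(\omega_*))^{-1/4}\le T_f\le C\,(Q-q(\omega_*))^{-1/4},$$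 where $C>0$ may depend on $c$ (and on the fixed data $g$, $\phi$, $\Psi_3$, $\Psi_4$, $N$, $e_m$) but not on $Q$, $\omega_0$, $\lambda_0$; $\delta$ and $\epsilon_0$ do not depend on $c$. -/

import Mathlib

namespace NLSOscillation

noncomputable section

open MeasureTheory

/-! ### The Sobolev space `H¹(ℝ³)` -/

/-- Physical space `ℝ³` with its Euclidean norm. -/
abbrev E3 : Type := EuclideanSpace ℝ (Fin 3)

/-- Test functions: smooth real functions with compact support. -/
def IsTest (ψ : E3 → ℝ) : Prop := ContDiff ℝ (⊤ : ℕ∞) ψ ∧ HasCompactSupport ψ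

/-- The partial derivative `∂_j ψ`. -/
def partialD (j : Fin 3) (ψ : E3 → ℝ) (x : E3) : ℝ :=
  fderiv ℝ ψ x (EuclideanSpace.single j 1)

/-- `v` is the weak partial derivative `∂_j u`. -/
def IsWeakPartial {F : Type*} [NormedAddCommGroup F] [NormedSpace ℝ F]
    (j : Fin 3) (u v : E3 → F) : Prop :=
  ∀ ψ : E3 → ℝ, IsTest ψ → ∫ x, partialD j ψ x • u x = -∫ x, ψ x • v x

theorem IsTest.memLp {ψ : E3 → ℝ} (h : IsTest ψ) : MemLp ψ 2 volume :=
  h.1.continuous.memLp_of_hasCompactSupport h.2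

theorem IsTest.memLp_partialD {ψ : E3 → ℝ} (h : IsTest ψ) (j : Fin 3) :
    MemLp (partialD j ψ) 2 volume := by
  refine Continuous.memLp_of_hasCompactSupport ?_ ?_
  · exact (h.1.continuous_fderiv (by simp)).clm_apply continuous_const
  · exact (h.2.fderiv_apply ℝ (EuclideanSpace.single j 1))

theorem integrable_smul_Lp {F : Type*} [NormedAddCommGroup F] [NormedSpace ℝ F]
    {ψ : E3 → ℝ} (h : MemLp ψ 2 volume) (u : Lp F 2 (volume : Measure E3)) :
    Integrable (fun x => ψ x • u x) :=
  memLp_one_iff_integrable.1 ((Lp.memLp u).smul h)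

/-- `H¹(ℝ³, F)` as a space of pairs of an `L²` function and its weak gradient, again in `L²`.
The norm inherited from the product is the maximum of the `L²` norms of `u`, `∂₁u`, `∂₂u`, `∂₃u`,
which is equivalent to the usual `H¹` norm. -/
def H1Submodule (F : Type) [NormedAddCommGroup F] [NormedSpace ℝ F] :
    Submodule ℝ (Lp F 2 (volume : Measure E3) × (Fin 3 → Lp F 2 (volume : Measure E3))) where
  carrier := {p | ∀ j, IsWeakPartial j (p.1 : E3 → F) (p.2 j : E3 → F)}
  zero_mem' := by
    intro j ψ _
    have h0 := Lp.coeFn_zero F 2 (volume : Measure E3)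
    have h1 : (fun x => partialD j ψ x • (0 : Lp F 2 (volume : Measure E3)) x) =ᵐ[volume] 0 := by
      filter_upwards [h0] with x hx
      rw [hx]
      simp
    have h2 : (fun x => ψ x • (0 : Lp F 2 (volume : Measure E3)) x) =ᵐ[volume] 0 := by
      filter_upwards [h0] with x hx
      rw [hx]
      simp
    change ∫ x, partialD j ψ x • (0 : Lp F 2 (volume : Measure E3)) x
      = -∫ x, ψ x • (0 : Lp F 2 (volume : Measure E3)) x
    rw [integral_congr_ae h1, integral_congr_ae h2]
    simp
  add_mem' := by
    intro a b ha hb j ψ hψ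
    have h1 : (fun x => partialD j ψ x • (a.1 + b.1) x) =ᵐ[volume]
        fun x => partialD j ψ x • a.1 x + partialD j ψ x • b.1 x := by
      filter_upwards [Lp.coeFn_add a.1 b.1] with x hx
      rw [hx, Pi.add_apply, smul_add]
    have h2 : (fun x => ψ x • (a.2 j + b.2 j) x) =ᵐ[volume]
        fun x => ψ x • a.2 j x + ψ x • b.2 j x := by
      filter_upwards [Lp.coeFn_add (a.2 j) (b.2 j)] with x hx
      rw [hx, Pi.add_apply, smul_add]
    change ∫ x, partialD j ψ x • (a.1 + b.1) x = -∫ x, ψ x • (a.2 j + b.2 j) x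
    rw [integral_congr_ae h1, integral_congr_ae h2,
      integral_add (integrable_smul_Lp (hψ.memLp_partialD j) _)
        (integrable_smul_Lp (hψ.memLp_partialD j) _),
      integral_add (integrable_smul_Lp hψ.memLp _) (integrable_smul_Lp hψ.memLp _),
      ha j ψ hψ, hb j ψ hψ, neg_add]
  smul_mem' := by
    intro c a ha j ψ hψ
    have h1 : (fun x => partialD j ψ x • (c • a.1) x) =ᵐ[volume]
        fun x => c • (partialD j ψ x • a.1 x) := by
      filter_upwards [Lp.coeFn_smul c a.1] with x hx
      rw [hx, Pi.smul_apply, smul_comm]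
    have h2 : (fun x => ψ x • (c • a.2 j) x) =ᵐ[volume] fun x => c • (ψ x • a.2 j x) := by
      filter_upwards [Lp.coeFn_smul c (a.2 j)] with x hx
      rw [hx, Pi.smul_apply, smul_comm]
    change ∫ x, partialD j ψ x • (c • a.1) x = -∫ x, ψ x • (c • a.2 j) x
    rw [integral_congr_ae h1, integral_congr_ae h2, integral_smul, integral_smul,
      ha j ψ hψ, smul_neg]

/-- The Sobolev space `H¹(ℝ³, F)`. -/
abbrev H1 (F : Type) [NormedAddCommGroup F] [NormedSpace ℝ F] : Type := ↥(H1Submodule F)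

/-- The underlying function of an element of `H¹`. -/
def H1.fn {F : Type} [NormedAddCommGroup F] [NormedSpace ℝ F] (u : H1 F) : E3 → F :=
  (u.1.1 : E3 → F)

/-- The weak partial derivative `∂_j u` of an element of `H¹`. -/
def H1.grad {F : Type} [NormedAddCommGroup F] [NormedSpace ℝ F] (u : H1 F) (j : Fin 3) : E3 → F :=
  (u.1.2 j : E3 → F)

/-- Radial symmetry (of a class of functions modulo null sets). -/
def IsRadial {F : Type*} (f : E3 → F) : Prop :=
  ∀ R : E3 ≃ₗᵢ[ℝ] E3, (fun x => f (R x)) =ᵐ[volume] f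

/-! ### The nonlinearity, energy and mass -/

/-- `g ∈ C^∞([0,∞), ℝ)`, `g(0) = 0`, and for some `p < 2` one has
`|g^{(n)}(s)| ≤ C_n s^{p-n}` for all `s ≥ 1` and all `n`. -/
structure IsNonlinearity (g : ℝ → ℝ) : Prop where
  smooth : ContDiffOn ℝ (⊤ : ℕ∞) g (Set.Ici 0)
  zero : g 0 = 0
  growth : ∃ p : ℝ, p < 2 ∧ ∀ n : ℕ, ∃ C : ℝ, 0 < C ∧ ∀ s : ℝ, 1 ≤ s →
    |iteratedDerivWithin n g (Set.Ici 0) s| ≤ C * s ^ (p - n)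

/-- The derivative `g'` on `[0,∞)`. -/
def gDeriv (g : ℝ → ℝ) (s : ℝ) : ℝ := derivWithin g (Set.Ici 0) s

/-- The energy `E(u) = ½ ∫ |∇u|² + ½ ∫ G(|u|²)`, with `G(s) = ∫₀ˢ g`. -/
def energy {F : Type} [NormedAddCommGroup F] [NormedSpace ℝ F] (g : ℝ → ℝ) (u : H1 F) : ℝ :=
  1 / 2 * (∑ j : Fin 3, ∫ x, ‖u.grad j x‖ ^ 2)
    + 1 / 2 * ∫ x, ∫ τ in (0 : ℝ)..(‖u.fn x‖ ^ 2), g τ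

/-- The mass `Q(u) = ½ ∫ |u|²`. -/
def mass {F : Type} [NormedAddCommGroup F] [NormedSpace ℝ F] (u : H1 F) : ℝ :=
  1 / 2 * ∫ x, ‖u.fn x‖ ^ 2

/-! ### Ground states -/

/-- `φ` is a weak solution of `0 = -Δφ + ω φ + g(φ²) φ`. -/
def SolvesGroundStateEq (g : ℝ → ℝ) (ω : ℝ) (φ : H1 ℝ) : Prop :=
  ∀ ψ : E3 → ℝ, IsTest ψ →
    (∑ j : Fin 3, ∫ x, partialD j ψ x * φ.grad j x)
      + ∫ x, ψ x * (ω * φ.fn x + g (φ.fn x ^ 2) * φ.fn x) = 0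

/-- A `C²` family `O ∋ ω ↦ φ_ω ∈ H¹_rad(ℝ³, ℝ)` of positive solutions, with `O ⊆ (0,∞)` an
open interval. -/
structure IsGroundStateFamily (g : ℝ → ℝ) (O : Set ℝ) (φ : ℝ → H1 ℝ) : Prop where
  isOpen : IsOpen O
  ordConnected : O.OrdConnected
  pos_freq : O ⊆ Set.Ioi 0
  contDiffOn : ContDiffOn ℝ 2 φ O
  radial : ∀ ω ∈ O, IsRadial (φ ω).fn
  pos : ∀ ω ∈ O, ∀ᵐ x, 0 < (φ ω).fn x
  solves : ∀ ω ∈ O, SolvesGroundStateEq g ω (φ ω)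

/-- `q(ω) = ½ ‖φ_ω‖²_{L²}`. -/
def qFun (φ : ℝ → H1 ℝ) (ω : ℝ) : ℝ := mass (φ ω)

/-- `d(ω) = E(φ_ω) + ω Q(φ_ω)`. -/
def dFun (g : ℝ → ℝ) (φ : ℝ → H1 ℝ) (ω : ℝ) : ℝ := energy g (φ ω) + ω * mass (φ ω)

/-! ### The linearized operator and the frame defining `A(ω)`

A `ℂ`-valued function `u` is identified with the `ℂ²`-valued function `(u, ū)`. -/

/-- The symplectic form `Ω(u, v) = ⟨i σ₃ (u,ū), σ₁ (v,v̄)⟩ = Re ∫ i u v̄`. -/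
def symp (u v : E3 → ℂ) : ℝ := ∫ x, (Complex.I * u x * (starRingEnd ℂ) (v x)).re

/-- `-i 𝓗_ω u = v` in the sense of distributions, where `𝓗_ω = σ₃ H_ω` and
`H_ω = -Δ + ω + g(φ²) + g'(φ²) φ² + g'(φ²) φ² σ₁`; on `(u, ū)` the matrix `σ₁` acts as `u ↦ ū`. -/
def IsLinearizedImage (g : ℝ → ℝ) (ω : ℝ) (φ : H1 ℝ) (u : H1 ℂ) (v : E3 → ℂ) : Prop :=
  ∀ ψ : E3 → ℝ, IsTest ψ →
    -Complex.I *
      ((∑ j : Fin 3, ∫ x, partialD j ψ x • u.grad j x)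
        + ∫ x, ψ x •
          ((ω + g (φ.fn x ^ 2) + gDeriv g (φ.fn x ^ 2) * φ.fn x ^ 2) • u.fn x
            + (gDeriv g (φ.fn x ^ 2) * φ.fn x ^ 2) • (starRingEnd ℂ) (u.fn x)))
      = ∫ x, ψ x • v x

/-- `Ψ₂(ω) = ∂_ω φ_ω`, as a complex-valued function. -/
def Psi2 (φ : ℝ → H1 ℝ) (ω : ℝ) (x : E3) : ℂ := ((deriv φ ω).fn x : ℂ)

/-- `A(ω) = Ω(Ψ₂(ω), Ψ₃(ω))`. -/
def AFun (φ : ℝ → H1 ℝ) (Ψ₃ : ℝ → H1 ℂ) (ω : ℝ) : ℝ := symp (Psi2 φ ω) (Ψ₃ ω).fn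

/-- `Ψ₃`, `Ψ₄` complete `Ψ₁ = i φ_ω`, `Ψ₂ = ∂_ω φ_ω` to a smooth frame near `ω_*` in which
`-i 𝓗_ω` has the matrix with `-i𝓗_ω Ψ₃ = Ψ₂ + a(ω) Ψ₄`, `-i𝓗_ω Ψ₄ = Ψ₃`,
`a(ω) = -A(ω)⁻¹ q'(ω)`. -/
structure IsFrame (g : ℝ → ℝ) (φ : ℝ → H1 ℝ) (ωs r : ℝ) (Ψ₃ Ψ₄ : ℝ → H1 ℂ) : Prop where
  smooth₃ : ContDiffOn ℝ (⊤ : ℕ∞) Ψ₃ (Metric.ball ωs r)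
  smooth₄ : ContDiffOn ℝ (⊤ : ℕ∞) Ψ₄ (Metric.ball ωs r)
  radial₃ : ∀ ω ∈ Metric.ball ωs r, IsRadial (Ψ₃ ω).fn
  radial₄ : ∀ ω ∈ Metric.ball ωs r, IsRadial (Ψ₄ ω).fn
  image₃ : ∀ ω ∈ Metric.ball ωs r, IsLinearizedImage g ω (φ ω) (Ψ₃ ω)
    (fun x => Psi2 φ ω x + (-(AFun φ Ψ₃ ω)⁻¹ * deriv (qFun φ) ω) • (Ψ₄ ω).fn x)
  image₄ : ∀ ω ∈ Metric.ball ωs r, IsLinearizedImage g ω (φ ω) (Ψ₄ ω) (Ψ₃ ω).fn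

/-! ### The reduced Hamiltonian system -/

/-- The symbol class `S⁰_{i,0}` for functions of `(Q, ω, ρ)`: smooth near `(q_*, ω_*, 0)` and
`O((|Q - q_*|^{1/2} + |ω - ω_*| + |ρ|^{1/2})^i)` there. -/
def IsSymbol (qs ωs : ℝ) (i : ℕ) (f : ℝ → ℝ → ℝ → ℝ) : Prop :=
  ∃ r > 0,
    ContDiffOn ℝ (⊤ : ℕ∞) (fun p : ℝ × ℝ × ℝ => f p.1 p.2.1 p.2.2) (Metric.ball (qs, ωs, 0) r) ∧
    ∃ C : ℝ, ∀ p ∈ Metric.ball ((qs, ωs, 0) : ℝ × ℝ × ℝ) r,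
      |f p.1 p.2.1 p.2.2| ≤ C * (√|p.1 - qs| + |p.2.1 - ωs| + √|p.2.2|) ^ i

/-- Admissible higher order coefficients: `e₂ ∈ S⁰_{1,0}` and `e_m ∈ S⁰_{0,0}` for
`3 ≤ m ≤ N`. -/
def IsCoefficients (qs ωs : ℝ) (N : ℕ) (e : ℕ → ℝ → ℝ → ℝ → ℝ) : Prop :=
  IsSymbol qs ωs 1 (e 2) ∧ ∀ m, 3 ≤ m → m ≤ N → IsSymbol qs ωs 0 (e m)

/-- The potential energy `V_Q(ω) = d(ω) - ω Q`. -/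
def potential (d : ℝ → ℝ) (Q ω : ℝ) : ℝ := d ω - ω * Q

/-- The finite dimensional energy
`E_{f,N}(Q,ω,λ,ρ) = d(ω) - ωQ + (ω - ω_*)ρ + ½ A(ω) λ² + ∑_{m=2}^N λ^m e_m(Q,ω,ρ)`. -/
def finiteEnergy (A d : ℝ → ℝ) (ωs : ℝ) (N : ℕ) (e : ℕ → ℝ → ℝ → ℝ → ℝ) (Q ω l ρ : ℝ) : ℝ :=
  d ω - ω * Q + (ω - ωs) * ρ + 1 / 2 * A ω * l ^ 2
    + ∑ m ∈ Finset.Icc 2 N, l ^ m * e m Q ω ρ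

/-- `γ = (ω_f, λ_f)` solves, for all times,
`ω' = A(ω)⁻¹ ∂_λ E_{f,N}(Q,ω,λ,0)`, `λ' = -A(ω)⁻¹ ∂_ω E_{f,N}(Q,ω,λ,0)` with
`(ω,λ)(0) = (ω₀,λ₀)`. -/
def IsReducedSolution (A d : ℝ → ℝ) (ωs : ℝ) (N : ℕ) (e : ℕ → ℝ → ℝ → ℝ → ℝ)
    (Q ω₀ l₀ : ℝ) (γ : ℝ → ℝ × ℝ) : Prop :=
  γ 0 = (ω₀, l₀) ∧
  ∀ t : ℝ, HasDerivAt γ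
    ((A (γ t).1)⁻¹ * deriv (fun l => finiteEnergy A d ωs N e Q (γ t).1 l 0) (γ t).2,
      -(A (γ t).1)⁻¹ * deriv (fun ω => finiteEnergy A d ωs N e Q ω (γ t).2 0) (γ t).1) t

end

end NLSOscillation

namespace NLSOscillation

open MeasureTheory Filter Topology Function
open scoped Convolution ENNReal

/-! ### Mollification in `L²(ℝ³)` -/

/-! The reduced system is Hamiltonian for the form `A(ω) dω ∧ dλ`, with energy `V_Q(ω) + λ² κ(ω, λ)`
and `κ` close to `A(ω_*)/2`. Each `φ_ω` is a critical point of energy plus `ω` times mass, so `d' =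
q` (`hasDerivAt_dFun`) and `V_Q' = q - Q`. As `q` has a nondegenerate minimum at `ω_*`, `V_Q'`
behaves like `(ω - ω_-)(ω - ω_+)`: a barrier at `ω_-` and a well at `ω_+`.

Let `y(ω)` be the increasing signed root of `y²/2 = V_Q(ω) - V_Q(ω_+)` (`exists_signed_sqrt`) and
let `μ = λ √(2κ)`. The energy is then a constant plus `(y² + μ²)/2`, and in the coordinates `(y, μ)`
the field is a rotation with angular speed `F = A⁻¹ y' ∂_λ μ > 0`
(`triangular_apply_hamiltonianField`, `exists_rotationChart`). A level below the barrier is a full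
circle, and the least period is `∫ dθ / F` over one turn (`IsRotationChart.exists_unique_periodic`).
Only `C¹` regularity of `A` and `κ` is available, so the field is only known to be continuous, and
uniqueness is read off from the rotation instead of a Lipschitz bound.

For the size of the period, `F` is comparable to `y' = V'/√(2V)`, where `V` is measured from its
minimum. With `w = ω_+ - ω_-` and `s = ω - ω_+` one has `|V'| ~ |s| (s + w)` and `V ~ s² w` on the
relevant range. Energy below the fraction `c` of the barrier keeps `s + w` comparable to `w`
(`barrier_gap`), which is the only place where `c` matters. Hence `y' ~ √w`, and `w² ~ Q - q(ω_*)`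
gives the exponent `1/4` (`speed_bounds`, `speed_comparable`).

All this needs `A(ω_*) > 0` (`AFun_pos`). At `ω_*` the coefficient `a` vanishes, so `v = Im Ψ₃`
solves `L v = ∂_ω φ` with `L = -Δ + ω + g(φ²)`, and `A = ⟨L v, v⟩`. Since `L` annihilates the
positive function `φ`, its form is nonnegative by Picone's identity (`form_nonneg_of_pos_solution`).
If `A` vanished, `v` would be a null vector of the form, so `∂_ω φ = L v = 0`; differentiating the
equation for `φ_ω` in `ω` excludes this (`deriv_ne_zero`).

The analytic background is the density of test functions in `H¹` and the Sobolev embedding into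
`L⁶`. They make potentials of size `1 + φ⁴` bounded forms on `H¹`, extend the weak equations to all
of `H¹`, and make the energy differentiable. -/

theorem eLpNorm_two_eq {f : E3 → ℝ} (hf : MemLp f 2 volume) :
    eLpNorm f 2 volume = ENNReal.ofReal √(∫ x, f x ^ 2) := by
  rw [hf.eLpNorm_eq_integral_rpow_norm (by norm_num) (by norm_num), Real.sqrt_eq_rpow]
  simp [sq_abs]

theorem eLpNorm_two_le {f g : E3 → ℝ} (hf : MemLp f 2 volume) (hg : MemLp g 2 volume)
    (h : ∫ x, f x ^ 2 ≤ ∫ x, g x ^ 2) : eLpNorm f 2 volume ≤ eLpNorm g 2 volume := by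
  rw [eLpNorm_two_eq hf, eLpNorm_two_eq hg]
  exact ENNReal.ofReal_le_ofReal (Real.sqrt_le_sqrt h)

/-- Nonnegative continuous compactly supported kernels of unit mass. -/
structure IsKernel (ρ : E3 → ℝ) : Prop where
  cont : Continuous ρ
  supp : HasCompactSupport ρ
  nonneg : ∀ x, 0 ≤ ρ x
  mass : ∫ x, ρ x = 1

theorem IsKernel.integrable {ρ : E3 → ℝ} (h : IsKernel ρ) : Integrable ρ :=
  h.cont.integrable_of_hasCompactSupport h.supp

theorem IsKernel.integrable_mul {ρ : E3 → ℝ} (h : IsKernel ρ) {f : E3 → ℝ}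
    (hf : LocallyIntegrable f volume) (x : E3) : Integrable fun t => ρ t * f (x - t) :=
  h.supp.convolutionExists_left (ContinuousLinearMap.lsmul ℝ ℝ) h.cont hf x

/-- Jensen's inequality for the probability density `ρ`: the variance of `t ↦ f (x - t)` is
nonnegative. -/
theorem IsKernel.sq_convolution_le {ρ : E3 → ℝ} (h : IsKernel ρ) {f : E3 → ℝ}
    (hf : MemLp f 2 volume) (x : E3) :
    (ρ ⋆[ContinuousLinearMap.lsmul ℝ ℝ] f) x ^ 2 ≤
      (ρ ⋆[ContinuousLinearMap.lsmul ℝ ℝ] fun y => f y ^ 2) x := by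
  simp only [convolution_lsmul, smul_eq_mul]
  have h1 := h.integrable_mul (hf.locallyIntegrable one_le_two) x
  have h2 := h.integrable_mul (hf.integrable_sq.locallyIntegrable) x
  set a := ∫ t, ρ t * f (x - t) with ha
  have h3 : 0 ≤ ∫ t, ρ t * (f (x - t) - a) ^ 2 :=
    integral_nonneg fun t => mul_nonneg (h.nonneg t) (sq_nonneg _)
  have h4 : ∫ t, ρ t * (f (x - t) - a) ^ 2 = (∫ t, ρ t * f (x - t) ^ 2) - a ^ 2 := by
    have : (fun t => ρ t * (f (x - t) - a) ^ 2) =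
        fun t => ρ t * f (x - t) ^ 2 - 2 * a * (ρ t * f (x - t)) + a ^ 2 * ρ t := by
      ext t; ring
    have h5 : Integrable fun t => ρ t * f (x - t) ^ 2 - 2 * a * (ρ t * f (x - t)) :=
      h2.sub (h1.const_mul _)
    rw [this, integral_add h5 (h.integrable.const_mul _), integral_sub h2 (h1.const_mul _), integral_const_mul, integral_const_mul, h.mass, ← ha]
    ring
  linarith

theorem IsKernel.memLp_convolution {ρ : E3 → ℝ} (h : IsKernel ρ) {f : E3 → ℝ}
    (hf : MemLp f 2 volume) : MemLp (ρ ⋆[ContinuousLinearMap.lsmul ℝ ℝ] f) 2 volume := by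
  have hc : Continuous (ρ ⋆[ContinuousLinearMap.lsmul ℝ ℝ] f) :=
    h.supp.continuous_convolution_left _ h.cont (hf.locallyIntegrable one_le_two)
  rw [memLp_two_iff_integrable_sq hc.aestronglyMeasurable]
  refine (h.integrable.integrable_convolution (ContinuousLinearMap.lsmul ℝ ℝ)
    hf.integrable_sq).mono' (hc.pow 2).aestronglyMeasurable (Eventually.of_forall fun x => ?_)
  rw [Real.norm_eq_abs, abs_of_nonneg (sq_nonneg _)]
  exact h.sq_convolution_le hf x

/-- Integrate the pointwise Jensen bound; convolution with a kernel of unit mass preserves `∫ f²`.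
The contraction constant is uniform in the kernel, which the density argument below requires. -/
theorem IsKernel.eLpNorm_convolution_le {ρ : E3 → ℝ} (h : IsKernel ρ) {f : E3 → ℝ}
    (hf : MemLp f 2 volume) :
    eLpNorm (ρ ⋆[ContinuousLinearMap.lsmul ℝ ℝ] f) 2 volume ≤ eLpNorm f 2 volume := by
  refine eLpNorm_two_le (h.memLp_convolution hf) hf ?_
  calc ∫ x, (ρ ⋆[ContinuousLinearMap.lsmul ℝ ℝ] f) x ^ 2
      ≤ ∫ x, (ρ ⋆[ContinuousLinearMap.lsmul ℝ ℝ] fun y => f y ^ 2) x :=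
        integral_mono (h.memLp_convolution hf).integrable_sq
          (h.integrable.integrable_convolution _ hf.integrable_sq) (h.sq_convolution_le hf)
    _ = ∫ x, f x ^ 2 := by
        rw [integral_convolution _ h.integrable hf.integrable_sq, h.mass]
        simp

/-- Smooth bumps concentrating at the origin. -/
noncomputable def shrinkingBump (n : ℕ) : ContDiffBump (0 : E3) where
  rIn := 1 / (n + 2)
  rOut := 1 / (n + 1)
  rIn_pos := by positivity
  rIn_lt_rOut := by gcongr; norm_num

/-- The associated mollifiers. -/
noncomputable def mollifier (n : ℕ) : E3 → ℝ := (shrinkingBump n).normed volume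

theorem isTest_mollifier (n : ℕ) : IsTest (mollifier n) :=
  ⟨(shrinkingBump n).contDiff_normed, (shrinkingBump n).hasCompactSupport_normed⟩

theorem isKernel_mollifier (n : ℕ) : IsKernel (mollifier n) :=
  ⟨(shrinkingBump n).continuous_normed, (shrinkingBump n).hasCompactSupport_normed,
    (shrinkingBump n).nonneg_normed, (shrinkingBump n).integral_normed⟩

/-- Uniform continuity gives uniform convergence, and all mollified functions live in one ball of
radius `R + 1`, because the mollifiers are supported in the unit ball. Uniform smallness on a set of
finite measure controls the `L²` norm. -/
theorem tendsto_mollify_of_continuous {f : E3 → ℝ} (hf : Continuous f) (hs : HasCompactSupport f) :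
    Tendsto (fun n => eLpNorm ((mollifier n ⋆[ContinuousLinearMap.lsmul ℝ ℝ] f) - f) 2 volume)
      atTop (𝓝 0) := by
  have hu := hs.uniformContinuous_of_continuous hf
  obtain ⟨R, hR⟩ := hs.isCompact.isBounded.subset_closedBall (0 : E3)
  set s : Set E3 := Metric.closedBall 0 (R + 1)
  have hsub : support f ⊆ s := (subset_tsupport f).trans
    (hR.trans (Metric.closedBall_subset_closedBall (by linarith)))
  have hsubn : ∀ n, support (mollifier n ⋆[ContinuousLinearMap.lsmul ℝ ℝ] f) ⊆ s := by
    intro n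
    refine (support_convolution_subset _).trans ?_
    rintro _ ⟨a, ha, b, hb, rfl⟩
    have h1 : ‖a‖ ≤ 1 := by
      rw [mollifier, ContDiffBump.support_normed_eq] at ha
      have : (shrinkingBump n).rOut ≤ 1 := by
        simp only [shrinkingBump]
        rw [div_le_one (by positivity)]; linarith [n.cast_nonneg (α := ℝ)]
      exact (mem_ball_zero_iff.1 ha).le.trans this
    have h2 : ‖b‖ ≤ R := mem_closedBall_zero_iff.1 (hR (subset_tsupport f hb))
    exact mem_closedBall_zero_iff.2 ((norm_add_le a b).trans (by linarith))
  have hfin : (volume s) ^ (1 / (2 : ℝ≥0∞).toReal) ≠ ∞ :=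
    ENNReal.rpow_ne_top_of_nonneg (by norm_num) measure_closedBall_lt_top.ne
  have key : ∀ c : ℝ, 0 < c → ∀ᶠ n in atTop,
      eLpNorm ((mollifier n ⋆[ContinuousLinearMap.lsmul ℝ ℝ] f) - f) 2 volume
        ≤ ENNReal.ofReal c * (volume s) ^ (1 / (2 : ℝ≥0∞).toReal) := by
    intro c hc
    obtain ⟨η, hη, hd⟩ := Metric.uniformContinuous_iff.1 hu c hc
    have ht : Tendsto (fun n : ℕ => 1 / ((n : ℝ) + 1)) atTop (𝓝 0) :=
      tendsto_one_div_add_atTop_nhds_zero_nat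
    filter_upwards [ht.eventually_lt_const hη] with n hn
    refine eLpNorm_sub_le_of_dist_bdd _ (by norm_num) measurableSet_closedBall hc.le
      (fun x => ?_) (hsubn n) hsub
    refine ContDiffBump.dist_normed_convolution_le hf.aestronglyMeasurable fun y hy => ?_
    exact (hd (lt_trans (Metric.mem_ball.1 hy) hn)).le
  rw [ENNReal.tendsto_nhds_zero]
  intro ε hε
  set M := (volume s) ^ (1 / (2 : ℝ≥0∞).toReal)
  obtain ⟨c, hc, hcε⟩ : ∃ c : ℝ, 0 < c ∧ ENNReal.ofReal c * M ≤ ε := by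
    have : Tendsto (fun c : ℝ => ENNReal.ofReal c * M) (𝓝[>] 0) (𝓝 (ENNReal.ofReal 0 * M)) :=
      ((ENNReal.continuous_mul_const hfin).comp ENNReal.continuous_ofReal).continuousAt.tendsto.mono_left
        nhdsWithin_le_nhds
    rw [ENNReal.ofReal_zero, zero_mul] at this
    obtain ⟨c, h1, h2⟩ := ((ENNReal.tendsto_nhds_zero.1 this ε hε).and self_mem_nhdsWithin).exists
    exact ⟨c, h2, h1⟩
  filter_upwards [key c hc] with n hn using hn.trans hcε

/-- An `ε/3` argument: approximate by a continuous compactly supported function and use that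
mollification contracts `L²`. -/
theorem tendsto_mollify {f : E3 → ℝ} (hf : MemLp f 2 volume) :
    Tendsto (fun n => eLpNorm ((mollifier n ⋆[ContinuousLinearMap.lsmul ℝ ℝ] f) - f) 2 volume)
      atTop (𝓝 0) := by
  rw [ENNReal.tendsto_nhds_zero]
  intro ε hε
  have hε3 : ε / 3 ≠ 0 := (ENNReal.div_pos hε.ne' (by norm_num)).ne'
  obtain ⟨g, hgs, hfg, hgc, hg⟩ := hf.exists_hasCompactSupport_eLpNorm_sub_le (by norm_num) hε3
  filter_upwards [ENNReal.tendsto_nhds_zero.1 (tendsto_mollify_of_continuous hgc hgs) (ε / 3)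
    (pos_iff_ne_zero.2 hε3)] with n hn
  have hk := isKernel_mollifier n
  have e1 : (mollifier n ⋆[ContinuousLinearMap.lsmul ℝ ℝ] f) - f =
      (mollifier n ⋆[ContinuousLinearMap.lsmul ℝ ℝ] (f - g)) +
        (((mollifier n ⋆[ContinuousLinearMap.lsmul ℝ ℝ] g) - g) + (g - f)) := by
    have : mollifier n ⋆[ContinuousLinearMap.lsmul ℝ ℝ] f =
        (mollifier n ⋆[ContinuousLinearMap.lsmul ℝ ℝ] (f - g)) +
          (mollifier n ⋆[ContinuousLinearMap.lsmul ℝ ℝ] g) := by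
      rw [← ConvolutionExists.distrib_add, sub_add_cancel]
      · exact fun x => hk.integrable_mul ((hf.sub hg).locallyIntegrable one_le_two) x
      · exact fun x => hk.integrable_mul (hg.locallyIntegrable one_le_two) x
    rw [this]; abel
  rw [e1]
  have m1 := hk.memLp_convolution (hf.sub hg)
  have m2 := (hk.memLp_convolution hg).sub hg
  have m3 := hg.sub hf
  calc _ ≤ eLpNorm (mollifier n ⋆[ContinuousLinearMap.lsmul ℝ ℝ] (f - g)) 2 volume +
        (eLpNorm ((mollifier n ⋆[ContinuousLinearMap.lsmul ℝ ℝ] g) - g) 2 volume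
          + eLpNorm (g - f) 2 volume) :=
        (eLpNorm_add_le m1.1 (m2.add m3).1 one_le_two).trans
          (by gcongr; exact eLpNorm_add_le m2.1 m3.1 one_le_two)
    _ ≤ ε / 3 + (ε / 3 + ε / 3) := by
        gcongr
        · exact (hk.eLpNorm_convolution_le (hf.sub hg)).trans hfg
        · rw [eLpNorm_sub_comm]; exact hfg
    _ = ε := by rw [← add_assoc]; exact ENNReal.add_thirds ε

end NLSOscillation

namespace NLSOscillation

open MeasureTheory Filter Topology Function
open scoped Convolution ENNReal

/-! ### Density of test functions in `H¹` -/

theorem IsWeakPartial.congr {F : Type*} [NormedAddCommGroup F] [NormedSpace ℝ F] {j : Fin 3}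
    {u v u' v' : E3 → F} (h : IsWeakPartial j u v) (hu : u' =ᵐ[volume] u) (hv : v' =ᵐ[volume] v) :
    IsWeakPartial j u' v' := by
  intro ψ hψ
  have h1 : (fun x => partialD j ψ x • u' x) =ᵐ[volume] fun x => partialD j ψ x • u x := by
    filter_upwards [hu] with x hx
    rw [hx]
  have h2 : (fun x => ψ x • v' x) =ᵐ[volume] fun x => ψ x • v x := by
    filter_upwards [hv] with x hx
    rw [hx]
  rw [integral_congr_ae h1, integral_congr_ae h2]
  exact h ψ hψ

/-- The element of `H¹` given by a function and its weak gradient. -/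
noncomputable def H1.of {u : E3 → ℝ} {v : Fin 3 → E3 → ℝ} (hu : MemLp u 2 volume)
    (hv : ∀ j, MemLp (v j) 2 volume) (h : ∀ j, IsWeakPartial j u (v j)) : H1 ℝ :=
  ⟨(hu.toLp u, fun j => (hv j).toLp (v j)), fun j =>
    (h j).congr hu.coeFn_toLp (hv j).coeFn_toLp⟩

theorem H1.fn_of {u : E3 → ℝ} {v : Fin 3 → E3 → ℝ} (hu : MemLp u 2 volume)
    (hv : ∀ j, MemLp (v j) 2 volume) (h : ∀ j, IsWeakPartial j u (v j)) :
    (H1.of hu hv h).fn =ᵐ[volume] u := hu.coeFn_toLp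

theorem H1.grad_of {u : E3 → ℝ} {v : Fin 3 → E3 → ℝ} (hu : MemLp u 2 volume)
    (hv : ∀ j, MemLp (v j) 2 volume) (h : ∀ j, IsWeakPartial j u (v j)) (j : Fin 3) :
    (H1.of hu hv h).grad j =ᵐ[volume] v j := (hv j).coeFn_toLp

theorem H1.memLp_fn {F : Type} [NormedAddCommGroup F] [NormedSpace ℝ F] (u : H1 F) :
    MemLp u.fn 2 volume := Lp.memLp _

theorem H1.memLp_grad {F : Type} [NormedAddCommGroup F] [NormedSpace ℝ F] (u : H1 F) (j : Fin 3) :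
    MemLp (u.grad j) 2 volume := Lp.memLp _

theorem H1.weakPartial {F : Type} [NormedAddCommGroup F] [NormedSpace ℝ F] (u : H1 F) (j : Fin 3) :
    IsWeakPartial j u.fn (u.grad j) := u.2 j

theorem H1.of_self (u : H1 ℝ) : H1.of u.memLp_fn u.memLp_grad u.weakPartial = u := by
  refine Subtype.ext (Prod.ext ?_ (funext fun j => ?_))
  · exact Lp.toLp_coeFn _ u.memLp_fn
  · exact Lp.toLp_coeFn _ (u.memLp_grad j)

theorem H1.tendsto_of {u : ℕ → E3 → ℝ} {v : ℕ → Fin 3 → E3 → ℝ} {hu : ∀ n, MemLp (u n) 2 volume}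
    {hv : ∀ n j, MemLp (v n j) 2 volume} {h : ∀ n j, IsWeakPartial j (u n) (v n j)}
    {u' : E3 → ℝ} {v' : Fin 3 → E3 → ℝ} {hu' : MemLp u' 2 volume}
    {hv' : ∀ j, MemLp (v' j) 2 volume} {h' : ∀ j, IsWeakPartial j u' (v' j)}
    (h1 : Tendsto (fun n => eLpNorm (u n - u') 2 volume) atTop (𝓝 0))
    (h2 : ∀ j, Tendsto (fun n => eLpNorm (v n j - v' j) 2 volume) atTop (𝓝 0)) :
    Tendsto (fun n => H1.of (hu n) (hv n) (h n)) atTop (𝓝 (H1.of hu' hv' h')) := by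
  rw [tendsto_subtype_rng]
  refine Filter.Tendsto.prodMk_nhds ?_ (tendsto_pi_nhds.2 fun j => ?_)
  · exact (Lp.tendsto_Lp_iff_tendsto_eLpNorm'' _ hu _ hu').2 h1
  · exact (Lp.tendsto_Lp_iff_tendsto_eLpNorm'' _ (fun n => hv n j) _ (hv' j)).2 (h2 j)

theorem IsTest.differentiable {ψ : E3 → ℝ} (h : IsTest ψ) : Differentiable ℝ ψ :=
  h.1.differentiable (by simp)

theorem IsTest.continuous_partialD {ψ : E3 → ℝ} (h : IsTest ψ) (j : Fin 3) :
    Continuous (partialD j ψ) :=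
  (h.1.continuous_fderiv (by simp)).clm_apply continuous_const

theorem IsTest.hasCompactSupport_partialD {ψ : E3 → ℝ} (h : IsTest ψ) (j : Fin 3) :
    HasCompactSupport (partialD j ψ) :=
  h.2.fderiv_apply ℝ (EuclideanSpace.single j 1)

theorem IsTest.exists_bound {ψ : E3 → ℝ} (h : IsTest ψ) : ∃ C, 0 ≤ C ∧ ∀ x, |ψ x| ≤ C := by
  obtain ⟨C, hC⟩ := h.2.exists_bound_of_continuous h.1.continuous
  exact ⟨C, (norm_nonneg _).trans (hC 0), hC⟩

theorem IsTest.exists_bound_partialD {ψ : E3 → ℝ} (h : IsTest ψ) (j : Fin 3) :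
    ∃ C, 0 ≤ C ∧ ∀ x, |partialD j ψ x| ≤ C := by
  obtain ⟨C, hC⟩ := (h.hasCompactSupport_partialD j).exists_bound_of_continuous
    (h.continuous_partialD j)
  exact ⟨C, (norm_nonneg _).trans (hC 0), hC⟩

theorem IsTest.mul {ψ χ : E3 → ℝ} (hψ : IsTest ψ) (hχ : IsTest χ) :
    IsTest fun x => ψ x * χ x :=
  ⟨hψ.1.mul hχ.1, hψ.2.mul_right⟩

theorem partialD_mul {ψ χ : E3 → ℝ} (hψ : Differentiable ℝ ψ) (hχ : Differentiable ℝ χ)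
    (j : Fin 3) (x : E3) :
    partialD j (fun x => ψ x * χ x) x = partialD j ψ x * χ x + ψ x * partialD j χ x := by
  simp only [partialD]
  rw [fderiv_fun_mul (hψ x) (hχ x)]
  simp only [add_apply, smul_apply, smul_eq_mul]
  ring

theorem IsTest.weakPartial {ψ : E3 → ℝ} (h : IsTest ψ) (j : Fin 3) :
    IsWeakPartial j ψ (partialD j ψ) := by
  intro χ hχ
  have h1 : Integrable fun x => χ x * partialD j ψ x :=
    (hχ.1.continuous.mul (h.continuous_partialD j)).integrable_of_hasCompactSupport hχ.2.mul_right
  have h2 : Integrable fun x => partialD j χ x * ψ x :=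
    ((hχ.continuous_partialD j).mul h.1.continuous).integrable_of_hasCompactSupport
      h.2.mul_left
  have h3 : Integrable fun x => χ x * ψ x :=
    (hχ.1.continuous.mul h.1.continuous).integrable_of_hasCompactSupport hχ.2.mul_right
  have := integral_mul_fderiv_eq_neg_fderiv_mul_of_integrable (𝕜 := ℝ) h2 h1 h3
    (fun x _ => hχ.differentiable x) (fun x _ => h.differentiable x)
  simp only [smul_eq_mul, partialD] at this ⊢
  rw [this, neg_neg]

/-- A test function as an element of `H¹`. -/
noncomputable def IsTest.toH1 {ψ : E3 → ℝ} (h : IsTest ψ) : H1 ℝ :=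
  H1.of h.memLp h.memLp_partialD h.weakPartial

theorem memLp_mul_of_bound {χ u : E3 → ℝ} (hχ : Continuous χ) {C : ℝ} (hC : ∀ x, |χ x| ≤ C)
    (hu : MemLp u 2 volume) : MemLp (fun x => χ x * u x) 2 volume := by
  refine (hu.const_mul C).of_le (hχ.aestronglyMeasurable.mul hu.1) (Eventually.of_forall fun x => ?_)
  have : 0 ≤ C := (abs_nonneg _).trans (hC x)
  rw [norm_mul, norm_mul, Real.norm_eq_abs, Real.norm_eq_abs C, abs_of_nonneg this]
  gcongr
  exact hC x

theorem IsTest.memLp_mul {χ u : E3 → ℝ} (hχ : IsTest χ) (hu : MemLp u 2 volume) :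
    MemLp (fun x => χ x * u x) 2 volume := by
  obtain ⟨C, -, hC⟩ := hχ.exists_bound
  exact memLp_mul_of_bound hχ.1.continuous hC hu

theorem IsTest.memLp_partialD_mul {χ u : E3 → ℝ} (hχ : IsTest χ) (hu : MemLp u 2 volume)
    (j : Fin 3) : MemLp (fun x => partialD j χ x * u x) 2 volume := by
  obtain ⟨C, -, hC⟩ := hχ.exists_bound_partialD j
  exact memLp_mul_of_bound (hχ.continuous_partialD j) hC hu

theorem integrable_mul_of_memLp {ψ u : E3 → ℝ} (hψ : MemLp ψ 2 volume) (hu : MemLp u 2 volume) :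
    Integrable (fun x => ψ x * u x) :=
  memLp_one_iff_integrable.1 (hu.smul hψ)

theorem IsWeakPartial.mul_test {u v : E3 → ℝ} {j : Fin 3} (h : IsWeakPartial j u v)
    (hu : MemLp u 2 volume) (hv : MemLp v 2 volume) {χ : E3 → ℝ} (hχ : IsTest χ) :
    IsWeakPartial j (fun x => χ x * u x) (fun x => χ x * v x + partialD j χ x * u x) := by
  intro ψ hψ
  have h1 := h _ (hψ.mul hχ)
  simp only [smul_eq_mul] at h1 ⊢
  have i1 : Integrable fun x => partialD j ψ x * (χ x * u x) :=
    integrable_mul_of_memLp (hψ.memLp_partialD j) (hχ.memLp_mul hu)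
  have i2 : Integrable fun x => ψ x * (partialD j χ x * u x) :=
    integrable_mul_of_memLp hψ.memLp (hχ.memLp_partialD_mul hu j)
  have i3 : Integrable fun x => ψ x * (χ x * v x) :=
    integrable_mul_of_memLp hψ.memLp (hχ.memLp_mul hv)
  have e1 : (fun x => partialD j (fun x => ψ x * χ x) x * u x) =
      fun x => partialD j ψ x * (χ x * u x) + ψ x * (partialD j χ x * u x) := by
    ext x
    rw [partialD_mul hψ.differentiable hχ.differentiable]
    ring
  have e2 : (fun x => ψ x * (χ x * v x + partialD j χ x * u x)) =
      fun x => ψ x * (χ x * v x) + ψ x * (partialD j χ x * u x) := by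
    ext x; ring
  have e3 : (fun x => ψ x * χ x * v x) = fun x => ψ x * (χ x * v x) := by
    ext x; ring
  rw [e1, e3, integral_add i1 i2] at h1
  rw [e2, integral_add i3 i2]
  linarith

/-- The derivative falls on `ρ`, and the definition of the weak derivative is applied to the test
function `t ↦ ρ (x - t)`, whose reflection produces the sign that cancels the one in the definition.
-/
theorem partialD_convolution {ρ u v : E3 → ℝ} (hρ : IsTest ρ) (hu : MemLp u 2 volume)
    {j : Fin 3} (h : IsWeakPartial j u v) :
    partialD j (ρ ⋆[ContinuousLinearMap.lsmul ℝ ℝ] u) = ρ ⋆[ContinuousLinearMap.lsmul ℝ ℝ] v := by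
  ext x
  have hloc := hu.locallyIntegrable one_le_two
  have hd := hρ.2.hasFDerivAt_convolution_left (ContinuousLinearMap.lsmul ℝ ℝ)
    (hρ.1.of_le (by exact_mod_cast le_top)) hloc x (μ := volume)
  have he := (hρ.2.fderiv ℝ).convolutionExists_left
    ((ContinuousLinearMap.lsmul ℝ ℝ : ℝ →L[ℝ] ℝ →L[ℝ] ℝ).precompL E3)
    (hρ.1.continuous_fderiv (by simp)) hloc x (μ := volume)
  rw [partialD, hd.fderiv, convolution_def, ContinuousLinearMap.integral_apply he]
  simp only [ContinuousLinearMap.precompL_apply, ContinuousLinearMap.lsmul_apply, smul_eq_mul]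
  have hη : IsTest fun t => ρ (x - t) :=
    ⟨hρ.1.comp (contDiff_const.sub contDiff_id), hρ.2.comp_homeomorph (Homeomorph.subLeft x)⟩
  have hw := h _ hη
  have hp : ∀ t, partialD j (fun t => ρ (x - t)) t = -partialD j ρ (x - t) := by
    intro t
    have : HasFDerivAt (fun t => ρ (x - t)) ((fderiv ℝ ρ (x - t)).comp
        (-ContinuousLinearMap.id ℝ E3)) t :=
      (hρ.differentiable (x - t)).hasFDerivAt.comp t ((hasFDerivAt_id t).const_sub x)
    rw [partialD, this.fderiv]
    simp [partialD]
  simp only [hp, smul_eq_mul, neg_mul, integral_neg, neg_inj] at hw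
  rw [convolution_lsmul_swap]
  simp only [smul_eq_mul]
  rw [← hw, ← integral_sub_left_eq_self (fun t => partialD j ρ (x - t) * u t) volume x]
  simp [partialD]

theorem mem_closure_test_of_hasCompactSupport {u : E3 → ℝ} {v : Fin 3 → E3 → ℝ}
    (hu : MemLp u 2 volume) (hv : ∀ j, MemLp (v j) 2 volume) (h : ∀ j, IsWeakPartial j u (v j))
    (hs : HasCompactSupport u) :
    H1.of hu hv h ∈ closure {w : H1 ℝ | ∃ (ψ : E3 → ℝ) (hψ : IsTest ψ), w = hψ.toH1} := by
  have ht : ∀ n, IsTest (mollifier n ⋆[ContinuousLinearMap.lsmul ℝ ℝ] u) := fun n =>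
    ⟨(isTest_mollifier n).2.contDiff_convolution_left _ (isTest_mollifier n).1
      (hu.locallyIntegrable one_le_two), (isTest_mollifier n).2.convolution _ hs⟩
  refine mem_closure_of_tendsto (f := fun n => (ht n).toH1) (b := atTop) ?_
    (Eventually.of_forall fun n => ⟨_, ht n, rfl⟩)
  refine H1.tendsto_of (tendsto_mollify hu) fun j => ?_
  simp_rw [fun n => partialD_convolution (isTest_mollifier n) hu (h j)]
  exact tendsto_mollify (hv j)

theorem tendsto_eLpNorm_two_zero {F : ℕ → E3 → ℝ} {b : E3 → ℝ} (hb : MemLp b 2 volume)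
    (hF : ∀ n, MemLp (F n) 2 volume) (hle : ∀ n, ∀ x, |F n x| ≤ b x)
    (hlim : ∀ x, Tendsto (fun n => F n x) atTop (𝓝 0)) :
    Tendsto (fun n => eLpNorm (F n) 2 volume) atTop (𝓝 0) := by
  simp_rw [fun n => eLpNorm_two_eq (hF n)]
  have h1 : Tendsto (fun n => ∫ x, F n x ^ 2) atTop (𝓝 (∫ _ : E3, (0 : ℝ))) := by
    refine tendsto_integral_of_dominated_convergence (fun x => b x ^ 2)
      (fun n => (hF n).integrable_sq.1) hb.integrable_sq (fun n => Eventually.of_forall fun x => ?_)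
      (Eventually.of_forall fun x => by simpa using (hlim x).pow 2)
    rw [Real.norm_eq_abs, abs_pow]
    gcongr
    exact hle n x
  rw [integral_zero] at h1
  simpa using ENNReal.tendsto_ofReal h1.sqrt

/-- A fixed smooth cutoff, equal to one on the unit ball. -/
noncomputable def unitCutoff : ContDiffBump (0 : E3) := ⟨1, 2, one_pos, one_lt_two⟩

/-- The cutoff at scale `n + 1`. -/
noncomputable def cutoff (n : ℕ) (x : E3) : ℝ := unitCutoff ((1 / ((n : ℝ) + 1)) • x)

theorem isTest_unitCutoff : IsTest unitCutoff :=
  ⟨unitCutoff.contDiff, unitCutoff.hasCompactSupport⟩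

theorem isTest_cutoff (n : ℕ) : IsTest (cutoff n) :=
  ⟨unitCutoff.contDiff.comp (contDiff_const_smul _),
    unitCutoff.hasCompactSupport.comp_smul (by positivity)⟩

theorem partialD_cutoff (n : ℕ) (j : Fin 3) (x : E3) :
    partialD j (cutoff n) x =
      1 / ((n : ℝ) + 1) * partialD j unitCutoff ((1 / ((n : ℝ) + 1)) • x) := by
  have : HasFDerivAt (cutoff n) ((fderiv ℝ unitCutoff ((1 / ((n : ℝ) + 1)) • x)).comp
      ((1 / ((n : ℝ) + 1)) • ContinuousLinearMap.id ℝ E3)) x :=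
    (isTest_unitCutoff.differentiable _).hasFDerivAt.comp x
      ((hasFDerivAt_id x).const_smul (1 / ((n : ℝ) + 1)))
  rw [partialD, this.fderiv]
  simp [partialD]

theorem tendsto_cutoff (x : E3) : Tendsto (fun n => cutoff n x) atTop (𝓝 1) := by
  refine tendsto_const_nhds.congr' ?_
  filter_upwards [eventually_ge_atTop ⌈‖x‖⌉₊] with n hn
  symm
  refine unitCutoff.one_of_mem_closedBall ?_
  rw [mem_closedBall_zero_iff, norm_smul, Real.norm_of_nonneg (by positivity), one_div,
    inv_mul_le_iff₀ (by positivity)]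
  have : ‖x‖ ≤ n := (Nat.le_ceil _).trans (by exact_mod_cast hn)
  simp only [unitCutoff]
  linarith

/-- Cutoffs reduce to compact support, where mollification applies. The extra term `∂_j χ_n · u` of
the product rule has size `C / (n + 1)`, and dominated convergence handles the rest. -/
theorem mem_closure_test (u : H1 ℝ) :
    u ∈ closure {w : H1 ℝ | ∃ (ψ : E3 → ℝ) (hψ : IsTest ψ), w = hψ.toH1} := by
  have hu := u.memLp_fn
  have hv := u.memLp_grad
  have hw := u.weakPartial
  have h1 : ∀ n, MemLp (fun x => cutoff n x * u.fn x) 2 volume := fun n =>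
    (isTest_cutoff n).memLp_mul hu
  have h2 : ∀ n j, MemLp (fun x => cutoff n x * u.grad j x + partialD j (cutoff n) x * u.fn x)
      2 volume := fun n j =>
    ((isTest_cutoff n).memLp_mul (hv j)).add ((isTest_cutoff n).memLp_partialD_mul hu j)
  have h3 : ∀ n j, IsWeakPartial j (fun x => cutoff n x * u.fn x)
      (fun x => cutoff n x * u.grad j x + partialD j (cutoff n) x * u.fn x) := fun n j =>
    (hw j).mul_test hu (hv j) (isTest_cutoff n)
  rw [← closure_closure, ← u.of_self]
  refine mem_closure_of_tendsto (f := fun n => H1.of (h1 n) (h2 n) (h3 n)) (b := atTop) ?_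
    (Eventually.of_forall fun n => mem_closure_test_of_hasCompactSupport _ _ _
      (isTest_cutoff n).2.mul_right)
  have hc : ∀ n x, |cutoff n x - 1| ≤ 1 := fun n x => by
    have h0 : 0 ≤ cutoff n x := unitCutoff.nonneg
    have h1 : cutoff n x ≤ 1 := unitCutoff.le_one
    rw [abs_le]; constructor <;> linarith
  refine H1.tendsto_of ?_ fun j => ?_
  · refine tendsto_eLpNorm_two_zero hu.norm (fun n => (h1 n).sub hu) (fun n x => ?_) fun x => ?_
    · have : ((fun x => cutoff n x * u.fn x) - u.fn) x = (cutoff n x - 1) * u.fn x := by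
        simp only [Pi.sub_apply]; ring
      rw [this, abs_mul]
      exact mul_le_of_le_one_left (abs_nonneg _) (hc n x)
    · have := ((tendsto_cutoff x).mul_const (u.fn x)).sub_const (u.fn x)
      simpa using this
  · obtain ⟨C, hC0, hC⟩ := isTest_unitCutoff.exists_bound_partialD j
    refine tendsto_eLpNorm_two_zero (b := fun x => ‖u.grad j x‖ + C * ‖u.fn x‖)
      ((hv j).norm.add (hu.norm.const_mul C)) (fun n => (h2 n j).sub (hv j)) (fun n x => ?_)
      fun x => ?_
    · have : ((fun x => cutoff n x * u.grad j x + partialD j (cutoff n) x * u.fn x) - u.grad j) x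
          = (cutoff n x - 1) * u.grad j x + partialD j (cutoff n) x * u.fn x := by
        simp only [Pi.sub_apply]; ring
      rw [this]
      refine (abs_add_le _ _).trans (add_le_add ?_ ?_)
      · rw [abs_mul]
        exact mul_le_of_le_one_left (abs_nonneg _) (hc n x)
      · rw [abs_mul, partialD_cutoff, abs_mul, ← Real.norm_eq_abs (u.fn x)]
        gcongr
        refine le_trans (mul_le_of_le_one_left (abs_nonneg _) ?_) (hC _)
        rw [abs_of_nonneg (by positivity), div_le_one (by positivity)]
        linarith [n.cast_nonneg (α := ℝ)]
    · have e1 := ((tendsto_cutoff x).mul_const (u.grad j x)).sub_const (u.grad j x)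
      have e2 : Tendsto (fun n => partialD j (cutoff n) x * u.fn x) atTop (𝓝 0) := by
        rw [← zero_mul (u.fn x)]
        refine Tendsto.mul_const _ ?_
        refine squeeze_zero_norm (a := fun n : ℕ => 1 / ((n : ℝ) + 1) * C) (fun n => ?_) ?_
        · rw [partialD_cutoff, norm_mul, Real.norm_of_nonneg (by positivity)]
          gcongr
          exact hC _
        · simpa using tendsto_one_div_add_atTop_nhds_zero_nat.mul_const C
      have := e1.add e2
      simp only [one_mul, sub_self, add_zero] at this
      refine this.congr fun n => ?_
      simp only [Pi.sub_apply]; ring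

theorem exists_test_tendsto (u : H1 ℝ) : ∃ (ψ : ℕ → E3 → ℝ) (hψ : ∀ n, IsTest (ψ n)),
    Tendsto (fun n => (hψ n).toH1) atTop (𝓝 u) := by
  obtain ⟨w, hw, hlim⟩ := mem_closure_iff_seq_limit.1 (mem_closure_test u)
  choose ψ hψ hwψ using hw
  exact ⟨ψ, hψ, by simpa only [← hwψ] using hlim⟩

end NLSOscillation

namespace NLSOscillation

open MeasureTheory Filter Topology Function
open scoped Convolution ENNReal

/-! ### The Sobolev embedding and weighted quadratic forms on `H¹` -/

theorem H1.norm_fst_le {F : Type} [NormedAddCommGroup F] [NormedSpace ℝ F] (u : H1 F) :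
    ‖u.1.1‖ ≤ ‖u‖ := _root_.norm_fst_le u.1

theorem H1.norm_grad_le {F : Type} [NormedAddCommGroup F] [NormedSpace ℝ F] (u : H1 F)
    (j : Fin 3) : ‖u.1.2 j‖ ≤ ‖u‖ :=
  (norm_le_pi_norm u.1.2 j).trans (norm_snd_le u.1)

theorem norm_sq_Lp_eq (f : Lp ℝ 2 (volume : Measure E3)) : ‖f‖ ^ 2 = ∫ x, f x ^ 2 := by
  rw [← real_inner_self_eq_norm_sq, L2.inner_def]
  simp [sq]

theorem inner_Lp_eq (f g : Lp ℝ 2 (volume : Measure E3)) : inner ℝ f g = ∫ x, f x * g x := by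
  rw [L2.inner_def]
  simp [mul_comm]

theorem H1.integral_sq_le (u : H1 ℝ) : ∫ x, u.fn x ^ 2 ≤ ‖u‖ ^ 2 := by
  have h := norm_sq_Lp_eq u.1.1
  rw [H1.fn, ← h]
  gcongr
  exact u.norm_fst_le

theorem H1.fn_add (u v : H1 ℝ) : (u + v).fn =ᵐ[volume] fun x => u.fn x + v.fn x :=
  Lp.coeFn_add _ _

theorem H1.fn_sub (u v : H1 ℝ) : (u - v).fn =ᵐ[volume] fun x => u.fn x - v.fn x :=
  Lp.coeFn_sub _ _

theorem H1.fn_smul (c : ℝ) (u : H1 ℝ) : (c • u).fn =ᵐ[volume] fun x => c * u.fn x :=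
  Lp.coeFn_smul _ _

theorem IsTest.fn_toH1 {ψ : E3 → ℝ} (h : IsTest ψ) : h.toH1.fn =ᵐ[volume] ψ := H1.fn_of _ _ _

theorem IsTest.grad_toH1 {ψ : E3 → ℝ} (h : IsTest ψ) (j : Fin 3) :
    h.toH1.grad j =ᵐ[volume] partialD j ψ := H1.grad_of _ _ _ j

/-- A continuous function on `H¹` that is nonnegative on test functions is nonnegative. -/
theorem nonneg_of_test {f : H1 ℝ → ℝ} (hf : Continuous f)
    (h : ∀ (ψ : E3 → ℝ) (hψ : IsTest ψ), 0 ≤ f hψ.toH1) (u : H1 ℝ) : 0 ≤ f u := by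
  have : closure {w : H1 ℝ | ∃ (ψ : E3 → ℝ) (hψ : IsTest ψ), w = hψ.toH1} ⊆ {u | 0 ≤ f u} := by
    refine closure_minimal ?_ (isClosed_le continuous_const hf)
    rintro _ ⟨ψ, hψ, rfl⟩
    exact h ψ hψ
  exact this (mem_closure_test u)

/-- A continuous function on `H¹` that vanishes on test functions vanishes. -/
theorem eq_zero_of_test {f : H1 ℝ → ℝ} (hf : Continuous f)
    (h : ∀ (ψ : E3 → ℝ) (hψ : IsTest ψ), f hψ.toH1 = 0) (u : H1 ℝ) : f u = 0 :=
  le_antisymm (neg_nonneg.1 (nonneg_of_test (f := fun u => -f u) hf.neg (by simp [h]) u))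
    (nonneg_of_test hf (fun ψ hψ => (h ψ hψ).ge) u)

theorem H1.tendsto_ae {u : ℕ → H1 ℝ} {v : H1 ℝ} (h : Tendsto u atTop (𝓝 v)) :
    ∃ ns : ℕ → ℕ, StrictMono ns ∧ ∀ᵐ x, Tendsto (fun n => (u (ns n)).fn x) atTop (𝓝 (v.fn x)) := by
  have h1 : Tendsto (fun n => (u n).1.1) atTop (𝓝 v.1.1) :=
    ((continuous_fst.comp continuous_subtype_val).tendsto v).comp h
  exact (tendstoInMeasure_of_tendsto_Lp h1).exists_seq_tendsto_ae

theorem norm_fderiv_le_sum (ψ : E3 → ℝ) (x : E3) :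
    ‖fderiv ℝ ψ x‖ ≤ ∑ j : Fin 3, ‖partialD j ψ x‖ := by
  refine ContinuousLinearMap.opNorm_le_bound _ (Finset.sum_nonneg fun j _ => norm_nonneg _)
    fun v => ?_
  have hv : v = ∑ j : Fin 3, v j • EuclideanSpace.single j (1 : ℝ) := by
    ext i
    simp [Finset.sum_apply, Pi.single_apply]
  conv_lhs => rw [hv, map_sum]
  rw [Finset.sum_mul]
  refine norm_sum_le_of_le _ fun j _ => ?_
  rw [map_smul, norm_smul, mul_comm]
  exact mul_le_mul_of_nonneg_left (PiLp.norm_apply_le v j) (norm_nonneg _)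

/-- The Gagliardo–Nirenberg–Sobolev inequality in dimension three, where `1/6 = 1/2 - 1/3`. -/
theorem exists_sobolev_test : ∃ C : ℝ, 0 < C ∧ ∀ (ψ : E3 → ℝ) (hψ : IsTest ψ),
    eLpNorm ψ 6 volume ≤ ENNReal.ofReal (C * ‖hψ.toH1‖) := by
  -- The factor `3` counts the partial derivatives that bound the full derivative; the summand `1`
  -- only makes the constant positive.
  refine ⟨SNormLESNormFDerivOfEqConst ℝ (volume : Measure E3) (2 : NNReal) * 3 + 1,
    by positivity, fun ψ hψ => ?_⟩
  have h := eLpNorm_le_eLpNorm_fderiv_of_eq (volume : Measure E3)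
    (hψ.1.of_le (by exact_mod_cast le_top)) hψ.2 (p := 2) (p' := 6) (by norm_num)
    (by simp) (by simp; norm_num)
  have hg : ∀ j, eLpNorm (partialD j ψ) 2 volume ≤ ENNReal.ofReal ‖hψ.toH1‖ := by
    intro j
    rw [← eLpNorm_congr_ae (hψ.grad_toH1 j), H1.grad]
    have := hψ.toH1.norm_grad_le j
    rw [Lp.norm_def] at this
    exact (ENNReal.le_ofReal_iff_toReal_le (Lp.memLp _).eLpNorm_ne_top (norm_nonneg _)).2 this
  have hf : eLpNorm (fderiv ℝ ψ) 2 volume ≤ 3 * ENNReal.ofReal ‖hψ.toH1‖ := by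
    calc eLpNorm (fderiv ℝ ψ) 2 volume
        ≤ eLpNorm (∑ j : Fin 3, fun x => ‖partialD j ψ x‖) 2 volume := by
          refine eLpNorm_mono fun x => ?_
          rw [Finset.sum_apply, Real.norm_of_nonneg (Finset.sum_nonneg fun j _ => norm_nonneg _)]
          exact norm_fderiv_le_sum ψ x
      _ ≤ ∑ j : Fin 3, eLpNorm (fun x => ‖partialD j ψ x‖) 2 volume :=
          eLpNorm_sum_le (fun j _ => (hψ.memLp_partialD j).norm.1) one_le_two
      _ ≤ ∑ _j : Fin 3, ENNReal.ofReal ‖hψ.toH1‖ := by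
          gcongr with j
          rw [eLpNorm_norm]
          exact hg j
      _ = 3 * ENNReal.ofReal ‖hψ.toH1‖ := by simp
  set S := SNormLESNormFDerivOfEqConst ℝ (volume : Measure E3) (2 : NNReal)
  calc eLpNorm ψ 6 volume ≤ S * eLpNorm (fderiv ℝ ψ) 2 volume := by exact_mod_cast h
    _ ≤ S * (3 * ENNReal.ofReal ‖hψ.toH1‖) := by gcongr
    _ = ENNReal.ofReal (S * (3 * ‖hψ.toH1‖)) := by
        rw [ENNReal.ofReal_mul (by positivity), ENNReal.ofReal_mul (by positivity)]
        simp
    _ ≤ _ := ENNReal.ofReal_le_ofReal (by linarith [norm_nonneg hψ.toH1])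

/-- Fatou's lemma along an almost everywhere convergent subsequence of test functions; no a priori
integrability of `u` in `L⁶` is needed. -/
theorem exists_sobolev_eLpNorm : ∃ C : ℝ, 0 < C ∧ ∀ u : H1 ℝ,
    eLpNorm u.fn 6 volume ≤ ENNReal.ofReal (C * ‖u‖) := by
  obtain ⟨C, hC, h⟩ := exists_sobolev_test
  refine ⟨C, hC, fun u => ?_⟩
  obtain ⟨ψ, hψ, hlim⟩ := exists_test_tendsto u
  obtain ⟨ns, hns, hae⟩ := H1.tendsto_ae hlim
  refine (Lp.eLpNorm_lim_le_liminf_eLpNorm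
    (fun n => ((hψ (ns n)).toH1.memLp_fn).1) u.fn hae).trans ?_
  have hlim' : Tendsto (fun n => ENNReal.ofReal (C * ‖(hψ (ns n)).toH1‖)) atTop
      (𝓝 (ENNReal.ofReal (C * ‖u‖))) :=
    ENNReal.tendsto_ofReal ((hlim.comp hns.tendsto_atTop).norm.const_mul C)
  rw [← hlim'.liminf_eq]
  refine liminf_le_liminf (Eventually.of_forall fun n => ?_)
  rw [eLpNorm_congr_ae (hψ (ns n)).fn_toH1]
  exact h _ _

/-- The Sobolev embedding `H¹(ℝ³) ⊂ L⁶(ℝ³)`. -/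
theorem exists_sobolev : ∃ S : ℝ, 0 < S ∧ ∀ u : H1 ℝ,
    Integrable (fun x => u.fn x ^ 6) ∧ ∫ x, u.fn x ^ 6 ≤ S * ‖u‖ ^ 6 := by
  obtain ⟨C, hC, h⟩ := exists_sobolev_eLpNorm
  refine ⟨C ^ 6, by positivity, fun u => ?_⟩
  have hm : MemLp u.fn 6 volume := ⟨u.memLp_fn.1, (h u).trans_lt ENNReal.ofReal_lt_top⟩
  have e : ∀ x, ‖u.fn x‖ ^ 6 = u.fn x ^ 6 := fun x => by
    rw [Real.norm_eq_abs]; exact Even.pow_abs (by decide) _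
  have hi := hm.integrable_norm_pow (by norm_num)
  refine ⟨by simpa only [e] using hi, ?_⟩
  have h1 := hm.eLpNorm_eq_integral_rpow_norm (by norm_num) (by norm_num)
  have h2 := h u
  rw [h1, ENNReal.ofReal_le_ofReal_iff (by positivity)] at h2
  have e' : ∀ x, ‖u.fn x‖ ^ (6 : ℝ≥0∞).toReal = u.fn x ^ 6 := fun x => by
    rw [← e]; norm_cast
  simp only [e'] at h2
  have h0 : 0 ≤ ∫ x, u.fn x ^ 6 := integral_nonneg fun x => by positivity
  have h3 := pow_le_pow_left₀ (by positivity) h2 6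
  rw [← Real.rpow_natCast, ← Real.rpow_mul h0, mul_pow] at h3
  simpa using h3

theorem pow_four_mul_mul_le (w x y : ℝ) : w ^ 4 * (|x| * |y|) ≤ w ^ 6 + x ^ 6 + y ^ 6 := by
  have key : ∀ a b : ℝ, 0 ≤ a → 0 ≤ b → 3 * (a ^ 2 * b) ≤ 2 * a ^ 3 + b ^ 3 := fun a b ha hb => by
    have : 0 ≤ (a - b) ^ 2 * (2 * a + b) := by positivity
    nlinarith
  have h1 := key (w ^ 2) (x ^ 2) (by positivity) (by positivity)
  have h2 := key (w ^ 2) (y ^ 2) (by positivity) (by positivity)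
  have h3 : |x| * |y| ≤ (x ^ 2 + y ^ 2) / 2 := by
    nlinarith [sq_nonneg (|x| - |y|), sq_abs x, sq_abs y]
  have h4 := mul_le_mul_of_nonneg_left h3 (by positivity : 0 ≤ w ^ 4)
  have : 0 ≤ w ^ 6 := by positivity
  have : 0 ≤ x ^ 6 := by positivity
  have : 0 ≤ y ^ 6 := by positivity
  nlinarith

/-- Sobolev's inequality turns the pointwise Young bound into an integral one. That bound is not
homogeneous, so it is applied to `u/‖u‖` and `v/‖v‖`; this yields the product `‖u‖ ‖v‖` and explains
why the cases of zero norm are split off. The fourth power is the growth allowed for `g (φ²)`. -/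
theorem exists_weight_bound : ∃ K : ℝ, 0 < K ∧ ∀ w u v : H1 ℝ,
    Integrable (fun x => (1 + w.fn x ^ 4) * (|u.fn x| * |v.fn x|)) ∧
    ∫ x, (1 + w.fn x ^ 4) * (|u.fn x| * |v.fn x|) ≤ K * (1 + ‖w‖ ^ 6) * (‖u‖ * ‖v‖) := by
  obtain ⟨S, hS, hsob⟩ := exists_sobolev
  refine ⟨2 * S + 2, by positivity, fun w u v => ?_⟩
  have hmeas : AEStronglyMeasurable (fun x => (1 + w.fn x ^ 4) * (|u.fn x| * |v.fn x|)) volume :=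
    ((w.memLp_fn.1.pow 4).const_add 1).mul (u.memLp_fn.1.norm.mul v.memLp_fn.1.norm)
  have hint : Integrable (fun x => (1 + w.fn x ^ 4) * (|u.fn x| * |v.fn x|)) := by
    refine (((u.memLp_fn.integrable_sq.add v.memLp_fn.integrable_sq).add
      ((hsob w).1.add ((hsob u).1.add (hsob v).1)))).mono' hmeas (Eventually.of_forall fun x => ?_)
    rw [Real.norm_of_nonneg (by positivity)]
    have h1 := pow_four_mul_mul_le (w.fn x) (u.fn x) (v.fn x)
    have h3 : |u.fn x| * |v.fn x| ≤ u.fn x ^ 2 + v.fn x ^ 2 := by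
      nlinarith [sq_nonneg (|u.fn x| - |v.fn x|), sq_abs (u.fn x), sq_abs (v.fn x),
        sq_nonneg (u.fn x), sq_nonneg (v.fn x)]
    simp only [Pi.add_apply]
    nlinarith
  refine ⟨hint, ?_⟩
  have hz : ∀ z : H1 ℝ, ‖z‖ = 0 → z.fn =ᵐ[volume] 0 := by
    intro z hz
    rw [norm_eq_zero] at hz
    subst hz
    exact Lp.coeFn_zero _ _ _
  by_cases hu : ‖u‖ = 0
  · have : (fun x => (1 + w.fn x ^ 4) * (|u.fn x| * |v.fn x|)) =ᵐ[volume] fun _ => (0 : ℝ) := by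
      filter_upwards [hz u hu] with x hx
      simp [hx]
    rw [integral_congr_ae this, hu]
    simp
  by_cases hv : ‖v‖ = 0
  · have : (fun x => (1 + w.fn x ^ 4) * (|u.fn x| * |v.fn x|)) =ᵐ[volume] fun _ => (0 : ℝ) := by
      filter_upwards [hz v hv] with x hx
      simp [hx]
    rw [integral_congr_ae this, hv]
    simp
  have ha : 0 < ‖u‖ := lt_of_le_of_ne (norm_nonneg _) (Ne.symm hu)
  have hb : 0 < ‖v‖ := lt_of_le_of_ne (norm_nonneg _) (Ne.symm hv)
  set a := ‖u‖
  set b := ‖v‖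
  have i1 : Integrable fun x => a⁻¹ ^ 2 * u.fn x ^ 2 := u.memLp_fn.integrable_sq.const_mul _
  have i2 : Integrable fun x => b⁻¹ ^ 2 * v.fn x ^ 2 := v.memLp_fn.integrable_sq.const_mul _
  have i3 : Integrable fun x => a⁻¹ ^ 6 * u.fn x ^ 6 := (hsob u).1.const_mul _
  have i4 : Integrable fun x => b⁻¹ ^ 6 * v.fn x ^ 6 := (hsob v).1.const_mul _
  have i12 : Integrable fun x => a⁻¹ ^ 2 * u.fn x ^ 2 + b⁻¹ ^ 2 * v.fn x ^ 2 := i1.add i2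
  have i34 : Integrable fun x => a⁻¹ ^ 6 * u.fn x ^ 6 + b⁻¹ ^ 6 * v.fn x ^ 6 := i3.add i4
  have i345 : Integrable fun x => w.fn x ^ 6 + (a⁻¹ ^ 6 * u.fn x ^ 6 + b⁻¹ ^ 6 * v.fn x ^ 6) :=
    (hsob w).1.add i34
  have iall : Integrable fun x => (a⁻¹ ^ 2 * u.fn x ^ 2 + b⁻¹ ^ 2 * v.fn x ^ 2) +
      (w.fn x ^ 6 + (a⁻¹ ^ 6 * u.fn x ^ 6 + b⁻¹ ^ 6 * v.fn x ^ 6)) := i12.add i345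
  calc ∫ x, (1 + w.fn x ^ 4) * (|u.fn x| * |v.fn x|)
      ≤ ∫ x, a * b * ((a⁻¹ ^ 2 * u.fn x ^ 2 + b⁻¹ ^ 2 * v.fn x ^ 2) +
          (w.fn x ^ 6 + (a⁻¹ ^ 6 * u.fn x ^ 6 + b⁻¹ ^ 6 * v.fn x ^ 6))) := by
        refine integral_mono hint (iall.const_mul _) fun x => ?_
        have h1 := pow_four_mul_mul_le (w.fn x) (a⁻¹ * u.fn x) (b⁻¹ * v.fn x)
        have h3 : |a⁻¹ * u.fn x| * |b⁻¹ * v.fn x| ≤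
            (a⁻¹ * u.fn x) ^ 2 + (b⁻¹ * v.fn x) ^ 2 := by
          set p := a⁻¹ * u.fn x
          set q := b⁻¹ * v.fn x
          nlinarith [sq_nonneg (|p| - |q|), sq_abs p, sq_abs q, sq_nonneg p, sq_nonneg q]
        have e : (1 + w.fn x ^ 4) * (|u.fn x| * |v.fn x|) =
            a * b * ((1 + w.fn x ^ 4) * (|a⁻¹ * u.fn x| * |b⁻¹ * v.fn x|)) := by
          rw [abs_mul, abs_mul, abs_of_pos (inv_pos.2 ha), abs_of_pos (inv_pos.2 hb)]
          field_simp
        simp only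
        rw [e]
        refine mul_le_mul_of_nonneg_left ?_ (by positivity)
        rw [← mul_pow, ← mul_pow, ← mul_pow, ← mul_pow]
        nlinarith
    _ = a * b * ((a⁻¹ ^ 2 * ∫ x, u.fn x ^ 2) + (b⁻¹ ^ 2 * ∫ x, v.fn x ^ 2) +
          ((∫ x, w.fn x ^ 6) + ((a⁻¹ ^ 6 * ∫ x, u.fn x ^ 6) + b⁻¹ ^ 6 * ∫ x, v.fn x ^ 6))) := by
        rw [integral_const_mul, integral_add i12 i345, integral_add i1 i2,
          integral_add (hsob w).1 i34, integral_add i3 i4]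
        simp only [integral_const_mul]
    _ ≤ a * b * ((a⁻¹ ^ 2 * a ^ 2) + (b⁻¹ ^ 2 * b ^ 2) +
          (S * ‖w‖ ^ 6 + ((a⁻¹ ^ 6 * (S * a ^ 6)) + b⁻¹ ^ 6 * (S * b ^ 6)))) := by
        gcongr
        · exact u.integral_sq_le
        · exact v.integral_sq_le
        · exact (hsob w).2
        · exact (hsob u).2
        · exact (hsob v).2
    _ = a * b * (2 + S * ‖w‖ ^ 6 + 2 * S) := by
        field_simp
        ring
    _ ≤ _ := by
        have : 0 ≤ a * b := by positivity
        have h6 : 0 ≤ ‖w‖ ^ 6 := by positivity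
        have : (2 + S * ‖w‖ ^ 6 + 2 * S) ≤ (2 * S + 2) * (1 + ‖w‖ ^ 6) := by nlinarith
        nlinarith

/-- Potentials dominated by `1 + w⁴` with `w ∈ H¹`. -/
def IsWeight (w : H1 ℝ) (V : E3 → ℝ) : Prop :=
  AEStronglyMeasurable V volume ∧ ∃ C : ℝ, 0 ≤ C ∧ ∀ x, |V x| ≤ C * (1 + w.fn x ^ 4)

theorem IsWeight.integrable {w : H1 ℝ} {V : E3 → ℝ} (hV : IsWeight w V) (u v : H1 ℝ) :
    Integrable fun x => V x * (u.fn x * v.fn x) := by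
  obtain ⟨K, hK, h⟩ := exists_weight_bound
  obtain ⟨hm, C, hC, hb⟩ := hV
  refine ((h w u v).1.const_mul C).mono' (hm.mul (u.memLp_fn.1.mul v.memLp_fn.1))
    (Eventually.of_forall fun x => ?_)
  rw [norm_mul, norm_mul, Real.norm_eq_abs, Real.norm_eq_abs, Real.norm_eq_abs, ← mul_assoc C]
  gcongr
  exact hb x

theorem IsWeight.exists_bound {w : H1 ℝ} {V : E3 → ℝ} (hV : IsWeight w V) :
    ∃ C : ℝ, ∀ u v : H1 ℝ, ‖∫ x, V x * (u.fn x * v.fn x)‖ ≤ C * ‖u‖ * ‖v‖ := by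
  obtain ⟨K, hK, h⟩ := exists_weight_bound
  obtain ⟨hm, C, hC, hb⟩ := id hV
  refine ⟨C * (K * (1 + ‖w‖ ^ 6)), fun u v => ?_⟩
  calc ‖∫ x, V x * (u.fn x * v.fn x)‖
      ≤ ∫ x, C * ((1 + w.fn x ^ 4) * (|u.fn x| * |v.fn x|)) := by
        refine norm_integral_le_of_norm_le ((h w u v).1.const_mul C)
          (Eventually.of_forall fun x => ?_)
        rw [norm_mul, norm_mul, Real.norm_eq_abs, Real.norm_eq_abs, Real.norm_eq_abs, ← mul_assoc C]
        gcongr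
        exact hb x
    _ ≤ C * (K * (1 + ‖w‖ ^ 6) * (‖u‖ * ‖v‖)) := by
        rw [integral_const_mul]
        gcongr
        exact (h w u v).2
    _ = _ := by ring

/-- The bilinear form `∫ V u v` on `H¹`. -/
noncomputable def potentialForm {w : H1 ℝ} {V : E3 → ℝ} (hV : IsWeight w V) :
    H1 ℝ →L[ℝ] H1 ℝ →L[ℝ] ℝ :=
  LinearMap.mkContinuous₂
    (LinearMap.mk₂ ℝ (fun u v => ∫ x, V x * (u.fn x * v.fn x))
      (fun u u' v => by
        rw [← integral_add (hV.integrable u v) (hV.integrable u' v)]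
        refine integral_congr_ae ?_
        filter_upwards [H1.fn_add u u'] with x hx
        rw [hx]; ring)
      (fun c u v => by
        rw [smul_eq_mul, ← integral_const_mul]
        refine integral_congr_ae ?_
        filter_upwards [H1.fn_smul c u] with x hx
        rw [hx]; ring)
      (fun u v v' => by
        rw [← integral_add (hV.integrable u v) (hV.integrable u v')]
        refine integral_congr_ae ?_
        filter_upwards [H1.fn_add v v'] with x hx
        rw [hx]; ring)
      (fun c u v => by
        rw [smul_eq_mul, ← integral_const_mul]
        refine integral_congr_ae ?_
        filter_upwards [H1.fn_smul c v] with x hx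
        rw [hx]; ring))
    hV.exists_bound.choose (fun u v => hV.exists_bound.choose_spec u v)

theorem potentialForm_apply {w : H1 ℝ} {V : E3 → ℝ} (hV : IsWeight w V) (u v : H1 ℝ) :
    potentialForm hV u v = ∫ x, V x * (u.fn x * v.fn x) := rfl

/-- The underlying `L²` function as a continuous linear map. -/
noncomputable def fnL (F : Type) [NormedAddCommGroup F] [NormedSpace ℝ F] :
    H1 F →L[ℝ] Lp F 2 (volume : Measure E3) :=
  (ContinuousLinearMap.fst ℝ _ _).comp (H1Submodule F).subtypeL

/-- The bilinear form `∫ ∇u·∇v`. -/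
noncomputable def dirichletForm (u v : H1 ℝ) : ℝ := ∑ j : Fin 3, inner ℝ (u.1.2 j) (v.1.2 j)

theorem dirichletForm_apply (u v : H1 ℝ) :
    dirichletForm u v = ∑ j : Fin 3, ∫ x, u.grad j x * v.grad j x :=
  Finset.sum_congr rfl fun _ _ => inner_Lp_eq _ _

theorem dirichletForm_comm (u v : H1 ℝ) : dirichletForm u v = dirichletForm v u :=
  Finset.sum_congr rfl fun _ _ => real_inner_comm _ _

theorem dirichletForm_add_left (u u' v : H1 ℝ) :
    dirichletForm (u + u') v = dirichletForm u v + dirichletForm u' v := by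
  rw [dirichletForm, dirichletForm, dirichletForm, ← Finset.sum_add_distrib]
  exact Finset.sum_congr rfl fun _ _ => inner_add_left _ _ _

theorem dirichletForm_smul_left (c : ℝ) (u v : H1 ℝ) :
    dirichletForm (c • u) v = c * dirichletForm u v := by
  rw [dirichletForm, dirichletForm, Finset.mul_sum]
  exact Finset.sum_congr rfl fun _ _ => real_inner_smul_left _ _ _

theorem continuous_gradient (j : Fin 3) : Continuous fun u : H1 ℝ => u.1.2 j :=
  (continuous_apply j).comp (continuous_snd.comp continuous_subtype_val)

theorem continuous_dirichletForm : Continuous fun p : H1 ℝ × H1 ℝ => dirichletForm p.1 p.2 :=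
  continuous_finsetSum _ fun j _ =>
    ((continuous_gradient j).comp continuous_fst).inner ((continuous_gradient j).comp continuous_snd)

theorem dirichletForm_test {ψ : E3 → ℝ} (hψ : IsTest ψ) (v : H1 ℝ) :
    dirichletForm hψ.toH1 v = ∑ j : Fin 3, ∫ x, partialD j ψ x * v.grad j x := by
  rw [dirichletForm_apply]
  refine Finset.sum_congr rfl fun j _ => integral_congr_ae ?_
  filter_upwards [hψ.grad_toH1 j] with x hx
  rw [hx]

theorem potentialForm_test {w : H1 ℝ} {V : E3 → ℝ} (hV : IsWeight w V) {ψ : E3 → ℝ}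
    (hψ : IsTest ψ) (v : H1 ℝ) :
    potentialForm hV hψ.toH1 v = ∫ x, V x * (ψ x * v.fn x) := by
  rw [potentialForm_apply]
  refine integral_congr_ae ?_
  filter_upwards [hψ.fn_toH1] with x hx
  rw [hx]

end NLSOscillation

namespace NLSOscillation

open MeasureTheory Filter Topology Function
open scoped Convolution ENNReal

/-! ### The nonlinearity on `H¹` -/

namespace IsNonlinearity

variable {g : ℝ → ℝ}

theorem continuous_sq (hg : IsNonlinearity g) : Continuous fun s : ℝ => g (s ^ 2) :=
  hg.smooth.continuousOn.comp_continuous (by fun_prop) fun s => sq_nonneg s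

theorem continuous_gDeriv_sq (hg : IsNonlinearity g) :
    Continuous fun s : ℝ => gDeriv g (s ^ 2) :=
  (hg.smooth.continuousOn_derivWithin (uniqueDiffOn_Ici 0) (by simp)).comp_continuous
    (by fun_prop) fun s => sq_nonneg s

/-- For `|s| ≥ 1` the exponent `p < 2` gives `(s²)^p ≤ s⁴`; for `|s| ≤ 1` compactness suffices. -/
theorem exists_growth (hg : IsNonlinearity g) : ∃ C : ℝ, 0 < C ∧ ∀ s : ℝ,
    |g (s ^ 2)| ≤ C * (1 + s ^ 4) ∧ |gDeriv g (s ^ 2) * s ^ 2| ≤ C * (1 + s ^ 4) := by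
  obtain ⟨p, hp, hgr⟩ := hg.growth
  obtain ⟨C₀, hC₀, h₀⟩ := hgr 0
  obtain ⟨C₁, hC₁, h₁⟩ := hgr 1
  obtain ⟨D₀, hD₀⟩ := (isCompact_Icc (a := (-1 : ℝ)) (b := 1)).exists_bound_of_continuousOn
    hg.continuous_sq.continuousOn
  obtain ⟨D₁, hD₁⟩ := (isCompact_Icc (a := (-1 : ℝ)) (b := 1)).exists_bound_of_continuousOn
    (hg.continuous_gDeriv_sq.mul (continuous_pow 2)).continuousOn
  refine ⟨C₀ + C₁ + |D₀| + |D₁|, by positivity, fun s => ?_⟩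
  have h4 : 0 ≤ s ^ 4 := by positivity
  by_cases hs : |s| ≤ 1
  · have h0 := hD₀ s (abs_le.1 hs)
    have h1 := hD₁ s (abs_le.1 hs)
    simp only [Real.norm_eq_abs, Pi.mul_apply] at h0 h1
    have hle : |D₀| + |D₁| ≤ (C₀ + C₁ + |D₀| + |D₁|) * (1 + s ^ 4) := by
      nlinarith [abs_nonneg D₀, abs_nonneg D₁]
    constructor
    · linarith [le_abs_self D₀, abs_nonneg D₁]
    · linarith [le_abs_self D₁, abs_nonneg D₀]
  · have hs1 : 1 ≤ s ^ 2 := by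
      rw [← sq_abs]; nlinarith [not_le.1 hs]
    have hs0 : 0 < s ^ 2 := by linarith
    have hpow : (s ^ 2) ^ p ≤ s ^ 4 := by
      calc (s ^ 2) ^ p ≤ (s ^ 2) ^ (2 : ℝ) := Real.rpow_le_rpow_of_exponent_le hs1 hp.le
        _ = s ^ 4 := by rw [Real.rpow_two]; ring
    have h0 := h₀ _ hs1
    have h1 := h₁ _ hs1
    simp only [iteratedDerivWithin_zero, Nat.cast_zero, sub_zero] at h0
    rw [iteratedDerivWithin_one, Nat.cast_one] at h1
    have hle : (C₀ + C₁) * s ^ 4 ≤ (C₀ + C₁ + |D₀| + |D₁|) * (1 + s ^ 4) := by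
      nlinarith [abs_nonneg D₀, abs_nonneg D₁, mul_nonneg (abs_nonneg D₀) h4,
        mul_nonneg (abs_nonneg D₁) h4]
    constructor
    · calc |g (s ^ 2)| ≤ C₀ * (s ^ 2) ^ p := h0
        _ ≤ C₀ * s ^ 4 := by gcongr
        _ ≤ _ := by nlinarith
    · calc |gDeriv g (s ^ 2) * s ^ 2| = |gDeriv g (s ^ 2)| * s ^ 2 := by
            rw [abs_mul, abs_of_pos hs0]
        _ ≤ C₁ * (s ^ 2) ^ (p - 1) * s ^ 2 := by gcongr; exact h1
        _ = C₁ * (s ^ 2) ^ p := by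
            rw [Real.rpow_sub_one hs0.ne', mul_assoc, div_mul_cancel₀ _ hs0.ne']
        _ ≤ C₁ * s ^ 4 := by gcongr
        _ ≤ _ := by nlinarith

/-- The derivative of `s ↦ g(s²) s`. -/
theorem hasDerivAt_force (hg : IsNonlinearity g) (s : ℝ) :
    HasDerivAt (fun s : ℝ => g (s ^ 2) * s) (g (s ^ 2) + 2 * (gDeriv g (s ^ 2) * s ^ 2)) s := by
  have h1 : HasDerivWithinAt g (gDeriv g (s ^ 2)) (Set.Ici 0) (s ^ 2) :=
    ((hg.smooth.differentiableOn (by simp)) (s ^ 2) (sq_nonneg s)).hasDerivWithinAt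
  have h2 : HasDerivAt (fun s : ℝ => s ^ 2) (2 * s) s := by
    simpa using hasDerivAt_pow 2 s
  have h3 : HasDerivAt (fun s : ℝ => g (s ^ 2)) (gDeriv g (s ^ 2) * (2 * s)) s := by
    rw [← hasDerivWithinAt_univ] at h2 ⊢
    exact HasDerivWithinAt.comp (h := fun s : ℝ => s ^ 2) s h1 h2 fun t _ => sq_nonneg t
  refine (h3.mul (hasDerivAt_id s)).congr_deriv ?_
  simp only [id]
  ring

theorem exists_force_lipschitz (hg : IsNonlinearity g) : ∃ C : ℝ, 0 < C ∧ ∀ a b : ℝ,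
    |g (b ^ 2) * b - g (a ^ 2) * a| ≤ C * (1 + a ^ 4 + b ^ 4) * |b - a| := by
  obtain ⟨C, hC, h⟩ := hg.exists_growth
  refine ⟨3 * C, by positivity, fun a b => ?_⟩
  have := (convex_uIcc a b).norm_image_sub_le_of_norm_hasDerivWithin_le
    (f := fun s : ℝ => g (s ^ 2) * s) (C := 3 * C * (1 + a ^ 4 + b ^ 4))
    (fun t _ => (hg.hasDerivAt_force t).hasDerivWithinAt) (fun t ht => ?_)
    Set.left_mem_uIcc Set.right_mem_uIcc
  · simpa only [Real.norm_eq_abs] using this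
  · have ht4 : t ^ 4 ≤ a ^ 4 + b ^ 4 := by
      have hm : |t| ≤ max |a| |b| := by
        rcases Set.mem_uIcc.1 ht with ⟨h1, h2⟩ | ⟨h1, h2⟩
        · exact abs_le_max_abs_abs h1 h2
        · rw [max_comm]; exact abs_le_max_abs_abs h1 h2
      have h4 : |t| ^ 4 ≤ (max |a| |b|) ^ 4 := by gcongr
      have e : ∀ z : ℝ, |z| ^ 4 = z ^ 4 := fun z => Even.pow_abs (by decide) z
      rw [e] at h4
      have ha : 0 ≤ a ^ 4 := by positivity
      have hb : 0 ≤ b ^ 4 := by positivity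
      rcases max_choice |a| |b| with h' | h' <;> rw [h', e] at h4 <;> linarith
    obtain ⟨h1, h2⟩ := h t
    rw [Real.norm_eq_abs]
    calc |g (t ^ 2) + 2 * (gDeriv g (t ^ 2) * t ^ 2)|
        ≤ |g (t ^ 2)| + |2 * (gDeriv g (t ^ 2) * t ^ 2)| := abs_add_le _ _
      _ = |g (t ^ 2)| + 2 * |gDeriv g (t ^ 2) * t ^ 2| := by
          rw [abs_mul 2, abs_of_pos (by norm_num : (0 : ℝ) < 2)]
      _ ≤ 3 * C * (1 + t ^ 4) := by linarith
      _ ≤ 3 * C * (1 + a ^ 4 + b ^ 4) := by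
          have := mul_le_mul_of_nonneg_left ht4 hC.le
          nlinarith

/-- Nothing is known about `g` on the negative axis, so the fundamental theorem of calculus is
applied to the continuous function `τ ↦ g (max τ 0)`, which has the same integrals over `[0, s²]`.
-/
theorem hasDerivAt_primitive (hg : IsNonlinearity g) (s : ℝ) :
    HasDerivAt (fun s : ℝ => 1 / 2 * ∫ τ in (0 : ℝ)..(s ^ 2), g τ) (g (s ^ 2) * s) s := by
  have hc : Continuous fun τ : ℝ => g (max τ 0) :=
    hg.smooth.continuousOn.comp_continuous (by fun_prop) fun τ => Set.mem_Ici.2 (le_max_right _ _)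
  have e : ∀ s : ℝ, ∫ τ in (0 : ℝ)..(s ^ 2), g τ = ∫ τ in (0 : ℝ)..(s ^ 2), g (max τ 0) := by
    intro s
    refine intervalIntegral.integral_congr fun τ hτ => ?_
    rw [Set.uIcc_of_le (sq_nonneg s)] at hτ
    rw [max_eq_left hτ.1]
  simp only [e]
  have h1 := (hc.integral_hasStrictDerivAt 0 (s ^ 2)).hasDerivAt
  have h2 : HasDerivAt (fun s : ℝ => s ^ 2) (2 * s) s := by
    simpa using hasDerivAt_pow 2 s
  have h3 := (HasDerivAt.comp (h := fun s : ℝ => s ^ 2) s h1 h2).const_mul (1 / 2)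
  refine h3.congr_deriv ?_
  rw [max_eq_left (sq_nonneg s)]
  ring

/-- Mean value inequality for the primitive minus its linear part: the derivative is a difference of
forces, which is of size `|h|` by the Lipschitz bound. -/
theorem exists_primitive_remainder (hg : IsNonlinearity g) : ∃ C : ℝ, 0 < C ∧ ∀ s h : ℝ,
    |1 / 2 * (∫ τ in (0 : ℝ)..((s + h) ^ 2), g τ) - 1 / 2 * (∫ τ in (0 : ℝ)..(s ^ 2), g τ)
      - g (s ^ 2) * (s * h)| ≤ C * (1 + s ^ 4 + h ^ 4) * h ^ 2 := by
  obtain ⟨C, hC, hlip⟩ := hg.exists_force_lipschitz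
  -- For `t` between `s` and `s + h` one has `t⁴ ≤ 8 (s⁴ + h⁴)`, hence `1 + s⁴ + t⁴ ≤ 9 (1 + s⁴ +
  -- h⁴)`.
  refine ⟨9 * C, by positivity, fun s h => ?_⟩
  have := (convex_uIcc s (s + h)).norm_image_sub_le_of_norm_hasDerivWithin_le
    (f := fun t : ℝ => 1 / 2 * (∫ τ in (0 : ℝ)..(t ^ 2), g τ) - g (s ^ 2) * s * t)
    (C := 9 * C * (1 + s ^ 4 + h ^ 4) * |h|)
    (fun t _ => ((hg.hasDerivAt_primitive t).sub
      ((hasDerivAt_id t).const_mul (g (s ^ 2) * s))).hasDerivWithinAt) (fun t ht => ?_)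
    Set.left_mem_uIcc Set.right_mem_uIcc
  · rw [Real.norm_eq_abs, Real.norm_eq_abs, add_sub_cancel_left] at this
    calc _ = |1 / 2 * (∫ τ in (0 : ℝ)..((s + h) ^ 2), g τ) - g (s ^ 2) * s * (s + h) -
          (1 / 2 * (∫ τ in (0 : ℝ)..(s ^ 2), g τ) - g (s ^ 2) * s * s)| := by
            congr 1; ring
      _ ≤ _ := this
      _ = _ := by rw [mul_assoc, ← sq, sq_abs]
  · rw [mul_one, Real.norm_eq_abs]
    have hts : |t - s| ≤ |h| := by
      have := Set.abs_sub_left_of_mem_uIcc ht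
      simpa using this
    have ht4 : t ^ 4 ≤ 8 * (s ^ 4 + h ^ 4) := by
      have hh : (t - s) ^ 4 ≤ h ^ 4 := by
        have e : ∀ z : ℝ, |z| ^ 4 = z ^ 4 := fun z => Even.pow_abs (by decide) z
        rw [← e (t - s), ← e h]
        gcongr
      have h2 : t ^ 2 ≤ 2 * (s ^ 2 + (t - s) ^ 2) := by nlinarith [sq_nonneg (2 * s - t)]
      have h3 : (t ^ 2) ^ 2 ≤ (2 * (s ^ 2 + (t - s) ^ 2)) ^ 2 := by gcongr
      nlinarith [sq_nonneg (s ^ 2 - (t - s) ^ 2)]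
    have hs4 : 0 ≤ s ^ 4 := by positivity
    have hh4 : 0 ≤ h ^ 4 := by positivity
    calc |g (t ^ 2) * t - g (s ^ 2) * s| ≤ C * (1 + s ^ 4 + t ^ 4) * |t - s| := hlip s t
      _ ≤ 9 * C * (1 + s ^ 4 + h ^ 4) * |h| := by
          refine mul_le_mul ?_ hts (abs_nonneg _) (by positivity)
          have : 1 + s ^ 4 + t ^ 4 ≤ 9 * (1 + s ^ 4 + h ^ 4) := by linarith
          nlinarith

theorem isWeight (hg : IsNonlinearity g) (c : ℝ) (w : H1 ℝ) :
    IsWeight w fun x => c + g (w.fn x ^ 2) := by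
  obtain ⟨C, hC, h⟩ := hg.exists_growth
  refine ⟨(hg.continuous_sq.comp_aestronglyMeasurable w.memLp_fn.1).const_add c, |c| + C,
    by positivity, fun x => ?_⟩
  have h4 : 0 ≤ w.fn x ^ 4 := by positivity
  refine (abs_add_le _ _).trans ?_
  nlinarith [(h (w.fn x)).1, abs_nonneg c, mul_nonneg (abs_nonneg c) h4]

theorem isWeight_gDeriv (hg : IsNonlinearity g) (w : H1 ℝ) :
    IsWeight w fun x => gDeriv g (w.fn x ^ 2) * w.fn x ^ 2 := by
  obtain ⟨C, hC, h⟩ := hg.exists_growth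
  exact ⟨(hg.continuous_gDeriv_sq.mul (continuous_pow 2)).comp_aestronglyMeasurable w.memLp_fn.1,
    C, hC.le, fun x => (h (w.fn x)).2⟩

theorem integrable_primitive (hg : IsNonlinearity g) (u : H1 ℝ) :
    Integrable fun x => 1 / 2 * ∫ τ in (0 : ℝ)..(u.fn x ^ 2), g τ := by
  obtain ⟨C, hC, h⟩ := hg.exists_primitive_remainder
  obtain ⟨K, hK, hw⟩ := exists_weight_bound
  have hcont : Continuous fun s : ℝ => 1 / 2 * ∫ τ in (0 : ℝ)..(s ^ 2), g τ :=
    continuous_iff_continuousAt.2 fun s => (hg.hasDerivAt_primitive s).continuousAt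
  refine (((hw u u u).1.const_mul C)).mono' (hcont.comp_aestronglyMeasurable u.memLp_fn.1)
    (Eventually.of_forall fun x => ?_)
  have := h 0 (u.fn x)
  simp only [zero_add, ne_eq, OfNat.ofNat_ne_zero, not_false_eq_true, zero_pow,
    intervalIntegral.integral_same, mul_zero, sub_zero, zero_mul, add_zero] at this
  rw [Real.norm_eq_abs]
  refine this.trans (le_of_eq ?_)
  rw [← abs_mul, abs_of_nonneg (mul_self_nonneg _)]
  ring

/-- `½ ∫ G(u²)` is differentiable on `H¹`. -/
theorem hasFDerivAt_primitive (hg : IsNonlinearity g) (u : H1 ℝ) :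
    HasFDerivAt (fun u : H1 ℝ => ∫ x, 1 / 2 * ∫ τ in (0 : ℝ)..(u.fn x ^ 2), g τ)
      (potentialForm (hg.isWeight 0 u) u) u := by
  obtain ⟨C, hC, h⟩ := hg.exists_primitive_remainder
  obtain ⟨K, hK, hw⟩ := exists_weight_bound
  -- The pointwise remainder carries the weight `1 + u⁴ + v⁴`, which is split into an admissible
  -- weight for `u` and one for `v`; on the unit ball this is `O(‖v‖²)`.
  have key : ∀ v : H1 ℝ, ‖(∫ x, 1 / 2 * ∫ τ in (0 : ℝ)..((u + v).fn x ^ 2), g τ) -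
      (∫ x, 1 / 2 * ∫ τ in (0 : ℝ)..(u.fn x ^ 2), g τ) - potentialForm (hg.isWeight 0 u) u v‖ ≤
      C * (K * (1 + ‖u‖ ^ 6) + K * (1 + ‖v‖ ^ 6)) * ‖v‖ ^ 2 := by
    intro v
    have hsub : Integrable fun x => (1 / 2 * ∫ τ in (0 : ℝ)..((u + v).fn x ^ 2), g τ) -
        1 / 2 * ∫ τ in (0 : ℝ)..(u.fn x ^ 2), g τ :=
      (hg.integrable_primitive _).sub (hg.integrable_primitive _)
    rw [potentialForm_apply, ← integral_sub (hg.integrable_primitive _) (hg.integrable_primitive _),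
      ← integral_sub hsub ((hg.isWeight 0 u).integrable u v)]
    refine (norm_integral_le_of_norm_le
      ((((hw u v v).1.add (hw v v v).1).const_mul C)) ?_).trans ?_
    · filter_upwards [H1.fn_add u v] with x hx
      rw [hx, Real.norm_eq_abs, zero_add]
      refine (h (u.fn x) (v.fn x)).trans ?_
      simp only [Pi.add_apply]
      rw [← abs_mul, abs_of_nonneg (mul_self_nonneg _)]
      nlinarith [mul_nonneg hC.le (sq_nonneg (v.fn x))]
    · rw [integral_const_mul]
      simp only [Pi.add_apply]
      rw [integral_add (hw u v v).1 (hw v v v).1, mul_assoc]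
      gcongr
      have h1 := (hw u v v).2
      have h2 := (hw v v v).2
      nlinarith
  rw [hasFDerivAt_iff_isLittleO_nhds_zero]
  have hO : (fun v : H1 ℝ => (∫ x, 1 / 2 * ∫ τ in (0 : ℝ)..((u + v).fn x ^ 2), g τ) -
      (∫ x, 1 / 2 * ∫ τ in (0 : ℝ)..(u.fn x ^ 2), g τ) - potentialForm (hg.isWeight 0 u) u v)
      =O[𝓝 0] fun v : H1 ℝ => ‖v‖ ^ 2 := by
    refine Asymptotics.IsBigO.of_bound (C * (K * (1 + ‖u‖ ^ 6) + K * (1 + 1))) ?_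
    filter_upwards [Metric.ball_mem_nhds (0 : H1 ℝ) one_pos] with v hv
    rw [mem_ball_zero_iff] at hv
    refine (key v).trans ?_
    rw [Real.norm_of_nonneg (by positivity)]
    gcongr
    exact pow_le_one₀ (norm_nonneg _) hv.le
  exact hO.trans_isLittleO (Asymptotics.isLittleO_norm_pow_id one_lt_two)

end IsNonlinearity

end NLSOscillation

namespace NLSOscillation

open MeasureTheory Filter Topology Function
open scoped Convolution ENNReal

/-! ### Regularity of `q`, `d` and `A` -/

/-- The `j`-th weak derivative as a continuous linear map. -/
noncomputable def gradL (j : Fin 3) : H1 ℝ →L[ℝ] Lp ℝ 2 (volume : Measure E3) :=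
  (ContinuousLinearMap.proj j).comp
    ((ContinuousLinearMap.snd ℝ _ _).comp (H1Submodule ℝ).subtypeL)

theorem mass_eq (u : H1 ℝ) : mass u = 1 / 2 * ‖fnL ℝ u‖ ^ 2 := by
  rw [norm_sq_Lp_eq, mass]
  simp only [Real.norm_eq_abs, sq_abs]
  rfl

theorem inner_fnL (u v : H1 ℝ) : inner ℝ (fnL ℝ u) (fnL ℝ v) = ∫ x, u.fn x * v.fn x :=
  inner_Lp_eq _ _

theorem energy_eq (g : ℝ → ℝ) (u : H1 ℝ) :
    energy g u = 1 / 2 * (∑ j : Fin 3, ‖gradL j u‖ ^ 2)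
      + ∫ x, 1 / 2 * ∫ τ in (0 : ℝ)..(u.fn x ^ 2), g τ := by
  rw [energy, integral_const_mul]
  simp only [norm_sq_Lp_eq, Real.norm_eq_abs, sq_abs]
  rfl

/-- Both forms are continuous in `v`, so density of test functions applies. This permits testing
with `∂_ω φ` and with quotients by `φ + ε`. -/
theorem SolvesGroundStateEq.extend {g : ℝ → ℝ} (hg : IsNonlinearity g) {ω : ℝ} {φ : H1 ℝ}
    (h : SolvesGroundStateEq g ω φ) (v : H1 ℝ) :
    dirichletForm v φ + potentialForm (hg.isWeight ω φ) v φ = 0 := by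
  refine eq_zero_of_test (f := fun v => dirichletForm v φ + potentialForm (hg.isWeight ω φ) v φ)
    ?_ (fun ψ hψ => ?_) v
  · refine (continuous_dirichletForm.comp (continuous_id.prodMk continuous_const)).add ?_
    exact ((potentialForm (hg.isWeight ω φ)).flip φ).continuous
  · rw [dirichletForm_test, potentialForm_test, ← h ψ hψ]
    congr 1
    refine integral_congr_ae (Eventually.of_forall fun x => ?_)
    simp only
    ring

namespace IsGroundStateFamily

variable {g : ℝ → ℝ} {O : Set ℝ} {φ : ℝ → H1 ℝ}

theorem hasDerivAt (hφ : IsGroundStateFamily g O φ) {ω : ℝ} (hω : ω ∈ O) :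
    HasDerivAt φ (deriv φ ω) ω :=
  ((hφ.contDiffOn.differentiableOn (by norm_num)).differentiableAt
    (hφ.isOpen.mem_nhds hω)).hasDerivAt

theorem contDiffOn_qFun (hφ : IsGroundStateFamily g O φ) : ContDiffOn ℝ 2 (qFun φ) O := by
  have h1 : ContDiffOn ℝ 2 (fun ω => fnL ℝ (φ ω)) O := (fnL ℝ).contDiff.comp_contDiffOn hφ.contDiffOn
  refine ((contDiffOn_const (c := (1 / 2 : ℝ))).mul (h1.norm_sq ℝ)).congr fun ω _ => ?_
  exact mass_eq _

/-- By the chain rule the derivative is the ground state equation tested with `∂_ω φ`, which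
vanishes, plus the contribution of the explicit factor `ω`, which is the mass. -/
theorem hasDerivAt_dFun (hφ : IsGroundStateFamily g O φ) (hg : IsNonlinearity g) {ω : ℝ}
    (hω : ω ∈ O) : HasDerivAt (dFun g φ) (qFun φ ω) ω := by
  have hd := hφ.hasDerivAt hω
  set φ' := deriv φ ω
  have hm : HasDerivAt (fun ω => mass (φ ω)) (inner ℝ (fnL ℝ (φ ω)) (fnL ℝ φ')) ω := by
    have h1 : HasDerivAt (fun ω => fnL ℝ (φ ω)) (fnL ℝ φ') ω :=
      (fnL ℝ).hasFDerivAt.comp_hasDerivAt ω hd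
    have h2 := h1.norm_sq.const_mul (1 / 2)
    simp only [mass_eq]
    exact h2.congr_deriv (by ring)
  have hk : HasDerivAt (fun ω => 1 / 2 * ∑ j : Fin 3, ‖gradL j (φ ω)‖ ^ 2)
      (dirichletForm (φ ω) φ') ω := by
    have h1 : ∀ j, HasDerivAt (fun ω => gradL j (φ ω)) (gradL j φ') ω := fun j =>
      (gradL j).hasFDerivAt.comp_hasDerivAt ω hd
    have h2 := (HasDerivAt.fun_sum fun j (_ : j ∈ Finset.univ) => (h1 j).norm_sq).const_mul (1 / 2)
    refine h2.congr_deriv ?_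
    rw [← Finset.mul_sum, ← mul_assoc]
    norm_num
    rfl
  have hp : HasDerivAt (fun ω => ∫ x, 1 / 2 * ∫ τ in (0 : ℝ)..((φ ω).fn x ^ 2), g τ)
      (potentialForm (hg.isWeight 0 (φ ω)) (φ ω) φ') ω :=
    (hg.hasFDerivAt_primitive (φ ω)).comp_hasDerivAt ω hd
  have h := ((hk.add hp).add ((hasDerivAt_id ω).mul hm))
  have heq : dFun g φ = fun ω => (1 / 2 * ∑ j : Fin 3, ‖gradL j (φ ω)‖ ^ 2) +
      (∫ x, 1 / 2 * ∫ τ in (0 : ℝ)..((φ ω).fn x ^ 2), g τ) + ω * mass (φ ω) := by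
    ext ω
    rw [dFun, energy_eq]
  rw [heq]
  refine h.congr_deriv ?_
  have hs := (hφ.solves ω hω).extend hg φ'
  rw [dirichletForm_comm] at hs
  have e : potentialForm (hg.isWeight ω (φ ω)) φ' (φ ω) =
      potentialForm (hg.isWeight 0 (φ ω)) (φ ω) φ' + ω * inner ℝ (fnL ℝ (φ ω)) (fnL ℝ φ') := by
    rw [potentialForm_apply, potentialForm_apply, inner_fnL, ← integral_const_mul,
      ← integral_add ((hg.isWeight 0 (φ ω)).integrable _ _)
        ((integrable_mul_of_memLp (φ ω).memLp_fn φ'.memLp_fn).const_mul ω)]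
    refine integral_congr_ae (Eventually.of_forall fun x => ?_)
    simp only
    ring
  rw [e] at hs
  simp only [id, qFun]
  linarith

end IsGroundStateFamily

/-- The imaginary part as a continuous linear map on `L²`. -/
noncomputable def imL : Lp ℂ 2 (volume : Measure E3) →L[ℝ] Lp ℝ 2 (volume : Measure E3) :=
  Complex.imCLM.compLpL 2 volume

theorem imL_ae (f : Lp ℂ 2 (volume : Measure E3)) : imL f =ᵐ[volume] fun x => (f x).im :=
  Complex.imCLM.coeFn_compLpL f

theorem AFun_eq (φ : ℝ → H1 ℝ) (Ψ₃ : ℝ → H1 ℂ) (ω : ℝ) :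
    AFun φ Ψ₃ ω = inner ℝ (fnL ℝ (deriv φ ω)) (imL (fnL ℂ (Ψ₃ ω))) := by
  rw [inner_Lp_eq, AFun, symp]
  refine integral_congr_ae ?_
  filter_upwards [imL_ae (fnL ℂ (Ψ₃ ω))] with x hx
  rw [hx]
  change _ = (deriv φ ω).fn x * ((Ψ₃ ω).fn x).im
  simp [Psi2]

/-- One derivative of the `C²` family is spent on `Ψ₂`. The reduced field contains `A'`, so it is
only known to be continuous. -/
theorem contDiffOn_AFun {g : ℝ → ℝ} {O : Set ℝ} {φ : ℝ → H1 ℝ} (hφ : IsGroundStateFamily g O φ)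
    {ωs r : ℝ} (hrO : Metric.ball ωs r ⊆ O) {Ψ₃ Ψ₄ : ℝ → H1 ℂ} (hΨ : IsFrame g φ ωs r Ψ₃ Ψ₄) :
    ContDiffOn ℝ 1 (AFun φ Ψ₃) (Metric.ball ωs r) := by
  have h1 : ContDiffOn ℝ 1 (deriv φ) (Metric.ball ωs r) :=
    (hφ.contDiffOn.mono hrO).deriv_of_isOpen Metric.isOpen_ball (by norm_num)
  have h2 : ContDiffOn ℝ 1 Ψ₃ (Metric.ball ωs r) := hΨ.smooth₃.of_le (by exact_mod_cast le_top)
  refine (ContDiffOn.inner ℝ ((fnL ℝ).contDiff.comp_contDiffOn h1)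
    (imL.contDiff.comp_contDiffOn ((fnL ℂ).contDiff.comp_contDiffOn h2))).congr fun ω _ => ?_
  exact AFun_eq _ _ _

end NLSOscillation

namespace NLSOscillation

open MeasureTheory Filter Topology Function
open scoped Convolution ENNReal

/-! ### Nonnegativity of the operator annihilating a positive solution -/

theorem integral_abs_mul_le {f h : E3 → ℝ} (hf : MemLp f 2 volume) (hh : MemLp h 2 volume) :
    ∫ x, |f x| * |h x| ≤ √(∫ x, f x ^ 2) * √(∫ x, h x ^ 2) := by
  have := integral_mul_le_Lp_mul_Lq_of_nonneg (μ := (volume : Measure E3))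
    Real.HolderConjugate.two_two (f := fun x => |f x|) (g := fun x => |h x|)
    (Eventually.of_forall fun x => abs_nonneg _) (Eventually.of_forall fun x => abs_nonneg _)
    (by simpa using hf.norm) (by simpa using hh.norm)
  simpa only [Real.rpow_two, sq_abs, ← Real.sqrt_eq_rpow] using this

/-- A continuously differentiable function with bounded derivative and vanishing at the origin
acts on `H¹` by composition. -/
structure IsAdmissible (F F' : ℝ → ℝ) (M : ℝ) : Prop where
  zero : F 0 = 0
  hasDeriv : ∀ s, HasDerivAt F (F' s) s
  cont : Continuous F'
  bound : ∀ s, |F' s| ≤ M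

namespace IsAdmissible

variable {F F' : ℝ → ℝ} {M : ℝ}

theorem nonneg (h : IsAdmissible F F' M) : 0 ≤ M := (abs_nonneg _).trans (h.bound 0)

theorem contDiff (h : IsAdmissible F F' M) : ContDiff ℝ 1 F := by
  rw [contDiff_one_iff_deriv]
  refine ⟨fun s => (h.hasDeriv s).differentiableAt, ?_⟩
  rw [funext fun s => (h.hasDeriv s).deriv]
  exact h.cont

theorem lipschitz (h : IsAdmissible F F' M) (a b : ℝ) : |F a - F b| ≤ M * |a - b| := by
  have := (convex_univ (𝕜 := ℝ) (E := ℝ)).norm_image_sub_le_of_norm_hasDerivWithin_le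
    (f := F) (C := M) (fun t _ => (h.hasDeriv t).hasDerivWithinAt) (fun t _ => h.bound t)
    (Set.mem_univ b) (Set.mem_univ a)
  simpa using this

theorem memLp_comp (h : IsAdmissible F F' M) (u : H1 ℝ) :
    MemLp (fun x => F (u.fn x)) 2 volume := by
  refine (u.memLp_fn.const_mul M).of_le
    (h.contDiff.continuous.comp_aestronglyMeasurable u.memLp_fn.1) (Eventually.of_forall fun x => ?_)
  have := h.lipschitz (u.fn x) 0
  rw [h.zero, sub_zero, sub_zero] at this
  simpa [abs_of_nonneg h.nonneg] using this

theorem memLp_grad (h : IsAdmissible F F' M) (u : H1 ℝ) {w : E3 → ℝ} (hw : MemLp w 2 volume) :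
    MemLp (fun x => F' (u.fn x) * w x) 2 volume := by
  refine (hw.const_mul M).of_le
    ((h.cont.comp_aestronglyMeasurable u.memLp_fn.1).mul hw.1) (Eventually.of_forall fun x => ?_)
  rw [norm_mul, norm_mul]
  gcongr
  rw [Real.norm_eq_abs, Real.norm_of_nonneg h.nonneg]
  exact h.bound _

theorem integral_test (h : IsAdmissible F F' M) {ψ η : E3 → ℝ} (hψ : IsTest ψ) (hη : IsTest η)
    (j : Fin 3) :
    ∫ x, partialD j η x * F (ψ x) = -∫ x, η x * (F' (ψ x) * partialD j ψ x) := by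
  have hd : ∀ x, HasFDerivAt (fun x => F (ψ x)) (F' (ψ x) • fderiv ℝ ψ x) x := fun x =>
    (h.hasDeriv (ψ x)).comp_hasFDerivAt x (hψ.differentiable x).hasFDerivAt
  have e : ∀ x, fderiv ℝ (fun x => F (ψ x)) x (EuclideanSpace.single j 1) =
      F' (ψ x) * partialD j ψ x := fun x => by
    rw [(hd x).fderiv]; rfl
  have c1 : Continuous fun x => F (ψ x) := h.contDiff.continuous.comp hψ.1.continuous
  have c2 : Continuous fun x => F' (ψ x) * partialD j ψ x :=
    (h.cont.comp hψ.1.continuous).mul (hψ.continuous_partialD j)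
  have i1 : Integrable fun x => η x * (F' (ψ x) * partialD j ψ x) :=
    (hη.1.continuous.mul c2).integrable_of_hasCompactSupport hη.2.mul_right
  have i2 : Integrable fun x => partialD j η x * F (ψ x) :=
    ((hη.continuous_partialD j).mul c1).integrable_of_hasCompactSupport
      (hη.hasCompactSupport_partialD j).mul_right
  have i3 : Integrable fun x => η x * F (ψ x) :=
    (hη.1.continuous.mul c1).integrable_of_hasCompactSupport hη.2.mul_right
  have := integral_mul_fderiv_eq_neg_fderiv_mul_of_integrable (𝕜 := ℝ) (f := η)
    (g := fun x => F (ψ x)) (v := EuclideanSpace.single j 1) i2 (by simpa only [e] using i1) i3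
    (fun x _ => hη.differentiable x) (fun x _ => (hd x).differentiableAt)
  simp only [e] at this
  rw [this, neg_neg]
  rfl

/-- The chain rule passes from test functions `U n` to the limit. The left side converges because
`F` is Lipschitz. On the right, `F'(U n) (∂_j U n - ∂_j u)` is small because `F'` is bounded, while
`F'(U n) ∂_j u` converges by dominated convergence along an almost everywhere convergent
subsequence. -/
theorem weakPartial (h : IsAdmissible F F' M) (u : H1 ℝ) (j : Fin 3) :
    IsWeakPartial j (fun x => F (u.fn x)) (fun x => F' (u.fn x) * u.grad j x) := by
  intro η hη
  simp only [smul_eq_mul]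
  obtain ⟨ψ, hψ, hlim⟩ := exists_test_tendsto u
  obtain ⟨ns, hns, hae⟩ := H1.tendsto_ae hlim
  have hlim' := hlim.comp hns.tendsto_atTop
  set U : ℕ → H1 ℝ := fun n => (hψ (ns n)).toH1 with hU
  have hUlim : Tendsto U atTop (𝓝 u) := hlim'
  have hn : Tendsto (fun n => ‖U n - u‖) atTop (𝓝 0) := by
    simpa using (tendsto_iff_norm_sub_tendsto_zero.1 hUlim)
  have hid : ∀ n, ∫ x, partialD j η x * F ((U n).fn x) =
      -∫ x, η x * (F' ((U n).fn x) * (U n).grad j x) := by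
    intro n
    have h1 : (fun x => partialD j η x * F ((U n).fn x)) =ᵐ[volume]
        fun x => partialD j η x * F (ψ (ns n) x) := by
      filter_upwards [(hψ (ns n)).fn_toH1] with x hx
      rw [hU]
      simp only
      rw [hx]
    have h2 : (fun x => η x * (F' ((U n).fn x) * (U n).grad j x)) =ᵐ[volume]
        fun x => η x * (F' (ψ (ns n) x) * partialD j (ψ (ns n)) x) := by
      filter_upwards [(hψ (ns n)).fn_toH1, (hψ (ns n)).grad_toH1 j] with x hx hx'
      rw [hU]
      simp only
      rw [hx, hx']
    rw [integral_congr_ae h1, integral_congr_ae h2]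
    exact h.integral_test (hψ (ns n)) hη j
  have hL : Tendsto (fun n => ∫ x, partialD j η x * F ((U n).fn x)) atTop
      (𝓝 (∫ x, partialD j η x * F (u.fn x))) := by
    rw [tendsto_iff_norm_sub_tendsto_zero]
    have hb : ∀ n, ‖(∫ x, partialD j η x * F ((U n).fn x)) - ∫ x, partialD j η x * F (u.fn x)‖ ≤
        M * (√(∫ x, partialD j η x ^ 2) * ‖U n - u‖) := by
      intro n
      rw [← integral_sub (integrable_mul_of_memLp (hη.memLp_partialD j) (h.memLp_comp _))
        (integrable_mul_of_memLp (hη.memLp_partialD j) (h.memLp_comp _))]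
      refine (norm_integral_le_of_norm_le (g := fun x => M * (|partialD j η x| * |(U n - u).fn x|))
        ((integrable_mul_of_memLp (hη.memLp_partialD j).norm (U n - u).memLp_fn.norm).const_mul M)
        ?_).trans ?_
      · filter_upwards [H1.fn_sub (U n) u] with x hx
        rw [hx, ← mul_sub, norm_mul, Real.norm_eq_abs, Real.norm_eq_abs]
        have := mul_le_mul_of_nonneg_left (h.lipschitz ((U n).fn x) (u.fn x))
          (abs_nonneg (partialD j η x))
        linarith
      · rw [integral_const_mul]
        refine mul_le_mul_of_nonneg_left ?_ h.nonneg
        refine (integral_abs_mul_le (hη.memLp_partialD j) (U n - u).memLp_fn).trans ?_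
        gcongr
        rw [Real.sqrt_le_left (norm_nonneg _)]
        exact (U n - u).integral_sq_le
    refine squeeze_zero (fun n => norm_nonneg _) hb ?_
    simpa using (hn.const_mul (√(∫ x, partialD j η x ^ 2))).const_mul M
  have hR : Tendsto (fun n => ∫ x, η x * (F' ((U n).fn x) * (U n).grad j x)) atTop
      (𝓝 (∫ x, η x * (F' (u.fn x) * u.grad j x))) := by
    have hR1 : Tendsto (fun n => ∫ x, η x * (F' ((U n).fn x) * u.grad j x)) atTop
        (𝓝 (∫ x, η x * (F' (u.fn x) * u.grad j x))) := by
      refine tendsto_integral_of_dominated_convergence (fun x => M * (|η x| * |u.grad j x|))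
        (fun n => (integrable_mul_of_memLp hη.memLp (h.memLp_grad _ (u.memLp_grad j))).1)
        ((integrable_mul_of_memLp hη.memLp.norm (u.memLp_grad j).norm).const_mul M)
        (fun n => Eventually.of_forall fun x => ?_) ?_
      · rw [norm_mul, norm_mul, Real.norm_eq_abs, Real.norm_eq_abs, Real.norm_eq_abs]
        have := mul_le_mul_of_nonneg_right (h.bound ((U n).fn x))
          (mul_nonneg (abs_nonneg (η x)) (abs_nonneg (u.grad j x)))
        linarith
      · filter_upwards [hae] with x hx
        exact (((h.cont.tendsto _).comp hx).mul_const _).const_mul _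
    have hR2 : Tendsto (fun n => (∫ x, η x * (F' ((U n).fn x) * (U n).grad j x)) -
        ∫ x, η x * (F' ((U n).fn x) * u.grad j x)) atTop (𝓝 0) := by
      rw [tendsto_zero_iff_norm_tendsto_zero]
      have hb : ∀ n, ‖(∫ x, η x * (F' ((U n).fn x) * (U n).grad j x)) -
          ∫ x, η x * (F' ((U n).fn x) * u.grad j x)‖ ≤ M * (√(∫ x, η x ^ 2) * ‖U n - u‖) := by
        intro n
        rw [← integral_sub (integrable_mul_of_memLp hη.memLp (h.memLp_grad _ ((U n).memLp_grad j)))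
          (integrable_mul_of_memLp hη.memLp (h.memLp_grad _ (u.memLp_grad j)))]
        have hsub : (U n - u).grad j =ᵐ[volume] fun x => (U n).grad j x - u.grad j x :=
          Lp.coeFn_sub _ _
        refine (norm_integral_le_of_norm_le (g := fun x => M * (|η x| * |(U n - u).grad j x|))
          ((integrable_mul_of_memLp hη.memLp.norm ((U n - u).memLp_grad j).norm).const_mul M)
          ?_).trans ?_
        · filter_upwards [hsub] with x hx
          rw [hx, ← mul_sub, ← mul_sub, norm_mul, norm_mul, Real.norm_eq_abs, Real.norm_eq_abs,
            Real.norm_eq_abs]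
          have := mul_le_mul_of_nonneg_right (h.bound ((U n).fn x))
            (mul_nonneg (abs_nonneg (η x)) (abs_nonneg ((U n).grad j x - u.grad j x)))
          linarith
        · rw [integral_const_mul]
          refine mul_le_mul_of_nonneg_left ?_ h.nonneg
          refine (integral_abs_mul_le hη.memLp ((U n - u).memLp_grad j)).trans ?_
          gcongr
          rw [Real.sqrt_le_left (norm_nonneg _)]
          have := norm_sq_Lp_eq ((U n - u).1.2 j)
          rw [H1.grad, ← this]
          gcongr
          exact (U n - u).norm_grad_le j
      refine squeeze_zero (fun n => norm_nonneg _) hb ?_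
      simpa using (hn.const_mul (√(∫ x, η x ^ 2))).const_mul M
    simpa using hR2.add hR1
  have hL' := hL
  simp only [hid] at hL'
  exact tendsto_nhds_unique hL (by simpa only [hid] using hR.neg)

end IsAdmissible

/-- A `C¹` extension of `s ↦ 1/(s+ε) - 1/ε` to the line. -/
noncomputable def shiftedInv (ε s : ℝ) : ℝ := 1 / (max s 0 + ε) - 1 / ε - min s 0 / ε ^ 2

theorem isAdmissible_shiftedInv {ε : ℝ} (hε : 0 < ε) :
    IsAdmissible (shiftedInv ε) (fun s => -(1 / (max s 0 + ε) ^ 2)) (1 / ε ^ 2) where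
  zero := by simp [shiftedInv]
  hasDeriv := by
    have hcont : Continuous (shiftedInv ε) := by
      unfold shiftedInv
      have : ∀ s : ℝ, max s 0 + ε ≠ 0 := fun s => by positivity
      fun_prop (disch := simp [this])
    have hcont' : Continuous fun s : ℝ => -(1 / (max s 0 + ε) ^ 2) := by
      have : ∀ s : ℝ, max s 0 + ε ≠ 0 := fun s => by positivity
      fun_prop (disch := simp [this])
    -- Only `s = 0` is delicate: there the derivatives from both sides extend continuously to
    -- `-1/ε²`.
    refine hasDerivAt_of_hasDerivAt_of_ne' (x := 0) (fun s hs => ?_) hcont.continuousAt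
      hcont'.continuousAt
    rcases lt_or_gt_of_ne hs with h | h
    · have h1 : HasDerivAt (fun s : ℝ => 1 / (0 + ε) - 1 / ε - s / ε ^ 2) (-(1 / ε ^ 2)) s := by
        simpa using ((hasDerivAt_id s).div_const (ε ^ 2)).const_sub (1 / (0 + ε) - 1 / ε)
      rw [max_eq_right h.le, zero_add]
      refine h1.congr_of_eventuallyEq ?_
      filter_upwards [Iio_mem_nhds h] with t ht
      rw [shiftedInv, max_eq_right (le_of_lt ht), min_eq_left (le_of_lt ht)]
    · have h0 : s + ε ≠ 0 := by positivity
      have h1 : HasDerivAt (fun s : ℝ => 1 / (s + ε) - 1 / ε - 0 / ε ^ 2)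
          (-(1 / (s + ε) ^ 2)) s := by
        have := ((((hasDerivAt_id s).add_const ε).fun_inv h0).sub_const (1 / ε)).sub_const
          (0 / ε ^ 2)
        simpa [neg_div] using this
      rw [max_eq_left h.le]
      refine h1.congr_of_eventuallyEq ?_
      filter_upwards [Ioi_mem_nhds h] with t ht
      rw [shiftedInv, max_eq_left (le_of_lt ht), min_eq_right (le_of_lt ht)]
  cont := by
    have : ∀ s : ℝ, max s 0 + ε ≠ 0 := fun s => by positivity
    fun_prop (disch := simp [this])
  bound := fun s => by
    rw [abs_neg, abs_of_nonneg (by positivity)]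
    gcongr
    linarith [le_max_right s 0]

/-- Test the equation with `z = v²/(φ + ε)`. Picone's identity `|∇v|² - ∇z·∇φ = |∇v - v ∇φ/(φ +
ε)|²` shows that the Dirichlet part of the tested equation is at most `∫ |∇v|²`. The shift `ε` puts
`z` in `H¹` without a positive lower bound for `φ`. -/
theorem picone_regularized {g : ℝ → ℝ} (hg : IsNonlinearity g) {ω : ℝ} {φ : H1 ℝ}
    (h : SolvesGroundStateEq g ω φ) (hpos : ∀ᵐ x, 0 < φ.fn x) {v : E3 → ℝ} (hv : IsTest v)
    {ε : ℝ} (hε : 0 < ε) :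
    0 ≤ dirichletForm hv.toH1 hv.toH1 +
      ∫ x, (ω + g (φ.fn x ^ 2)) * (v x * v x) * (φ.fn x / (φ.fn x + ε)) := by
  have ha := isAdmissible_shiftedInv hε
  have hv2 : IsTest fun x => v x * v x := hv.mul hv
  set F' : ℝ → ℝ := fun s => -(1 / (max s 0 + ε) ^ 2)
  set z₁ : H1 ℝ := H1.of (hv2.memLp_mul (ha.memLp_comp φ))
    (fun j => (hv2.memLp_mul (ha.memLp_grad φ (φ.memLp_grad j))).add
      (hv2.memLp_partialD_mul (ha.memLp_comp φ) j))
    (fun j => (ha.weakPartial φ j).mul_test (ha.memLp_comp φ) (ha.memLp_grad φ (φ.memLp_grad j)) hv2)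
    with hz₁
  -- `z₁` is `v² (1/(φ + ε) - 1/ε)`, normalized so that the composed function vanishes at the
  -- origin; adding `v²/ε` undoes the normalization.
  set z : H1 ℝ := z₁ + (1 / ε) • hv2.toH1 with hz
  have hzfn : z.fn =ᵐ[volume] fun x => v x * v x / (φ.fn x + ε) := by
    filter_upwards [H1.fn_add z₁ ((1 / ε) • hv2.toH1), H1.fn_smul (1 / ε) hv2.toH1, hv2.fn_toH1,
      H1.fn_of (hv2.memLp_mul (ha.memLp_comp φ)) (fun j => (hv2.memLp_mul (ha.memLp_grad φ
        (φ.memLp_grad j))).add (hv2.memLp_partialD_mul (ha.memLp_comp φ) j)) (fun j =>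
        (ha.weakPartial φ j).mul_test (ha.memLp_comp φ) (ha.memLp_grad φ (φ.memLp_grad j)) hv2),
      hpos] with x h1 h2 h3 h4 h5
    rw [← hz] at h1
    rw [← hz₁] at h4
    rw [h1, h2, h3, h4, shiftedInv, max_eq_left h5.le, min_eq_right h5.le]
    ring
  have hzgrad : ∀ j, z.grad j =ᵐ[volume] fun x =>
      2 * v x * partialD j v x / (φ.fn x + ε) - v x ^ 2 * φ.grad j x / (φ.fn x + ε) ^ 2 := by
    intro j
    have e1 : z.grad j =ᵐ[volume] fun x => z₁.grad j x + ((1 / ε) • hv2.toH1).grad j x :=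
      Lp.coeFn_add _ _
    have e2 : ((1 / ε) • hv2.toH1).grad j =ᵐ[volume] fun x => (1 / ε) * hv2.toH1.grad j x :=
      Lp.coeFn_smul _ _
    filter_upwards [e1, e2, hv2.grad_toH1 j,
      H1.grad_of (hv2.memLp_mul (ha.memLp_comp φ)) (fun j => (hv2.memLp_mul (ha.memLp_grad φ
        (φ.memLp_grad j))).add (hv2.memLp_partialD_mul (ha.memLp_comp φ) j)) (fun j =>
        (ha.weakPartial φ j).mul_test (ha.memLp_comp φ) (ha.memLp_grad φ (φ.memLp_grad j)) hv2) j,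
      hpos] with x h1 h2 h3 h4 h5
    rw [← hz₁] at h4
    rw [h1, h2, h3, h4]
    simp only [Pi.add_apply, F', shiftedInv, max_eq_left h5.le, min_eq_right h5.le,
      partialD_mul hv.differentiable hv.differentiable]
    ring
  have heq := h.extend hg z
  have hpot : potentialForm (hg.isWeight ω φ) z φ =
      ∫ x, (ω + g (φ.fn x ^ 2)) * (v x * v x) * (φ.fn x / (φ.fn x + ε)) := by
    rw [potentialForm_apply]
    refine integral_congr_ae ?_
    filter_upwards [hzfn] with x hx
    rw [hx]
    ring
  have hdir : dirichletForm z φ ≤ dirichletForm hv.toH1 hv.toH1 := by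
    rw [dirichletForm_apply, dirichletForm_apply]
    refine Finset.sum_le_sum fun j _ => integral_mono_ae
      (integrable_mul_of_memLp (z.memLp_grad j) (φ.memLp_grad j))
      (integrable_mul_of_memLp (hv.toH1.memLp_grad j) (hv.toH1.memLp_grad j)) ?_
    filter_upwards [hzgrad j, hv.grad_toH1 j, hpos] with x h1 h2 h3
    rw [h1, h2]
    have h0 : φ.fn x + ε ≠ 0 := by positivity
    have : partialD j v x * partialD j v x -
        (2 * v x * partialD j v x / (φ.fn x + ε) - v x ^ 2 * φ.grad j x / (φ.fn x + ε) ^ 2)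
          * φ.grad j x = (partialD j v x - v x * φ.grad j x / (φ.fn x + ε)) ^ 2 := by
      field_simp
      ring
    nlinarith [sq_nonneg (partialD j v x - v x * φ.grad j x / (φ.fn x + ε))]
  rw [← hpot]
  linarith

/-- Let `ε = 1/(n+1)` tend to zero in the regularized inequality. As `φ > 0` almost everywhere,
`φ/(φ + ε)` is at most one and tends to one, so dominated convergence applies to test functions;
density does the rest. -/
theorem form_nonneg_of_pos_solution {g : ℝ → ℝ} (hg : IsNonlinearity g) {ω : ℝ} {φ : H1 ℝ}
    (h : SolvesGroundStateEq g ω φ) (hpos : ∀ᵐ x, 0 < φ.fn x) (v : H1 ℝ) :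
    0 ≤ dirichletForm v v + potentialForm (hg.isWeight ω φ) v v := by
  refine nonneg_of_test (f := fun v => dirichletForm v v + potentialForm (hg.isWeight ω φ) v v)
    ?_ (fun ψ hψ => ?_) v
  · refine (continuous_dirichletForm.comp (continuous_id.prodMk continuous_id)).add ?_
    exact (potentialForm (hg.isWeight ω φ)).continuous.clm_apply continuous_id
  · have hint := (hg.isWeight ω φ).integrable hψ.toH1 hψ.toH1
    have hint' : Integrable fun x => (ω + g (φ.fn x ^ 2)) * (ψ x * ψ x) := by
      refine hint.congr ?_
      filter_upwards [hψ.fn_toH1] with x hx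
      rw [hx]
    have e : potentialForm (hg.isWeight ω φ) hψ.toH1 hψ.toH1 =
        ∫ x, (ω + g (φ.fn x ^ 2)) * (ψ x * ψ x) := by
      rw [potentialForm_apply]
      refine integral_congr_ae ?_
      filter_upwards [hψ.fn_toH1] with x hx
      rw [hx]
    rw [e]
    have hlim : Tendsto (fun n : ℕ => ∫ x, (ω + g (φ.fn x ^ 2)) * (ψ x * ψ x) *
        (φ.fn x / (φ.fn x + 1 / ((n : ℝ) + 1)))) atTop
        (𝓝 (∫ x, (ω + g (φ.fn x ^ 2)) * (ψ x * ψ x))) := by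
      refine tendsto_integral_of_dominated_convergence
        (fun x => ‖(ω + g (φ.fn x ^ 2)) * (ψ x * ψ x)‖) (fun n => ?_) hint'.norm (fun n => ?_) ?_
      · refine hint'.1.mul ?_
        exact (φ.memLp_fn.1.aemeasurable.div
          (φ.memLp_fn.1.aemeasurable.add_const _)).aestronglyMeasurable
      · filter_upwards [hpos] with x hx
        rw [norm_mul]
        refine mul_le_of_le_one_right (norm_nonneg _) ?_
        rw [Real.norm_of_nonneg (by positivity), div_le_one (by positivity)]
        have : (0 : ℝ) < 1 / ((n : ℝ) + 1) := by positivity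
        linarith
      · filter_upwards [hpos] with x hx
        have h1 : Tendsto (fun n : ℕ => φ.fn x / (φ.fn x + 1 / ((n : ℝ) + 1))) atTop
            (𝓝 (φ.fn x / (φ.fn x + 0))) :=
          tendsto_const_nhds.div (tendsto_one_div_add_atTop_nhds_zero_nat.const_add _)
            (by simpa using hx.ne')
        rw [add_zero, div_self hx.ne'] at h1
        simpa using h1.const_mul ((ω + g (φ.fn x ^ 2)) * (ψ x * ψ x))
    refine ge_of_tendsto (hlim.const_add _) (Eventually.of_forall fun n => ?_)
    exact picone_regularized hg h hpos hψ (by positivity)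

end NLSOscillation

namespace NLSOscillation

open MeasureTheory Filter Topology Function
open scoped Convolution ENNReal

/-! ### Positivity of `A` at the critical frequency -/

/-- The image of a complex element of `H¹` under a real linear functional. -/
noncomputable def H1.mapL (L : ℂ →L[ℝ] ℝ) (u : H1 ℂ) : H1 ℝ :=
  ⟨(L.compLp u.1.1, fun j => L.compLp (u.1.2 j)), fun j => by
    intro ψ hψ
    have h := congrArg L (u.weakPartial j ψ hψ)
    have i1 : Integrable fun x => partialD j ψ x • u.fn x :=
      integrable_smul_Lp (hψ.memLp_partialD j) u.1.1
    have i2 : Integrable fun x => ψ x • u.grad j x := integrable_smul_Lp hψ.memLp (u.1.2 j)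
    rw [map_neg, ← L.integral_comp_comm i1, ← L.integral_comp_comm i2] at h
    have e1 : (fun x => partialD j ψ x • (L.compLp u.1.1) x) =ᵐ[volume]
        fun x => L (partialD j ψ x • u.fn x) := by
      filter_upwards [L.coeFn_compLp u.1.1] with x hx
      rw [hx, map_smul]
      rfl
    have e2 : (fun x => ψ x • (L.compLp (u.1.2 j)) x) =ᵐ[volume]
        fun x => L (ψ x • u.grad j x) := by
      filter_upwards [L.coeFn_compLp (u.1.2 j)] with x hx
      rw [hx, map_smul]
      rfl
    rw [integral_congr_ae e1, integral_congr_ae e2]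
    exact h⟩

theorem H1.fn_mapL (L : ℂ →L[ℝ] ℝ) (u : H1 ℂ) : (u.mapL L).fn =ᵐ[volume] fun x => L (u.fn x) :=
  L.coeFn_compLp u.1.1

theorem H1.grad_mapL (L : ℂ →L[ℝ] ℝ) (u : H1 ℂ) (j : Fin 3) :
    (u.mapL L).grad j =ᵐ[volume] fun x => L (u.grad j x) :=
  L.coeFn_compLp (u.1.2 j)

set_option maxHeartbeats 1000000 in
/-- The real part of the equation `-i 𝓗 u = w` with real `w` is an equation for `Im u`. -/
theorem IsLinearizedImage.im_eq {g : ℝ → ℝ} (hg : IsNonlinearity g) {ω : ℝ} {φ : H1 ℝ} {u : H1 ℂ}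
    {w : H1 ℝ} {W : E3 → ℂ} (hW : W = fun x => (w.fn x : ℂ)) (h : IsLinearizedImage g ω φ u W)
    (η : H1 ℝ) :
    dirichletForm η (u.mapL Complex.imCLM) +
      potentialForm (hg.isWeight ω φ) η (u.mapL Complex.imCLM) = inner ℝ (fnL ℝ η) (fnL ℝ w) := by
  set v := u.mapL Complex.imCLM with hv
  set v' := u.mapL Complex.reCLM with hv'
  rw [← sub_eq_zero]
  refine eq_zero_of_test (f := fun η => dirichletForm η v + potentialForm (hg.isWeight ω φ) η v -
    inner ℝ (fnL ℝ η) (fnL ℝ w)) ?_ (fun ψ hψ => ?_) η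
  · refine ((continuous_dirichletForm.comp (continuous_id.prodMk continuous_const)).add
      ((potentialForm (hg.isWeight ω φ)).flip v).continuous).sub ?_
    exact (fnL ℝ).continuous.inner continuous_const
  · rw [sub_eq_zero, dirichletForm_test, potentialForm_test, inner_fnL]
    have hre := congrArg Complex.re (h ψ hψ)
    have hmul : ∀ Z : ℂ, (-Complex.I * Z).re = Z.im := fun Z => by simp
    rw [hmul, Complex.add_im, Complex.im_sum] at hre
    set D : E3 → ℝ := fun x => gDeriv g (φ.fn x ^ 2) * φ.fn x ^ 2 with hD
    have e1 : ∀ j, (∫ x, partialD j ψ x • u.grad j x).im = ∫ x, partialD j ψ x * v.grad j x := by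
      intro j
      have hi : Integrable fun x => partialD j ψ x • u.grad j x :=
        integrable_smul_Lp (hψ.memLp_partialD j) (u.1.2 j)
      rw [← Complex.imCLM_apply, ← Complex.imCLM.integral_comp_comm hi]
      refine integral_congr_ae ?_
      filter_upwards [u.grad_mapL Complex.imCLM j] with x hx
      rw [hx, map_smul]
      rfl
    set f : E3 → ℂ := fun x => ψ x • ((ω + g (φ.fn x ^ 2) + D x) • u.fn x
      + D x • (starRingEnd ℂ) (u.fn x)) with hf
    -- Conjugation flips the sign of the imaginary part, so the two `g'` terms cancel and only `-Δ +
    -- ω + g(φ²)` acts on `Im u`.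
    have him : ∀ x, (f x).im = ψ x * ((ω + g (φ.fn x ^ 2)) * (u.fn x).im) := by
      intro x
      simp only [hf, Complex.smul_im, Complex.add_im, Complex.conj_im, smul_eq_mul]
      ring
    have hrex : ∀ x, (f x).re = ψ x * ((ω + g (φ.fn x ^ 2)) * (u.fn x).re)
        + 2 * (ψ x * (D x * (u.fn x).re)) := by
      intro x
      simp only [hf, Complex.smul_re, Complex.add_re, Complex.conj_re, smul_eq_mul]
      ring
    have i1 : Integrable fun x => (f x).im := by
      refine ((hg.isWeight ω φ).integrable hψ.toH1 v).congr ?_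
      filter_upwards [hψ.fn_toH1, u.fn_mapL Complex.imCLM] with x h1 h2
      rw [h1, h2, him, Complex.imCLM_apply]
      ring
    -- The real part enters only through integrability, which is needed to take the imaginary part
    -- under the integral.
    have i2 : Integrable fun x => (f x).re := by
      refine (((hg.isWeight ω φ).integrable hψ.toH1 v').add
        (((hg.isWeight_gDeriv φ).integrable hψ.toH1 v').const_mul 2)).congr ?_
      filter_upwards [hψ.fn_toH1, u.fn_mapL Complex.reCLM] with x h1 h2
      simp only [Pi.add_apply]
      rw [h1, h2, hrex, Complex.reCLM_apply]
      ring
    have hfi : Integrable f := Integrable.re_im_iff.1 ⟨i2, i1⟩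
    have e2 : (∫ x, f x).im = ∫ x, (ω + g (φ.fn x ^ 2)) * (ψ x * v.fn x) := by
      rw [← Complex.imCLM_apply, ← Complex.imCLM.integral_comp_comm hfi]
      refine integral_congr_ae ?_
      filter_upwards [u.fn_mapL Complex.imCLM] with x hx
      rw [Complex.imCLM_apply, him, hx, Complex.imCLM_apply]
      ring
    have e3 : (∫ x, ψ x • W x).re = ∫ x, hψ.toH1.fn x * w.fn x := by
      have : (fun x => ψ x • W x) = fun x => ((ψ x * w.fn x : ℝ) : ℂ) := by
        ext x
        rw [hW]
        simp
      rw [this, integral_complex_ofReal, Complex.ofReal_re]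
      refine integral_congr_ae ?_
      filter_upwards [hψ.fn_toH1] with x hx
      rw [hx]
    rw [← e3, ← hre, e2]
    simp only [e1]

theorem H1.eq_zero_of_fnL_eq_zero {u : H1 ℝ} (h : fnL ℝ u = 0) : u = 0 := by
  have h0 : u.fn =ᵐ[volume] 0 := by
    have := Lp.coeFn_zero ℝ 2 (volume : Measure E3)
    rw [← h] at this
    exact this
  refine Subtype.ext (Prod.ext h (funext fun j => ?_))
  have hz : ∀ᵐ x, u.grad j x = 0 := by
    refine ae_eq_zero_of_integral_contDiff_smul_eq_zero
      ((u.memLp_grad j).locallyIntegrable one_le_two) fun ψ h1 h2 => ?_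
    have hw := u.weakPartial j ψ ⟨h1, h2⟩
    have : (fun x => partialD j ψ x • u.fn x) =ᵐ[volume] fun _ => (0 : ℝ) := by
      filter_upwards [h0] with x hx
      simp [hx]
    rw [integral_congr_ae this, integral_zero] at hw
    linarith
  have hz' : u.grad j =ᵐ[volume] 0 := hz
  exact Lp.ext (hz'.trans (Lp.coeFn_zero ℝ 2 (volume : Measure E3)).symm)

set_option maxHeartbeats 1000000 in
/-- The force term is locally Lipschitz on `H¹`, tested against `η`. -/
theorem IsNonlinearity.exists_force_bound {g : ℝ → ℝ} (hg : IsNonlinearity g) (η : H1 ℝ) :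
    ∃ C : ℝ, 0 ≤ C ∧ ∀ u v : H1 ℝ,
      |potentialForm (hg.isWeight 0 v) η v - potentialForm (hg.isWeight 0 u) η u| ≤
        C * (1 + ‖u‖ ^ 6 + (1 + ‖v‖ ^ 6)) * ‖v - u‖ := by
  obtain ⟨C, hC, h⟩ := hg.exists_force_lipschitz
  obtain ⟨K, hK, hw⟩ := exists_weight_bound
  refine ⟨C * K * ‖η‖, by positivity, fun u v => ?_⟩
  rw [potentialForm_apply, potentialForm_apply, ← integral_sub ((hg.isWeight 0 v).integrable η v)
    ((hg.isWeight 0 u).integrable η u), ← Real.norm_eq_abs]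
  refine (norm_integral_le_of_norm_le (((hw u (v - u) η).1.add (hw v (v - u) η).1).const_mul C)
    ?_).trans ?_
  · filter_upwards [H1.fn_sub v u] with x hx
    simp only [Pi.add_apply, zero_add]
    rw [hx, Real.norm_eq_abs]
    have e : g (v.fn x ^ 2) * (η.fn x * v.fn x) - g (u.fn x ^ 2) * (η.fn x * u.fn x) =
        (g (v.fn x ^ 2) * v.fn x - g (u.fn x ^ 2) * u.fn x) * η.fn x := by ring
    rw [e, abs_mul]
    have h1 := mul_le_mul_of_nonneg_right (h (u.fn x) (v.fn x)) (abs_nonneg (η.fn x))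
    refine h1.trans ?_
    have h2 : 0 ≤ C * (|v.fn x - u.fn x| * |η.fn x|) := by positivity
    nlinarith
  · rw [integral_const_mul]
    simp only [Pi.add_apply]
    rw [integral_add (hw u (v - u) η).1 (hw v (v - u) η).1]
    have h1 := (hw u (v - u) η).2
    have h2 := (hw v (v - u) η).2
    have := mul_le_mul_of_nonneg_left (add_le_add h1 h2) hC.le
    refine this.trans (le_of_eq ?_)
    ring

set_option maxHeartbeats 1000000 in
-- Test the equation for `φ_s` with the fixed function `η = φ_ω` and differentiate at `s = ω`. If
-- `∂_ω φ` vanished, only the explicit factor `s` would contribute, giving `‖φ_ω‖² = 0` in `L²` and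
-- contradicting positivity.
theorem IsGroundStateFamily.deriv_ne_zero {g : ℝ → ℝ} {O : Set ℝ} {φ : ℝ → H1 ℝ}
    (hφ : IsGroundStateFamily g O φ) (hg : IsNonlinearity g) {ω : ℝ} (hω : ω ∈ O) :
    deriv φ ω ≠ 0 := by
  intro hzero
  have hd := hφ.hasDerivAt hω
  rw [hzero] at hd
  set η := φ ω with hη
  have hD : HasDerivAt (fun s => dirichletForm η (φ s)) 0 ω := by
    have h1 : ∀ j, HasDerivAt (fun s => gradL j (φ s)) 0 ω := fun j =>
      ((gradL j).hasFDerivAt.comp_hasDerivAt ω hd).congr_deriv (map_zero _)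
    have h2 := HasDerivAt.fun_sum fun j (_ : j ∈ Finset.univ) =>
      (hasDerivAt_const ω (gradL j η)).inner ℝ (h1 j)
    exact h2.congr_deriv (by simp)
  have hI : HasDerivAt (fun s => s * inner ℝ (fnL ℝ η) (fnL ℝ (φ s)))
      (inner ℝ (fnL ℝ η) (fnL ℝ η)) ω := by
    have h1 : HasDerivAt (fun s => fnL ℝ (φ s)) 0 ω :=
      ((fnL ℝ).hasFDerivAt.comp_hasDerivAt ω hd).congr_deriv (map_zero _)
    have h2 := (hasDerivAt_id ω).mul ((hasDerivAt_const ω (fnL ℝ η)).inner ℝ h1)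
    exact h2.congr_deriv (by simp [hη])
  -- The derivative being zero, `φ s - φ ω` is `o(s - ω)`, so a local Lipschitz bound on the force
  -- replaces its differentiability on `H¹`.
  have hN : HasDerivAt (fun s => potentialForm (hg.isWeight 0 (φ s)) η (φ s)) 0 ω := by
    obtain ⟨C, hC, hb⟩ := hg.exists_force_bound η
    rw [hasDerivAt_iff_isLittleO]
    simp only [smul_zero, sub_zero]
    have hlo : (fun s => φ s - φ ω) =o[𝓝 ω] fun s => s - ω := by
      have := hasDerivAt_iff_isLittleO.1 hd
      simpa using this
    refine Asymptotics.IsBigO.trans_isLittleO ?_ hlo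
    refine Asymptotics.IsBigO.of_bound (C * (1 + ‖φ ω‖ ^ 6 + (1 + (‖φ ω‖ + 1) ^ 6))) ?_
    have hnear : ∀ᶠ s in 𝓝 ω, ‖φ s‖ < ‖φ ω‖ + 1 :=
      hd.continuousAt.norm.eventually_lt_const (by linarith)
    filter_upwards [hnear] with s hs
    rw [Real.norm_eq_abs]
    refine (hb (φ ω) (φ s)).trans ?_
    gcongr
  have hsum := (hD.add hN).add hI
  have hev : (fun s => dirichletForm η (φ s)) + (fun s => potentialForm (hg.isWeight 0 (φ s)) η (φ s))
      + (fun s => s * inner ℝ (fnL ℝ η) (fnL ℝ (φ s))) =ᶠ[𝓝 ω] fun _ => 0 := by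
    filter_upwards [hφ.isOpen.mem_nhds hω] with s hs
    have hs' := (hφ.solves s hs).extend hg η
    suffices he : potentialForm (hg.isWeight s (φ s)) η (φ s) =
        potentialForm (hg.isWeight 0 (φ s)) η (φ s) + s * inner ℝ (fnL ℝ η) (fnL ℝ (φ s)) by
      rw [he, ← add_assoc] at hs'
      exact hs'
    rw [potentialForm_apply, potentialForm_apply, inner_fnL, ← integral_const_mul,
      ← integral_add ((hg.isWeight 0 (φ s)).integrable _ _)
        ((integrable_mul_of_memLp η.memLp_fn (φ s).memLp_fn).const_mul s)]
    refine integral_congr_ae (Eventually.of_forall fun x => ?_)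
    simp only
    ring
  have h0 := hsum.unique ((hasDerivAt_const ω (0 : ℝ)).congr_of_eventuallyEq hev)
  simp only [zero_add] at h0
  have hz : fnL ℝ η = 0 := inner_self_eq_zero.1 h0
  have hz' : (φ ω).fn =ᵐ[volume] 0 := by
    have := Lp.coeFn_zero ℝ 2 (volume : Measure E3)
    rw [← hz] at this
    exact this
  have hfalse : ∀ᵐ _ : E3, False := by
    filter_upwards [hφ.pos ω hω, hz'] with x h1 h2
    rw [h2] at h1
    exact lt_irrefl _ h1
  obtain ⟨x, hx⟩ := hfalse.exists
  exact hx

set_option maxHeartbeats 1000000 in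
/-- `A` is positive at a critical point of `q`. -/
theorem AFun_pos {g : ℝ → ℝ} (hg : IsNonlinearity g) {O : Set ℝ} {φ : ℝ → H1 ℝ}
    (hφ : IsGroundStateFamily g O φ) {ωs : ℝ} (hωs : ωs ∈ O) (hq' : deriv (qFun φ) ωs = 0)
    {r : ℝ} (hr : 0 < r) {Ψ₃ Ψ₄ : ℝ → H1 ℂ} (hΨ : IsFrame g φ ωs r Ψ₃ Ψ₄) :
    0 < AFun φ Ψ₃ ωs := by
  set w := deriv φ ωs with hw
  set v := (Ψ₃ ωs).mapL Complex.imCLM with hv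
  set hV := hg.isWeight ωs (φ ωs)
  have himage : ∀ η : H1 ℝ, dirichletForm η v + potentialForm hV η v =
      inner ℝ (fnL ℝ η) (fnL ℝ w) := by
    -- At `ωs` the coefficient of `Ψ₄` vanishes, so the image of `Ψ₃` is the real function `∂_ω φ`.
    refine (hΨ.image₃ ωs (Metric.mem_ball_self hr)).im_eq hg (w := w) ?_
    ext x
    rw [hq', mul_zero, zero_smul, add_zero]
    rfl
  have hA : AFun φ Ψ₃ ωs = inner ℝ (fnL ℝ v) (fnL ℝ w) := by
    rw [AFun_eq, real_inner_comm]
    rfl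
  have hform := form_nonneg_of_pos_solution hg (hφ.solves ωs hωs) (hφ.pos ωs hωs)
  rw [hA, ← himage v]
  refine lt_of_le_of_ne (hform v) fun hzero => ?_
  have hsymm : ∀ a b : H1 ℝ, potentialForm hV a b = potentialForm hV b a := fun a b => by
    rw [potentialForm_apply, potentialForm_apply]
    refine integral_congr_ae (Eventually.of_forall fun x => ?_)
    simp only
    ring
  -- Expand the nonnegative form at `v + t η`: the constant term is zero by assumption, so the
  -- linear coefficient in `t` must vanish.
  have hexp : ∀ (η : H1 ℝ) (t : ℝ), 0 ≤ t ^ 2 * (dirichletForm η η + potentialForm hV η η) +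
      2 * t * (dirichletForm η v + potentialForm hV η v) := by
    intro η t
    have h1 := hform (v + t • η)
    have h2 : dirichletForm (v + t • η) (v + t • η) =
        dirichletForm v v + 2 * t * dirichletForm η v + t ^ 2 * dirichletForm η η := by
      rw [dirichletForm_add_left, dirichletForm_smul_left, dirichletForm_comm v,
        dirichletForm_comm η, dirichletForm_add_left, dirichletForm_add_left,
        dirichletForm_smul_left, dirichletForm_smul_left, dirichletForm_comm v η]
      ring
    have h3 : potentialForm hV (v + t • η) (v + t • η) =
        potentialForm hV v v + 2 * t * potentialForm hV η v + t ^ 2 * potentialForm hV η η := by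
      simp only [map_add, map_smul, add_apply, smul_apply, smul_eq_mul, hsymm v η]
      ring
    have h4 := h1.trans_eq (congrArg₂ (fun a b : ℝ => a + b) h2 h3)
    linarith
  have hw0 : inner ℝ (fnL ℝ w) (fnL ℝ w) = (0 : ℝ) := by
    rw [← himage w]
    set b := dirichletForm w v + potentialForm hV w v
    set a := dirichletForm w w + potentialForm hV w w
    have ha : 0 ≤ a := hform w
    -- The denominator `a + 1` avoids division by zero when `a = 0`; the resulting value is `-b² (a
    -- + 2)/(a + 1)²`.
    have h1 := hexp w (-b / (a + 1))
    have h2 : (-b / (a + 1)) ^ 2 * a + 2 * (-b / (a + 1)) * b = -(b ^ 2 * (a + 2)) / (a + 1) ^ 2 := by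
      field_simp
      ring
    change 0 ≤ (-b / (a + 1)) ^ 2 * a + 2 * (-b / (a + 1)) * b at h1
    rw [h2, div_nonneg_iff] at h1
    have h3 : 0 < (a + 1) ^ 2 := by positivity
    rcases h1 with ⟨h4, -⟩ | ⟨-, h4⟩
    · have : b ^ 2 ≤ 0 := by nlinarith [sq_nonneg b]
      exact pow_eq_zero_iff (two_ne_zero) |>.1 (le_antisymm this (sq_nonneg b))
    · linarith
  exact hφ.deriv_ne_zero hg hωs (H1.eq_zero_of_fnL_eq_zero (inner_self_eq_zero.1 hw0))

end NLSOscillation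

namespace NLSOscillation

open MeasureTheory Filter Topology Function

/-! ### Planar rotations with continuous speed -/

/-- Reparametrization of the line by a positive continuous periodic density. -/
theorem exists_clock {k : ℝ → ℝ} (hk : Continuous k) (hpos : ∀ θ, 0 < k θ) {c : ℝ} (hc : 0 < c)
    (hper : Periodic k c) (θ₀ : ℝ) :
    ∃ τ Θ : ℝ → ℝ, (∀ θ, HasDerivAt τ (k θ) θ) ∧ (∀ t, τ (Θ t) = t) ∧ (∀ θ, Θ (τ θ) = θ) ∧
      Θ 0 = θ₀ ∧ StrictMono Θ ∧ (∀ t, HasDerivAt Θ (k (Θ t))⁻¹ t) ∧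
      ∀ t, Θ (t + ∫ θ in (0 : ℝ)..c, k θ) = Θ t + c := by
  set τ : ℝ → ℝ := fun θ => (∫ x in (0 : ℝ)..θ, k x) - ∫ x in (0 : ℝ)..θ₀, k x with hτ
  have hd : ∀ θ, HasDerivAt τ (k θ) θ := fun θ =>
    ((hk.integral_hasStrictDerivAt 0 θ).hasDerivAt).sub_const _
  have hmono : StrictMono τ := strictMono_of_deriv_pos fun θ => by
    rw [(hd θ).deriv]; exact hpos θ
  have hcont : Continuous τ := continuous_iff_continuousAt.2 fun θ => (hd θ).continuousAt
  have hsurj : Surjective τ := by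
    refine hcont.surjective ?_ ?_
    · exact tendsto_atTop_add_const_right _ _
        (hper.tendsto_atTop_intervalIntegral_of_pos' (hk.intervalIntegrable _ _) hpos hc)
    · exact tendsto_atBot_add_const_right _ _
        (hper.tendsto_atBot_intervalIntegral_of_pos' (hk.intervalIntegrable _ _) hpos hc)
  set e := hmono.orderIsoOfSurjective τ hsurj
  have h1 : ∀ t, τ (e.symm t) = t := fun t => e.apply_symm_apply t
  have h2 : ∀ θ, e.symm (τ θ) = θ := fun θ => e.symm_apply_apply θ
  have hshift : ∀ θ, τ (θ + c) = τ θ + ∫ x in (0 : ℝ)..c, k x := fun θ => by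
    have := hper.intervalIntegral_add_eq θ 0
    rw [zero_add] at this
    simp only [hτ]
    rw [← this, ← intervalIntegral.integral_add_adjacent_intervals
      (hk.intervalIntegrable 0 θ) (hk.intervalIntegrable θ (θ + c))]
    ring
  refine ⟨τ, e.symm, hd, h1, h2, ?_, e.symm.strictMono, fun t => ?_, fun t => ?_⟩
  · have : τ θ₀ = 0 := by simp [hτ]
    rw [← this, h2]
  · exact HasDerivAt.of_local_left_inverse e.symm.continuous.continuousAt (hd _) (hpos _).ne'
      (Eventually.of_forall h1)
  · apply hmono.injective
    rw [h1, hshift, h1]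

/-- A chart `Φ` on an open set of the plane in which the vector field `X` is a rotation about the
origin with positive continuous angular speed `F`, together with a parametrization `P` of the
preimage of the circle of radius `R`. -/
structure IsRotationChart (U : Set (ℝ × ℝ)) (Φ : ℝ × ℝ → ℝ × ℝ)
    (Φ' : ℝ × ℝ → (ℝ × ℝ) ≃L[ℝ] (ℝ × ℝ)) (X : ℝ × ℝ → ℝ × ℝ) (F : ℝ × ℝ → ℝ) (R : ℝ)
    (P : ℝ → ℝ × ℝ) : Prop where
  isOpen : IsOpen U
  hasStrictFDerivAt : ∀ p ∈ U, HasStrictFDerivAt Φ (Φ' p : (ℝ × ℝ) →L[ℝ] (ℝ × ℝ)) p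
  injOn : Set.InjOn Φ U
  cont : ContinuousOn F U
  pos : ∀ p ∈ U, 0 < F p
  field : ∀ p ∈ U, Φ' p (X p) = F p • ((Φ p).2, -(Φ p).1)
  radius_pos : 0 < R
  mem : ∀ θ, P θ ∈ U
  circle : ∀ θ, Φ (P θ) = (R * Real.sin θ, R * Real.cos θ)

namespace IsRotationChart

variable {U : Set (ℝ × ℝ)} {Φ : ℝ × ℝ → ℝ × ℝ} {Φ' : ℝ × ℝ → (ℝ × ℝ) ≃L[ℝ] (ℝ × ℝ)}
  {X : ℝ × ℝ → ℝ × ℝ} {F : ℝ × ℝ → ℝ} {R : ℝ} {P : ℝ → ℝ × ℝ}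

theorem periodic (h : IsRotationChart U Φ Φ' X F R P) : Periodic P (2 * Real.pi) := fun θ =>
  h.injOn (h.mem _) (h.mem _) (by rw [h.circle, h.circle, Real.sin_add_two_pi, Real.cos_add_two_pi])

/-- No regularity of `P` is assumed. Injectivity of the chart forces `P` to agree near `θ` with the
local inverse of `Φ` along the circle, and the velocity of the circle is the image of `F⁻¹ X`. -/
theorem hasDerivAt (h : IsRotationChart U Φ Φ' X F R P) (θ : ℝ) :
    HasDerivAt P ((F (P θ))⁻¹ • X (P θ)) θ := by
  have hs := h.hasStrictFDerivAt _ (h.mem θ)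
  set f := hs.localInverse with hf
  have hcirc : HasDerivAt (fun s => (R * Real.sin s, R * Real.cos s))
      (R * Real.cos θ, R * -Real.sin θ) θ :=
    ((Real.hasDerivAt_sin θ).const_mul R).prodMk ((Real.hasDerivAt_cos θ).const_mul R)
  have hfd : HasFDerivAt f ((Φ' (P θ)).symm : (ℝ × ℝ) →L[ℝ] (ℝ × ℝ))
      (R * Real.sin θ, R * Real.cos θ) := by
    rw [← h.circle θ]
    exact hs.to_localInverse.hasFDerivAt
  have hcomp := hfd.comp_hasDerivAt θ hcirc
  have hev : P =ᶠ[𝓝 θ] f ∘ fun s => (R * Real.sin s, R * Real.cos s) := by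
    have hct : Tendsto (fun s => (R * Real.sin s, R * Real.cos s)) (𝓝 θ) (𝓝 (Φ (P θ))) := by
      rw [h.circle θ]
      exact hcirc.continuousAt
    have h1 := hct.eventually hs.eventually_right_inverse
    have h2 : ∀ᶠ s in 𝓝 θ, f (R * Real.sin s, R * Real.cos s) ∈ U := by
      refine (hs.localInverse_continuousAt.tendsto.comp hct).eventually (h.isOpen.mem_nhds ?_)
      rw [hs.localInverse_apply_image]
      exact h.mem θ
    filter_upwards [h1, h2] with s h3 h4
    exact h.injOn (h.mem s) h4 (by rw [h.circle]; exact h3.symm)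
  refine (hcomp.congr_of_eventuallyEq hev).congr_deriv ?_
  have hX := h.field _ (h.mem θ)
  rw [h.circle] at hX
  have hF := (h.pos _ (h.mem θ)).ne'
  have e : ((R * Real.cos θ, R * -Real.sin θ) : ℝ × ℝ) =
      Φ' (P θ) ((F (P θ))⁻¹ • X (P θ)) := by
    rw [map_smul, hX, smul_smul, inv_mul_cancel₀ hF, one_smul, mul_neg]
  rw [e]
  exact (Φ' (P θ)).symm_apply_apply _

theorem continuous_speed (h : IsRotationChart U Φ Φ' X F R P) : Continuous fun θ => F (P θ) := by
  have hP : Continuous P := continuous_iff_continuousAt.2 fun θ => (h.hasDerivAt θ).continuousAt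
  exact h.cont.comp_continuous hP h.mem

theorem angle_eq (h : IsRotationChart U Φ Φ' X F R P) {θ θ' : ℝ} (hθ : P θ = P θ') :
    ∃ n : ℤ, n * (2 * Real.pi) = θ - θ' := by
  have h1 := h.circle θ
  rw [hθ, h.circle, Prod.mk.injEq] at h1
  have hs : Real.sin θ' = Real.sin θ := mul_left_cancel₀ h.radius_pos.ne' h1.1
  have hc : Real.cos θ' = Real.cos θ := mul_left_cancel₀ h.radius_pos.ne' h1.2
  rw [← Real.cos_eq_one_iff, Real.cos_sub, hs, hc]
  nlinarith [Real.sin_sq_add_cos_sq θ]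

/-- Along a solution inside the chart the chart rotates by the integral of the speed. -/
theorem eq_of_angle (h : IsRotationChart U Φ Φ' X F R P) {γ : ℝ → ℝ × ℝ} {α : ℝ → ℝ} {a b t₁ : ℝ}
    (hγ : ∀ t ∈ Set.Ioo a b, HasDerivAt γ (X (γ t)) t) (hU : ∀ t ∈ Set.Ioo a b, γ t ∈ U)
    (hα : ∀ t ∈ Set.Ioo a b, HasDerivAt α (F (γ t)) t) (ht₁ : t₁ ∈ Set.Ioo a b)
    (h₁ : γ t₁ = P (α t₁)) {t : ℝ} (ht : t ∈ Set.Ioo a b) : γ t = P (α t) := by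
  -- `f` and `k` are the coordinates of `Φ (γ s)` in the frame turned by `α s`. Both are conserved,
  -- and initially they equal `0` and `R`.
  set f : ℝ → ℝ := fun s => (Φ (γ s)).1 * Real.cos (α s) - (Φ (γ s)).2 * Real.sin (α s) with hf
  set k : ℝ → ℝ := fun s => (Φ (γ s)).1 * Real.sin (α s) + (Φ (γ s)).2 * Real.cos (α s) with hk
  have hΦ : ∀ s ∈ Set.Ioo a b, HasDerivAt (fun s => Φ (γ s))
      (F (γ s) • ((Φ (γ s)).2, -(Φ (γ s)).1)) s := fun s hs => by
    rw [← h.field _ (hU s hs)]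
    exact (h.hasStrictFDerivAt _ (hU s hs)).hasFDerivAt.comp_hasDerivAt s (hγ s hs)
  have h1 : ∀ s ∈ Set.Ioo a b, HasDerivAt (fun s => (Φ (γ s)).1) (F (γ s) * (Φ (γ s)).2) s :=
    fun s hs => (hΦ s hs).fst
  have h2 : ∀ s ∈ Set.Ioo a b, HasDerivAt (fun s => (Φ (γ s)).2) (F (γ s) * -(Φ (γ s)).1) s :=
    fun s hs => (hΦ s hs).snd
  have hfd : ∀ s ∈ Set.Ioo a b, HasDerivAt f 0 s := fun s hs =>
    (((h1 s hs).mul (hα s hs).cos).sub ((h2 s hs).mul (hα s hs).sin)).congr_deriv (by ring)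
  have hkd : ∀ s ∈ Set.Ioo a b, HasDerivAt k 0 s := fun s hs =>
    (((h1 s hs).mul (hα s hs).sin).add ((h2 s hs).mul (hα s hs).cos)).congr_deriv (by ring)
  have hfc : f t = f t₁ := isOpen_Ioo.is_const_of_deriv_eq_zero isPreconnected_Ioo
    (fun s hs => (hfd s hs).differentiableAt.differentiableWithinAt)
    (fun s hs => (hfd s hs).deriv) ht ht₁
  have hkc : k t = k t₁ := isOpen_Ioo.is_const_of_deriv_eq_zero isPreconnected_Ioo
    (fun s hs => (hkd s hs).differentiableAt.differentiableWithinAt)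
    (fun s hs => (hkd s hs).deriv) ht ht₁
  have hf1 : f t₁ = 0 := by
    simp only [hf, h₁, h.circle]; ring
  have hk1 : k t₁ = R := by
    simp only [hk, h₁, h.circle]
    linear_combination R * Real.sin_sq_add_cos_sq (α t₁)
  rw [hf1] at hfc
  rw [hk1] at hkc
  simp only [hf] at hfc
  simp only [hk] at hkc
  refine h.injOn (hU t ht) (h.mem _) ?_
  rw [h.circle]
  have hsc := Real.sin_sq_add_cos_sq (α t)
  refine Prod.ext ?_ ?_
  · linear_combination Real.cos (α t) * hfc + Real.sin (α t) * hkc - (Φ (γ t)).1 * hsc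
  · linear_combination -Real.sin (α t) * hfc + Real.cos (α t) * hkc - (Φ (γ t)).2 * hsc

/-- The solution is `P ∘ Θ`, where `Θ` inverts the clock `τ` with density `1/F` on the circle. The
least period is the time of one turn, `∫ 1/F` over `[0, 2π]`, bounded through the bounds on `F`. -/
theorem exists_unique_periodic (h : IsRotationChart U Φ Φ' X F R P) {θ₀ f₁ f₂ : ℝ} (hf₁ : 0 < f₁)
    (hlow : ∀ θ, f₁ ≤ F (P θ)) (hup : ∀ θ, F (P θ) ≤ f₂) :
    ∃ γ : ℝ → ℝ × ℝ, γ 0 = P θ₀ ∧ (∀ t, HasDerivAt γ (X (γ t)) t) ∧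
      (∀ γ' : ℝ → ℝ × ℝ, γ' 0 = P θ₀ → (∀ t, HasDerivAt γ' (X (γ' t)) t) → γ' = γ) ∧
      ∃ T : ℝ, IsLeast {T : ℝ | 0 < T ∧ Periodic γ T} T ∧
        2 * Real.pi / f₂ ≤ T ∧ T ≤ 2 * Real.pi / f₁ := by
  have hFpos : ∀ θ, 0 < F (P θ) := fun θ => h.pos _ (h.mem θ)
  have hkc : Continuous fun θ => (F (P θ))⁻¹ := h.continuous_speed.inv₀ fun θ => (hFpos θ).ne'
  have hπ := Real.two_pi_pos
  obtain ⟨τ, Θ, hτ, hτΘ, hΘτ, hΘ0, hmono, hΘ, hshift⟩ := exists_clock hkc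
    (fun θ => inv_pos.2 (hFpos θ)) hπ (fun θ => by rw [h.periodic θ]) θ₀
  simp only [inv_inv] at hΘ
  set T := ∫ θ in (0 : ℝ)..(2 * Real.pi), (F (P θ))⁻¹ with hT
  have hγ : ∀ t, HasDerivAt (fun t => P (Θ t)) (X (P (Θ t))) t := fun t => by
    refine ((h.hasDerivAt (Θ t)).scomp t (hΘ t)).congr_deriv ?_
    rw [smul_smul, mul_inv_cancel₀ (hFpos _).ne', one_smul]
  have hTlow : 2 * Real.pi / f₂ ≤ T := by
    have : ∫ _ in (0 : ℝ)..(2 * Real.pi), f₂⁻¹ ≤ T :=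
      intervalIntegral.integral_mono_on hπ.le (by simp) (hkc.intervalIntegrable _ _)
        fun θ _ => inv_anti₀ (hFpos θ) (hup θ)
    rw [intervalIntegral.integral_const, sub_zero, smul_eq_mul] at this
    exact this
  have hTup : T ≤ 2 * Real.pi / f₁ := by
    have : T ≤ ∫ _ in (0 : ℝ)..(2 * Real.pi), f₁⁻¹ :=
      intervalIntegral.integral_mono_on hπ.le (hkc.intervalIntegrable _ _) (by simp)
        fun θ _ => inv_anti₀ hf₁ (hlow θ)
    rw [intervalIntegral.integral_const, sub_zero, smul_eq_mul] at this
    exact this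
  have hTpos : 0 < T := lt_of_lt_of_le (div_pos hπ ((hFpos 0).trans_le (hup 0))) hTlow
  refine ⟨fun t => P (Θ t), by simp only [hΘ0], hγ, fun γ' h0 hγ' => ?_, T, ⟨⟨hTpos, ?_⟩, ?_⟩,
    hTlow, hTup⟩
  · have hc' : Continuous γ' := continuous_iff_continuousAt.2 fun t => (hγ' t).continuousAt
    have hc : Continuous fun t => P (Θ t) :=
      continuous_iff_continuousAt.2 fun t => (hγ t).continuousAt
    -- With a merely continuous field, uniqueness comes from the clock: near a time of agreement
    -- `γ'` stays on the circle at some angle `α`, and `τ (α t) - t` has zero derivative, so `α`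
    -- coincides with `Θ`.
    have hclopen : IsClopen {t | γ' t = P (Θ t)} := by
      refine ⟨isClosed_eq hc' hc, isOpen_iff_mem_nhds.2 fun t₁ ht₁ => ?_⟩
      have hnear : ∀ᶠ t in 𝓝 t₁, γ' t ∈ U := hc'.continuousAt.eventually (h.isOpen.mem_nhds (by
        rw [show γ' t₁ = P (Θ t₁) from ht₁]; exact h.mem _))
      obtain ⟨ε, hε, hball⟩ := Metric.eventually_nhds_iff_ball.1 hnear
      have hU : ∀ t ∈ Set.Ioo (t₁ - ε) (t₁ + ε), γ' t ∈ U := fun t ht =>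
        hball t (by rw [Real.ball_eq_Ioo]; exact ht)
      have hmem : t₁ ∈ Set.Ioo (t₁ - ε) (t₁ + ε) := ⟨by linarith, by linarith⟩
      have hFc : ContinuousOn (fun t => F (γ' t)) (Set.Ioo (t₁ - ε) (t₁ + ε)) :=
        h.cont.comp hc'.continuousOn hU
      set α : ℝ → ℝ := fun t => Θ t₁ + ∫ s in t₁..t, F (γ' s) with hα
      have hαd : ∀ t ∈ Set.Ioo (t₁ - ε) (t₁ + ε), HasDerivAt α (F (γ' t)) t := by
        intro t ht
        refine HasDerivAt.const_add _ (intervalIntegral.integral_hasDerivAt_right ?_ ?_ ?_)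
        · refine (hFc.mono ?_).intervalIntegrable
          exact Set.ordConnected_Ioo.uIcc_subset hmem ht
        · exact hFc.stronglyMeasurableAtFilter isOpen_Ioo t ht
        · exact hFc.continuousAt (isOpen_Ioo.mem_nhds ht)
      have hαt₁ : α t₁ = Θ t₁ := by simp [hα]
      have hPα : ∀ t ∈ Set.Ioo (t₁ - ε) (t₁ + ε), γ' t = P (α t) := fun t ht =>
        h.eq_of_angle (fun s _ => hγ' s) hU hαd hmem (by rw [hαt₁]; exact ht₁) ht
      have hd : ∀ t ∈ Set.Ioo (t₁ - ε) (t₁ + ε), HasDerivAt (fun t => τ (α t) - t) 0 t :=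
        fun t ht => by
          refine (((hτ (α t)).comp t (hαd t ht)).sub (hasDerivAt_id t)).congr_deriv ?_
          rw [hPα t ht, inv_mul_cancel₀ (hFpos _).ne', sub_self]
      filter_upwards [Ioo_mem_nhds hmem.1 hmem.2] with t ht
      have hconst : τ (α t) - t = τ (α t₁) - t₁ := isOpen_Ioo.is_const_of_deriv_eq_zero
        isPreconnected_Ioo (fun s hs => (hd s hs).differentiableAt.differentiableWithinAt)
        (fun s hs => (hd s hs).deriv) ht hmem
      rw [hαt₁, hτΘ, sub_self, sub_eq_zero] at hconst
      change γ' t = P (Θ t)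
      rw [hPα t ht, ← hconst, hΘτ, hconst]
    have huniv := hclopen.eq_univ ⟨0, by change γ' 0 = P (Θ 0); rw [h0, hΘ0]⟩
    ext1 t
    exact huniv.ge (Set.mem_univ t)
  · intro t
    change P (Θ (t + T)) = P (Θ t)
    rw [hshift, h.periodic]
  -- A positive period advances the angle by a positive multiple of `2π`, hence by at least one full
  -- turn, which takes time `T`.
  · rintro S ⟨hS, hper⟩
    have h1 := hper 0
    rw [zero_add] at h1
    obtain ⟨n, hn⟩ := h.angle_eq (h1 : P (Θ S) = P (Θ 0))
    have hpos : 0 < Θ S - Θ 0 := sub_pos.2 (hmono hS)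
    rw [← hn] at hpos
    have hn0 : (0 : ℝ) < n := pos_of_mul_pos_left hpos hπ.le
    have hn0' : 0 < n := by exact_mod_cast hn0
    have hn1 : (1 : ℝ) ≤ n := by exact_mod_cast (show (1 : ℤ) ≤ n by omega)
    have h2 := hshift 0
    rw [zero_add] at h2
    by_contra hlt
    have := hmono (not_le.1 hlt)
    rw [h2] at this
    nlinarith

end IsRotationChart

end NLSOscillation

namespace NLSOscillation

open Filter Topology Function

/-! ### The potential well -/

theorem le_of_hasDerivAt_nonneg {f f' : ℝ → ℝ} {a b : ℝ} (hab : a ≤ b)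
    (hf : ∀ x ∈ Set.Icc a b, HasDerivAt f (f' x) x) (h0 : ∀ x ∈ Set.Icc a b, 0 ≤ f' x) :
    f a ≤ f b := by
  refine monotoneOn_of_deriv_nonneg (convex_Icc a b)
    (fun x hx => (hf x hx).continuousAt.continuousWithinAt)
    (fun x hx => (hf x (interior_subset hx)).differentiableAt.differentiableWithinAt)
    (fun x hx => ?_) (Set.left_mem_Icc.2 hab) (Set.right_mem_Icc.2 hab) hab
  rw [(hf x (interior_subset hx)).deriv]
  exact h0 x (interior_subset hx)

/-- Quantitative convexity of `q` near a minimum, and `d' = q`. -/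
structure IsWell (q q₁ q₂ d : ℝ → ℝ) (ωs δ m M : ℝ) : Prop where
  m_pos : 0 < m
  hasDeriv_q : ∀ ω ∈ Set.Ioo (ωs - δ) (ωs + δ), HasDerivAt q (q₁ ω) ω
  hasDeriv_q₁ : ∀ ω ∈ Set.Ioo (ωs - δ) (ωs + δ), HasDerivAt q₁ (q₂ ω) ω
  lower : ∀ ω ∈ Set.Ioo (ωs - δ) (ωs + δ), m ≤ q₂ ω
  upper : ∀ ω ∈ Set.Ioo (ωs - δ) (ωs + δ), q₂ ω ≤ M
  crit : q₁ ωs = 0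
  hasDeriv_d : ∀ ω ∈ Set.Ioo (ωs - δ) (ωs + δ), HasDerivAt d (q ω) ω

namespace IsWell

variable {q q₁ q₂ d : ℝ → ℝ} {ωs δ m M : ℝ}

theorem q₁_sub_bounds (h : IsWell q q₁ q₂ d ωs δ m M) {a b : ℝ}
    (ha : a ∈ Set.Ioo (ωs - δ) (ωs + δ)) (hb : b ∈ Set.Ioo (ωs - δ) (ωs + δ)) (hab : a ≤ b) :
    m * (b - a) ≤ q₁ b - q₁ a ∧ q₁ b - q₁ a ≤ M * (b - a) := by
  have hsub : Set.Icc a b ⊆ Set.Ioo (ωs - δ) (ωs + δ) := fun x hx =>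
    ⟨ha.1.trans_le hx.1, hx.2.trans_lt hb.2⟩
  constructor
  · have := le_of_hasDerivAt_nonneg (f := fun x => q₁ x - m * x) (f' := fun x => q₂ x - m * 1) hab
      (fun x hx => (h.hasDeriv_q₁ x (hsub hx)).sub ((hasDerivAt_id x).const_mul m))
      (fun x hx => by linarith [h.lower x (hsub hx)])
    linarith
  · have := le_of_hasDerivAt_nonneg (f := fun x => M * x - q₁ x) (f' := fun x => M * 1 - q₂ x) hab
      (fun x hx => ((hasDerivAt_id x).const_mul M).sub (h.hasDeriv_q₁ x (hsub hx)))
      (fun x hx => by linarith [h.upper x (hsub hx)])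
    linarith

theorem center_mem (_h : IsWell q q₁ q₂ d ωs δ m M) {a : ℝ}
    (ha : a ∈ Set.Ioo (ωs - δ) (ωs + δ)) : ωs ∈ Set.Ioo (ωs - δ) (ωs + δ) := by
  obtain ⟨h1, h2⟩ := ha
  constructor <;> linarith

theorem m_le_M (h : IsWell q q₁ q₂ d ωs δ m M) (hδ : 0 < δ) : m ≤ M := by
  have h0 : ωs ∈ Set.Ioo (ωs - δ) (ωs + δ) := ⟨by linarith, by linarith⟩
  exact (h.lower _ h0).trans (h.upper _ h0)

theorem hasDerivAt_sq (c ωs x : ℝ) :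
    HasDerivAt (fun x => c / 2 * (x - ωs) ^ 2) (c * (x - ωs)) x := by
  have := (((hasDerivAt_id x).sub_const ωs).pow 2).const_mul (c / 2)
  exact this.congr_deriv (by simp; ring)

theorem q_bounds (h : IsWell q q₁ q₂ d ωs δ m M) {ω : ℝ} (hω : ω ∈ Set.Ioo (ωs - δ) (ωs + δ)) :
    m / 2 * (ω - ωs) ^ 2 ≤ q ω - q ωs ∧ q ω - q ωs ≤ M / 2 * (ω - ωs) ^ 2 := by
  have hs := h.center_mem hω
  rcases le_total ωs ω with hle | hle
  · have hsub : ∀ x ∈ Set.Icc ωs ω, x ∈ Set.Ioo (ωs - δ) (ωs + δ) := fun x hx =>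
      ⟨hs.1.trans_le hx.1, hx.2.trans_lt hω.2⟩
    have hb : ∀ x ∈ Set.Icc ωs ω, m * (x - ωs) ≤ q₁ x ∧ q₁ x ≤ M * (x - ωs) := fun x hx => by
      simpa [h.crit] using h.q₁_sub_bounds hs (hsub x hx) hx.1
    constructor
    · have := le_of_hasDerivAt_nonneg (f := fun x => q x - m / 2 * (x - ωs) ^ 2)
        (f' := fun x => q₁ x - m * (x - ωs)) hle
        (fun x hx => (h.hasDeriv_q x (hsub x hx)).sub (hasDerivAt_sq m ωs x))
        (fun x hx => by linarith [(hb x hx).1])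
      simp only [sub_self] at this
      nlinarith
    · have := le_of_hasDerivAt_nonneg (f := fun x => M / 2 * (x - ωs) ^ 2 - q x)
        (f' := fun x => M * (x - ωs) - q₁ x) hle
        (fun x hx => (hasDerivAt_sq M ωs x).sub (h.hasDeriv_q x (hsub x hx)))
        (fun x hx => by linarith [(hb x hx).2])
      simp only [sub_self] at this
      nlinarith
  · have hsub : ∀ x ∈ Set.Icc ω ωs, x ∈ Set.Ioo (ωs - δ) (ωs + δ) := fun x hx =>
      ⟨hω.1.trans_le hx.1, hx.2.trans_lt hs.2⟩
    have hb : ∀ x ∈ Set.Icc ω ωs, M * (x - ωs) ≤ q₁ x ∧ q₁ x ≤ m * (x - ωs) := fun x hx => by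
      have := h.q₁_sub_bounds (hsub x hx) hs hx.2
      rw [h.crit] at this
      constructor <;> linarith [this.1, this.2]
    constructor
    · have := le_of_hasDerivAt_nonneg (f := fun x => m / 2 * (x - ωs) ^ 2 - q x)
        (f' := fun x => m * (x - ωs) - q₁ x) hle
        (fun x hx => (hasDerivAt_sq m ωs x).sub (h.hasDeriv_q x (hsub x hx)))
        (fun x hx => by linarith [(hb x hx).2])
      simp only [sub_self] at this
      nlinarith
    · have := le_of_hasDerivAt_nonneg (f := fun x => q x - M / 2 * (x - ωs) ^ 2)
        (f' := fun x => q₁ x - M * (x - ωs)) hle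
        (fun x hx => (h.hasDeriv_q x (hsub x hx)).sub (hasDerivAt_sq M ωs x))
        (fun x hx => by linarith [(hb x hx).1])
      simp only [sub_self] at this
      nlinarith

/-- The two roots of `q = Q`. -/
theorem exists_roots (h : IsWell q q₁ q₂ d ωs δ m M) (hδ : 0 < δ) {Q : ℝ} (hQ : 0 < Q - q ωs)
    (hQ' : Q - q ωs < m / 8 * δ ^ 2) :
    ∃ a b : ℝ, a < ωs ∧ ωs < b ∧ {ω : ℝ | |ω - ωs| < δ ∧ q ω = Q} = {a, b} := by
  have hmem : ∀ ω, |ω - ωs| < δ ↔ ω ∈ Set.Ioo (ωs - δ) (ωs + δ) := fun ω => by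
    rw [abs_lt, Set.mem_Ioo]
    constructor <;> rintro ⟨h1, h2⟩ <;> constructor <;> linarith
  have hs : ωs ∈ Set.Ioo (ωs - δ) (ωs + δ) := ⟨by linarith, by linarith⟩
  have hm := h.m_pos
  have hc : ContinuousOn q (Set.Ioo (ωs - δ) (ωs + δ)) := fun x hx =>
    (h.hasDeriv_q x hx).continuousAt.continuousWithinAt
  have hmono : StrictMonoOn q (Set.Ico ωs (ωs + δ)) := by
    refine strictMonoOn_of_deriv_pos (convex_Ico _ _)
      (hc.mono fun x hx => ⟨by linarith [hx.1], hx.2⟩) fun x hx => ?_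
    rw [interior_Ico] at hx
    have hxm : x ∈ Set.Ioo (ωs - δ) (ωs + δ) := ⟨by linarith [hx.1], hx.2⟩
    rw [(h.hasDeriv_q x hxm).deriv]
    have := (h.q₁_sub_bounds hs hxm hx.1.le).1
    rw [h.crit] at this
    nlinarith [mul_pos hm (sub_pos.2 hx.1)]
  have hanti : StrictAntiOn q (Set.Ioc (ωs - δ) ωs) := by
    refine strictAntiOn_of_deriv_neg (convex_Ioc _ _)
      (hc.mono fun x hx => ⟨hx.1, by linarith [hx.2]⟩) fun x hx => ?_
    rw [interior_Ioc] at hx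
    have hxm : x ∈ Set.Ioo (ωs - δ) (ωs + δ) := ⟨hx.1, by linarith [hx.2]⟩
    rw [(h.hasDeriv_q x hxm).deriv]
    have := (h.q₁_sub_bounds hxm hs hx.2.le).1
    rw [h.crit] at this
    nlinarith [mul_pos hm (sub_pos.2 hx.2)]
  -- The hypothesis on `Q` uses the value `m δ²/8` of the quadratic lower bound at distance `δ/2`,
  -- so `q` exceeds `Q` there.
  obtain ⟨b, hb, hqb⟩ : ∃ b ∈ Set.Ioo ωs (ωs + δ / 2), q b = Q := by
    refine intermediate_value_Ioo (by linarith) (hc.mono fun x hx =>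
      ⟨by linarith [hx.1], by linarith [hx.2]⟩) ⟨by linarith, ?_⟩
    have := (h.q_bounds (ω := ωs + δ / 2) ⟨by linarith, by linarith⟩).1
    nlinarith
  obtain ⟨a, ha, hqa⟩ : ∃ a ∈ Set.Ioo (ωs - δ / 2) ωs, q a = Q := by
    refine intermediate_value_Ioo' (by linarith) (hc.mono fun x hx =>
      ⟨by linarith [hx.1], by linarith [hx.2]⟩) ⟨by linarith, ?_⟩
    have := (h.q_bounds (ω := ωs - δ / 2) ⟨by linarith, by linarith⟩).1
    nlinarith
  refine ⟨a, b, ha.2, hb.1, Set.ext fun ω => ?_⟩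
  simp only [Set.mem_ofPred_eq, Set.mem_insert_iff, Set.mem_singleton_iff, hmem]
  constructor
  · rintro ⟨hω, hqω⟩
    rcases le_total ωs ω with hle | hle
    · right
      exact hmono.injOn ⟨hle, hω.2⟩ ⟨hb.1.le, by linarith [hb.2]⟩ (by rw [hqω, hqb])
    · left
      exact hanti.injOn ⟨hω.1, hle⟩ ⟨by linarith [ha.1], ha.2.le⟩ (by rw [hqω, hqa])
  · rintro (rfl | rfl)
    · exact ⟨⟨by linarith [ha.1], by linarith [ha.2]⟩, hqa⟩
    · exact ⟨⟨by linarith [hb.1], by linarith [hb.2]⟩, hqb⟩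

theorem hasDerivAt_quadratic (c a b x : ℝ) :
    HasDerivAt (fun x => c * ((x - a) * (x - b))) (c * ((x - b) + (x - a))) x := by
  have := ((((hasDerivAt_id x).sub_const a).mul ((hasDerivAt_id x).sub_const b))).const_mul c
  exact this.congr_deriv (by simp)

theorem hasDerivAt_quadratic_deriv (c a b x : ℝ) :
    HasDerivAt (fun x => c * ((x - b) + (x - a))) (2 * c) x := by
  have := ((((hasDerivAt_id x).sub_const b).add ((hasDerivAt_id x).sub_const a))).const_mul c
  exact this.congr_deriv (by ring)

/-- A convex function lies below its chords between their endpoints and above the extended chord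
outside. It is meant for the difference between `q - Q` and a quadratic with the same two roots. -/
theorem convexOn_zeros {f : ℝ → ℝ} {s : Set ℝ} (hf : ConvexOn ℝ s f) {a b : ℝ} (ha : a ∈ s)
    (hb : b ∈ s) (hab : a < b) (hfa : f a = 0) (hfb : f b = 0) :
    (∀ x ∈ Set.Icc a b, f x ≤ 0) ∧ ∀ x ∈ s, b ≤ x → 0 ≤ f x := by
  constructor
  · intro x hx
    have := hf.le_max_of_mem_Icc ha hb hx
    simpa [hfa, hfb] using this
  · intro x hx hbx
    rcases hbx.eq_or_lt with rfl | hlt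
    · exact hfb.ge
    · have := hf.slope_mono_adjacent ha hx hab hlt
      rw [hfa, hfb, sub_zero, zero_div, sub_zero, le_div_iff₀ (by linarith)] at this
      linarith

/-- Two-sided comparison of `q - Q` with quadratics. -/
theorem quadratic_bounds (h : IsWell q q₁ q₂ d ωs δ m M) {Q a b : ℝ}
    (ha : a ∈ Set.Ioo (ωs - δ) (ωs + δ)) (hb : b ∈ Set.Ioo (ωs - δ) (ωs + δ)) (hab : a < b)
    (hqa : q a = Q) (hqb : q b = Q) :
    (∀ x ∈ Set.Icc a b, M / 2 * ((x - a) * (x - b)) ≤ q x - Q ∧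
      q x - Q ≤ m / 2 * ((x - a) * (x - b))) ∧
    ∀ x ∈ Set.Ioo (ωs - δ) (ωs + δ), b ≤ x → m / 2 * ((x - a) * (x - b)) ≤ q x - Q ∧
      q x - Q ≤ M / 2 * ((x - a) * (x - b)) := by
  have hq : ∀ x ∈ Set.Ioo (ωs - δ) (ωs + δ), HasDerivAt (fun x => q x - Q) (q₁ x) x :=
    fun x hx => (h.hasDeriv_q x hx).sub_const Q
  -- The second derivative is `q₂ - m ≥ 0`. Since `(x - a)(x - b)` is negative between the roots,
  -- `M` gives the lower bound there and `m` the upper one; the roles are exchanged beyond `b`.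
  have c1 : ConvexOn ℝ (Set.Ioo (ωs - δ) (ωs + δ))
      (fun x => q x - Q - m / 2 * ((x - a) * (x - b))) := by
    refine convexOn_of_hasDerivWithinAt2_nonneg (convex_Ioo _ _)
      (f' := fun x => q₁ x - m / 2 * ((x - b) + (x - a))) (f'' := fun x => q₂ x - 2 * (m / 2))
      (fun x hx => ?_) (fun x hx => ?_) (fun x hx => ?_) (fun x hx => ?_)
    · exact ((hq x hx).sub (hasDerivAt_quadratic _ _ _ x)).continuousAt.continuousWithinAt
    · exact ((hq x (interior_subset hx)).sub (hasDerivAt_quadratic _ _ _ x)).hasDerivWithinAt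
    · exact ((h.hasDeriv_q₁ x (interior_subset hx)).sub
        (hasDerivAt_quadratic_deriv _ _ _ x)).hasDerivWithinAt
    · linarith [h.lower x (interior_subset hx)]
  have c2 : ConvexOn ℝ (Set.Ioo (ωs - δ) (ωs + δ))
      (fun x => M / 2 * ((x - a) * (x - b)) - (q x - Q)) := by
    refine convexOn_of_hasDerivWithinAt2_nonneg (convex_Ioo _ _)
      (f' := fun x => M / 2 * ((x - b) + (x - a)) - q₁ x) (f'' := fun x => 2 * (M / 2) - q₂ x)
      (fun x hx => ?_) (fun x hx => ?_) (fun x hx => ?_) (fun x hx => ?_)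
    · exact ((hasDerivAt_quadratic _ _ _ x).sub (hq x hx)).continuousAt.continuousWithinAt
    · exact ((hasDerivAt_quadratic _ _ _ x).sub (hq x (interior_subset hx))).hasDerivWithinAt
    · exact ((hasDerivAt_quadratic_deriv _ _ _ x).sub
        (h.hasDeriv_q₁ x (interior_subset hx))).hasDerivWithinAt
    · linarith [h.upper x (interior_subset hx)]
  obtain ⟨i1, o1⟩ := convexOn_zeros c1 ha hb hab (by simp [hqa]) (by simp [hqb])
  obtain ⟨i2, o2⟩ := convexOn_zeros c2 ha hb hab (by simp [hqa]) (by simp [hqb])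
  refine ⟨fun x hx => ⟨?_, ?_⟩, fun x hx hbx => ⟨?_, ?_⟩⟩
  · linarith [i2 x hx]
  · linarith [i1 x hx]
  · linarith [o1 x hx hbx]
  · linarith [o2 x hx hbx]

/-- With `s = x - b` and `w = b - a`, the integrand is `s (s + w)`; its primitive vanishing at `b`
is `s² (w/2 + s/3)`. -/
theorem hasDerivAt_cubic (c a b x : ℝ) :
    HasDerivAt (fun x => c * ((x - b) ^ 2 * ((b - a) / 2 + (x - b) / 3)))
      (c * ((x - a) * (x - b))) x := by
  have h1 := ((hasDerivAt_id x).sub_const b)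
  have := ((h1.pow 2).mul ((h1.div_const 3).const_add ((b - a) / 2))).const_mul c
  refine this.congr_deriv ?_
  simp only [id, Pi.pow_apply]
  push_cast
  ring

theorem hasDerivAt_potential (h : IsWell q q₁ q₂ d ωs δ m M) (Q : ℝ) {x : ℝ}
    (hx : x ∈ Set.Ioo (ωs - δ) (ωs + δ)) : HasDerivAt (potential d Q) (q x - Q) x := by
  have := (h.hasDeriv_d x hx).sub ((hasDerivAt_id x).mul_const Q)
  exact this.congr_deriv (by simp)

/-- Two-sided comparison of the potential with cubics. -/
theorem potential_bounds (h : IsWell q q₁ q₂ d ωs δ m M) {Q a b : ℝ}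
    (ha : a ∈ Set.Ioo (ωs - δ) (ωs + δ)) (hb : b ∈ Set.Ioo (ωs - δ) (ωs + δ)) (hab : a < b)
    (hqa : q a = Q) (hqb : q b = Q) {x : ℝ} (hx : x ∈ Set.Ioo (ωs - δ) (ωs + δ)) (hax : a ≤ x) :
    m / 2 * ((x - b) ^ 2 * ((b - a) / 2 + (x - b) / 3)) ≤ potential d Q x - potential d Q b ∧
    potential d Q x - potential d Q b ≤ M / 2 * ((x - b) ^ 2 * ((b - a) / 2 + (x - b) / 3)) := by
  obtain ⟨hin, hout⟩ := h.quadratic_bounds ha hb hab hqa hqb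
  have hV := fun y hy => h.hasDerivAt_potential Q (x := y) hy
  rcases le_total x b with hxb | hbx
  · have hsub : ∀ y ∈ Set.Icc x b, y ∈ Set.Ioo (ωs - δ) (ωs + δ) := fun y hy =>
      ⟨hx.1.trans_le hy.1, hy.2.trans_lt hb.2⟩
    have h1 := le_of_hasDerivAt_nonneg hxb (fun y hy => (hasDerivAt_cubic (m / 2) a b y).sub
      (hV y (hsub y hy))) (fun y hy => sub_nonneg.2 (hin y ⟨hax.trans hy.1, hy.2⟩).2)
    have h2 := le_of_hasDerivAt_nonneg hxb (fun y hy => (hV y (hsub y hy)).sub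
      (hasDerivAt_cubic (M / 2) a b y)) (fun y hy => sub_nonneg.2 (hin y ⟨hax.trans hy.1, hy.2⟩).1)
    simp only [Pi.sub_apply, sub_self, ne_eq, OfNat.ofNat_ne_zero, not_false_eq_true, zero_pow,
      zero_mul, mul_zero, zero_sub, sub_zero] at h1 h2
    constructor <;> linarith
  · have hsub : ∀ y ∈ Set.Icc b x, y ∈ Set.Ioo (ωs - δ) (ωs + δ) := fun y hy =>
      ⟨hb.1.trans_le hy.1, hy.2.trans_lt hx.2⟩
    have h1 := le_of_hasDerivAt_nonneg hbx (fun y hy => (hV y (hsub y hy)).sub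
      (hasDerivAt_cubic (m / 2) a b y)) (fun y hy => sub_nonneg.2 (hout y (hsub y hy) hy.1).1)
    have h2 := le_of_hasDerivAt_nonneg hbx (fun y hy => (hasDerivAt_cubic (M / 2) a b y).sub
      (hV y (hsub y hy))) (fun y hy => sub_nonneg.2 (hout y (hsub y hy) hy.1).2)
    simp only [Pi.sub_apply, sub_self, ne_eq, OfNat.ofNat_ne_zero, not_false_eq_true, zero_pow,
      zero_mul, mul_zero, zero_sub, sub_zero] at h1 h2
    constructor <;> linarith

/-- Below the fraction `c` of the barrier one stays away from the barrier top. -/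
theorem barrier_gap (h : IsWell q q₁ q₂ d ωs δ m M) {Q a b : ℝ}
    (ha : a ∈ Set.Ioo (ωs - δ) (ωs + δ)) (hb : b ∈ Set.Ioo (ωs - δ) (ωs + δ)) (hab : a < b)
    (hqa : q a = Q) (hqb : q b = Q) {x c : ℝ} (hx : x ∈ Set.Ioo (ωs - δ) (ωs + δ)) (hax : a ≤ x)
    (hc : 0 < c) (hc1 : c < 1) (hlt : potential d Q x - potential d Q b <
      c * (potential d Q a - potential d Q b)) :
    (1 - c) * m / (6 * M) * (b - a) ≤ x - a := by
  have hmM := h.m_le_M (by linarith [ha.1, ha.2] : 0 < δ)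
  have hm := h.m_pos
  have hM : 0 < M := hm.trans_le hmM
  have hw : 0 < b - a := by linarith
  have hcm : (1 - c) * m / (6 * M) ≤ 1 := by
    rw [div_le_one (by positivity)]
    nlinarith [mul_pos hc hm]
  rcases le_total b x with hbx | hxb
  · nlinarith
  · obtain ⟨hin, -⟩ := h.quadratic_bounds ha hb hab hqa hqb
    have hsub : ∀ y ∈ Set.Icc a x, y ∈ Set.Ioo (ωs - δ) (ωs + δ) := fun y hy =>
      ⟨ha.1.trans_le hy.1, hy.2.trans_lt hx.2⟩
    -- Compare the descent from the top. With `u = x - a` and `w = b - a` it is at most `M u w²/4`,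
    -- while the energy condition forces at least `(1 - c) m w³/12`. This gives `(1 - c) m w ≤ 3 M
    -- u`, twice as strong as required.
    have h1 := le_of_hasDerivAt_nonneg hax (fun y hy => (h.hasDerivAt_potential Q (hsub y hy)).sub
      (hasDerivAt_cubic (M / 2) a b y)) (fun y hy => sub_nonneg.2 (hin y ⟨hy.1, hy.2.trans hxb⟩).1)
    have h2 := (h.potential_bounds ha hb hab hqa hqb ha le_rfl).1
    simp only [Pi.sub_apply] at h1
    set Va := potential d Q a
    set Vb := potential d Q b
    set Vx := potential d Q x
    obtain ⟨w, hwdef⟩ : ∃ w, w = b - a := ⟨_, rfl⟩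
    obtain ⟨u, hudef⟩ : ∃ u, u = x - a := ⟨_, rfl⟩
    have e1 : a - b = -w := by linarith
    have e2 : x - b = u - w := by linarith
    rw [e1, e2, ← hwdef] at h1
    rw [e1, ← hwdef] at h2
    rw [← hwdef] at hw ⊢
    rw [← hudef]
    have hu0 : 0 ≤ u := by linarith
    have huw : u ≤ w := by linarith
    have h3 : (1 - c) * (m / 12 * w ^ 3) ≤ Va - Vx := by
      have : m / 12 * w ^ 3 ≤ Va - Vb := by nlinarith
      nlinarith [mul_le_mul_of_nonneg_left this (by linarith : 0 ≤ 1 - c)]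
    have h4 : Va - Vx ≤ M / 2 * (u ^ 2 * (w / 2 - u / 3)) := by nlinarith
    have h5 : u ^ 2 * (w / 2 - u / 3) ≤ u * w ^ 2 / 2 := by
      have : 0 ≤ u ^ 3 := by positivity
      nlinarith [mul_nonneg (mul_nonneg hu0 hw.le) (sub_nonneg.2 huw)]
    have h6 : (1 - c) * (m / 12 * w ^ 3) ≤ M / 4 * (u * w ^ 2) := by
      nlinarith [mul_le_mul_of_nonneg_left h5 (by positivity : 0 ≤ M / 2)]
    have h7 : (1 - c) * m * w ≤ 3 * M * u := by
      have hw2 : 0 < w ^ 2 := by positivity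
      by_contra hcon
      have := mul_lt_mul_of_pos_right (not_le.1 hcon) hw2
      nlinarith
    rw [div_mul_eq_mul_div, div_le_iff₀ (by positivity)]
    nlinarith [mul_nonneg hM.le hu0]

end IsWell

end NLSOscillation

/-! ### The signed square root of the potential and its slope -/

namespace NLSOscillation

open Filter Topology Function

/-- A signed square root of twice a potential with a nondegenerate minimum: if `V` vanishes to
second order at `x₀` and is strictly monotone on either side, then `V = y²/2` with `y` continuously
differentiable and increasing. -/
theorem exists_signed_sqrt {V V' : ℝ → ℝ} {l r x₀ k : ℝ} (hx₀ : x₀ ∈ Set.Ioo l r)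
    (hV : ∀ x ∈ Set.Ioo l r, HasDerivAt V (V' x) x) (hV' : ContinuousOn V' (Set.Ioo l r))
    (hk : HasDerivAt V' k x₀) (hk0 : 0 < k) (h0 : V x₀ = 0) (h0' : V' x₀ = 0)
    (hneg : ∀ x ∈ Set.Ioo l r, x < x₀ → V' x < 0) (hpos : ∀ x ∈ Set.Ioo l r, x₀ < x → 0 < V' x) :
    ∃ y D : ℝ → ℝ, ContinuousOn D (Set.Ioo l r) ∧ D x₀ ^ 2 = k ∧
      ∀ x ∈ Set.Ioo l r, HasDerivAt y (D x) x ∧ 0 < D x ∧ y x ^ 2 = 2 * V x ∧ y x * D x = V' x ∧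
        (x₀ < x → 0 < y x) ∧ (x < x₀ → y x < 0) := by
  have hVc : ContinuousOn V (Set.Ioo l r) := fun x hx => (hV x hx).continuousAt.continuousWithinAt
  have hVpos : ∀ x ∈ Set.Ioo l r, x ≠ x₀ → 0 < V x := by
    intro x hx hne
    rcases lt_or_gt_of_ne hne with hlt | hlt
    · have hanti : StrictAntiOn V (Set.Icc x x₀) := by
        have hsub : Set.Icc x x₀ ⊆ Set.Ioo l r := fun z hz =>
          ⟨hx.1.trans_le hz.1, hz.2.trans_lt hx₀.2⟩
        refine strictAntiOn_of_deriv_neg (convex_Icc _ _) (hVc.mono hsub) fun z hz => ?_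
        rw [interior_Icc] at hz
        have hz' := hsub (Set.Ioo_subset_Icc_self hz)
        rw [(hV z hz').deriv]
        exact hneg z hz' hz.2
      have := hanti (Set.left_mem_Icc.2 hlt.le) (Set.right_mem_Icc.2 hlt.le) hlt
      rwa [h0] at this
    · have hmono : StrictMonoOn V (Set.Icc x₀ x) := by
        have hsub : Set.Icc x₀ x ⊆ Set.Ioo l r := fun z hz =>
          ⟨hx₀.1.trans_le hz.1, hz.2.trans_lt hx.2⟩
        refine strictMonoOn_of_deriv_pos (convex_Icc _ _) (hVc.mono hsub) fun z hz => ?_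
        rw [interior_Icc] at hz
        have hz' := hsub (Set.Ioo_subset_Icc_self hz)
        rw [(hV z hz').deriv]
        exact hpos z hz' hz.1
      have := hmono (Set.left_mem_Icc.2 hlt.le) (Set.right_mem_Icc.2 hlt.le) hlt
      rwa [h0] at this
  set y : ℝ → ℝ := fun x => if x < x₀ then -√(2 * V x) else √(2 * V x) with hy
  set D : ℝ → ℝ := fun x => if x = x₀ then √k else |V' x| / √(2 * V x) with hD
  have hIoo : Set.Ioo l r ∈ 𝓝 x₀ := Ioo_mem_nhds hx₀.1 hx₀.2
  -- the two limits at the minimum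
  have hslope : Tendsto (fun x => V' x / (x - x₀)) (𝓝[≠] x₀) (𝓝 k) := by
    have := hasDerivAt_iff_tendsto_slope.1 hk
    refine this.congr fun x => ?_
    rw [slope_def_field, h0', sub_zero]
  -- `V'` is assumed differentiable only at `x₀`, so l'Hôpital's rule with the slope limit takes the
  -- place of a Taylor expansion.
  have hquot : Tendsto (fun x => 2 * V x / (x - x₀) ^ 2) (𝓝[≠] x₀) (𝓝 k) := by
    refine HasDerivAt.lhopital_zero_nhdsNE (f' := fun x => 2 * V' x)
      (g' := fun x => 2 * (x - x₀)) ?_ ?_ ?_ ?_ ?_ ?_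
    · filter_upwards [mem_nhdsWithin_of_mem_nhds hIoo] with x hx
      exact (hV x hx).const_mul 2
    · refine Eventually.of_forall fun x => ?_
      have := ((hasDerivAt_id x).sub_const x₀).pow 2
      exact this.congr_deriv (by simp)
    · filter_upwards [self_mem_nhdsWithin] with x hx
      exact mul_ne_zero two_ne_zero (sub_ne_zero.2 hx)
    · have : Tendsto (fun x => 2 * V x) (𝓝 x₀) (𝓝 (2 * V x₀)) :=
        ((hV x₀ hx₀).continuousAt.tendsto).const_mul 2
      rw [h0, mul_zero] at this
      exact this.mono_left nhdsWithin_le_nhds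
    · have : Tendsto (fun x : ℝ => (x - x₀) ^ 2) (𝓝 x₀) (𝓝 ((x₀ - x₀) ^ 2)) :=
        (by fun_prop : Continuous fun x : ℝ => (x - x₀) ^ 2).tendsto x₀
      rw [sub_self, zero_pow two_ne_zero] at this
      exact this.mono_left nhdsWithin_le_nhds
    · refine hslope.congr' ?_
      filter_upwards [self_mem_nhdsWithin] with x hx
      rw [mul_div_mul_left _ _ two_ne_zero]
  have hsqrt : Tendsto (fun x => √(2 * V x) / |x - x₀|) (𝓝[≠] x₀) (𝓝 √k) := by
    refine hquot.sqrt.congr fun x => ?_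
    rw [Real.sqrt_div' _ (sq_nonneg _), Real.sqrt_sq_eq_abs]
  have hyx₀ : y x₀ = 0 := by simp [hy, h0]
  have hDx₀ : D x₀ = √k := by simp [hD]
  have hderiv : ∀ x ∈ Set.Ioo l r, HasDerivAt y (D x) x := by
    intro x hx
    rcases lt_trichotomy x x₀ with hlt | rfl | hlt
    · have h1 := hVpos x hx hlt.ne
      have h2 := (((hV x hx).const_mul 2).sqrt (by positivity)).neg
      have h3 : y =ᶠ[𝓝 x] fun x => -√(2 * V x) := by
        filter_upwards [Iio_mem_nhds hlt] with z hz
        simp only [hy]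
        rw [if_pos (Set.mem_Iio.1 hz)]
      refine (h2.congr_of_eventuallyEq h3).congr_deriv ?_
      simp only [hD]
      rw [if_neg hlt.ne, abs_of_neg (hneg x hx hlt)]
      field_simp
    · rw [hasDerivAt_iff_tendsto_slope, hDx₀]
      refine hsqrt.congr' ?_
      filter_upwards [self_mem_nhdsWithin] with z hz
      rw [slope_def_field, hyx₀, sub_zero]
      simp only [hy]
      rcases lt_or_gt_of_ne hz with hlt | hlt
      · rw [if_pos hlt, abs_of_neg (by linarith)]
        rw [div_neg, neg_div]
      · rw [if_neg hlt.not_gt, abs_of_pos (by linarith)]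
    · have h1 := hVpos x hx hlt.ne'
      have h2 := (((hV x hx).const_mul 2).sqrt (by positivity))
      have h3 : y =ᶠ[𝓝 x] fun x => √(2 * V x) := by
        filter_upwards [Ioi_mem_nhds hlt] with z hz
        simp only [hy]
        rw [if_neg (not_lt.2 (le_of_lt hz))]
      refine (h2.congr_of_eventuallyEq h3).congr_deriv ?_
      simp only [hD]
      rw [if_neg hlt.ne', abs_of_pos (hpos x hx hlt)]
      field_simp
  refine ⟨y, D, fun x hx => ?_, ?_, fun x hx => ⟨hderiv x hx, ?_, ?_, ?_, ?_, ?_⟩⟩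
  · refine ContinuousAt.continuousWithinAt ?_
    by_cases hxx : x = x₀
    · subst hxx
      rw [continuousAt_iff_punctured_nhds, hDx₀]
      have h1 : Tendsto (fun z => |V' z / (z - x)| / (√(2 * V z) / |z - x|)) (𝓝[≠] x)
          (𝓝 (|k| / √k)) := hslope.abs.div hsqrt (Real.sqrt_pos.2 hk0).ne'
      rw [abs_of_pos hk0, Real.div_sqrt] at h1
      refine h1.congr' ?_
      filter_upwards [self_mem_nhdsWithin] with z hz
      have hz0 : z ≠ x := hz
      have hz' : |z - x| ≠ 0 := abs_ne_zero.2 (sub_ne_zero.2 hz0)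
      simp only [hD]
      rw [if_neg hz0, abs_div]
      field_simp
    · have h1 := hVpos x hx hxx
      have h3 : D =ᶠ[𝓝 x] fun x => |V' x| / √(2 * V x) := by
        filter_upwards [isOpen_ne.mem_nhds hxx] with z hz
        simp only [hD]
        rw [if_neg hz]
      refine ContinuousAt.congr ?_ h3.symm
      have hnx : Set.Ioo l r ∈ 𝓝 x := Ioo_mem_nhds hx.1 hx.2
      exact (hV'.continuousAt hnx).abs.div
        (((hV x hx).continuousAt.const_mul 2).sqrt) (by positivity)
  · rw [hDx₀, Real.sq_sqrt hk0.le]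
  · simp only [hD]
    split_ifs with hxx
    · exact Real.sqrt_pos.2 hk0
    · have h1 := hVpos x hx hxx
      have h2 : V' x ≠ 0 := by
        rcases lt_or_gt_of_ne hxx with hlt | hlt
        · exact (hneg x hx hlt).ne
        · exact (hpos x hx hlt).ne'
      positivity
  · have h1 : 0 ≤ V x := by
      by_cases hxx : x = x₀
      · rw [hxx, h0]
      · exact (hVpos x hx hxx).le
    simp only [hy]
    split_ifs
    · rw [neg_sq, Real.sq_sqrt (by positivity)]
    · rw [Real.sq_sqrt (by positivity)]
  · simp only [hD]
    by_cases hxx : x = x₀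
    · rw [hxx, hyx₀, h0', zero_mul]
    · have h1 := hVpos x hx hxx
      have h2 : √(2 * V x) ≠ 0 := by positivity
      rw [if_neg hxx]
      simp only [hy]
      rcases lt_or_gt_of_ne hxx with hlt | hlt
      · rw [if_pos hlt, abs_of_neg (hneg x hx hlt)]
        field_simp
      · rw [if_neg hlt.not_gt, abs_of_pos (hpos x hx hlt)]
        field_simp
  · intro hlt
    simp only [hy]
    rw [if_neg hlt.not_gt]
    have := hVpos x hx hlt.ne'
    positivity
  · intro hlt
    simp only [hy]
    rw [if_pos hlt]
    have := hVpos x hx hlt.ne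
    have : 0 < √(2 * V x) := by positivity
    linarith

namespace IsWell

variable {q q₁ q₂ d : ℝ → ℝ} {ωs δ m M : ℝ}

/-- The distance of a root to the minimum in terms of the excess of `Q`. -/
theorem root_bounds (h : IsWell q q₁ q₂ d ωs δ m M) {Q a : ℝ}
    (ha : a ∈ Set.Ioo (ωs - δ) (ωs + δ)) (hqa : q a = Q) :
    2 / M * (Q - q ωs) ≤ (a - ωs) ^ 2 ∧ (a - ωs) ^ 2 ≤ 2 / m * (Q - q ωs) := by
  have hδ : 0 < δ := by linarith [ha.1, ha.2]
  have hm := h.m_pos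
  have hM := hm.trans_le (h.m_le_M hδ)
  obtain ⟨h1, h2⟩ := h.q_bounds ha
  rw [hqa] at h1 h2
  constructor
  · rw [div_mul_eq_mul_div, div_le_iff₀ hM]
    linarith
  · rw [div_mul_eq_mul_div, le_div_iff₀ hm]
    linarith

/-- The speed `V'/√(2V)` in the well is comparable to the square root of its width. -/
theorem speed_bounds (h : IsWell q q₁ q₂ d ωs δ m M) {c K : ℝ} (hc : 0 < c) (hc1 : c < 1)
    (hK : 0 < K) :
    ∃ C₁ > 0, ∃ C₂ > 0, ∀ Q a b : ℝ, a ∈ Set.Ioo (ωs - δ) (ωs + δ) →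
      b ∈ Set.Ioo (ωs - δ) (ωs + δ) → a < b → q a = Q → q b = Q →
      ∀ x ∈ Set.Ioo (ωs - δ) (ωs + δ), a < x → x ≠ b → x - b ≤ K * (b - a) →
      potential d Q x - potential d Q b < c * (potential d Q a - potential d Q b) →
      ∀ D : ℝ, D ^ 2 * (2 * (potential d Q x - potential d Q b)) = (q x - Q) ^ 2 →
        C₁ * (b - a) ≤ D ^ 2 ∧ D ^ 2 ≤ C₂ * (b - a) := by
  by_cases hδ : 0 < δ
  swap
  · exact ⟨1, one_pos, 1, one_pos, fun Q a b ha => absurd (by linarith [ha.1, ha.2]) hδ⟩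
  have hm := h.m_pos
  have hmM := h.m_le_M hδ
  have hM := hm.trans_le hmM
  set κ := (1 - c) * m / (6 * M) with hκ
  have hκ0 : 0 < κ := div_pos (mul_pos (by linarith) hm) (by positivity)
  -- With `s = x - b` and `w = b - a`, `(q - Q)²` lies between `(m/2)²` and `(M/2)²` times `s² (s +
  -- w)²`. As `-w < s ≤ K w`, `V` lies between `(m/2) s² w/6` and `(M/2) s² w (1/2 + K/3)`. The
  -- factors `s²` cancel in `(q - Q)²/(2V)`, and `κ w ≤ s + w ≤ (1 + K) w` leaves a multiple of `w`.
  refine ⟨(m / 2) ^ 2 * κ ^ 2 / (M * (1 / 2 + K / 3)), by positivity,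
    (M / 2) ^ 2 * (1 + K) ^ 2 / (m / 6), by positivity, ?_⟩
  intro Q a b ha hb hab hqa hqb x hx hax hxb hxK hlt D hD
  have hgap := h.barrier_gap ha hb hab hqa hqb hx hax.le hc hc1 hlt
  rw [← hκ] at hgap
  obtain ⟨hV1, hV2⟩ := h.potential_bounds ha hb hab hqa hqb hx hax.le
  obtain ⟨hin, hout⟩ := h.quadratic_bounds ha hb hab hqa hqb
  set V := potential d Q x - potential d Q b
  obtain ⟨w, hw⟩ : ∃ w, w = b - a := ⟨_, rfl⟩
  obtain ⟨s, hs⟩ : ∃ s, s = x - b := ⟨_, rfl⟩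
  have exa : x - a = s + w := by linarith
  rw [← hw] at hgap hV1 hV2 hxK ⊢
  rw [← hs] at hV1 hV2 hxK
  rw [exa] at hgap
  have hw0 : 0 < w := by linarith
  have hsw : 0 < s + w := by linarith
  have hs0 : s ≠ 0 := by rw [hs]; exact sub_ne_zero.2 hxb
  have hs2 : 0 < s ^ 2 := by positivity
  have hVlow : m / 2 * (s ^ 2 * (w / 6)) ≤ V := by
    refine le_trans ?_ hV1
    gcongr
    linarith
  have hVup : V ≤ M / 2 * (s ^ 2 * (w * (1 / 2 + K / 3))) := by
    refine hV2.trans ?_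
    gcongr
    linarith
  have hVpos : 0 < V := lt_of_lt_of_le (by positivity) hVlow
  have hq2 : (m / 2) ^ 2 * (s ^ 2 * (s + w) ^ 2) ≤ (q x - Q) ^ 2 ∧
      (q x - Q) ^ 2 ≤ (M / 2) ^ 2 * (s ^ 2 * (s + w) ^ 2) := by
    have e1 : ∀ z : ℝ, z ^ 2 * (s ^ 2 * (s + w) ^ 2) = (z * ((s + w) * |s|)) ^ 2 := fun z => by
      rw [mul_pow, mul_pow, sq_abs]; ring
    have key : m / 2 * ((s + w) * |s|) ≤ |q x - Q| ∧ |q x - Q| ≤ M / 2 * ((s + w) * |s|) := by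
      rcases le_total x b with hle | hle
      · obtain ⟨h1, h2⟩ := hin x ⟨hax.le, hle⟩
        rw [exa, ← hs] at h1 h2
        have hsn : s ≤ 0 := by linarith
        rw [abs_of_nonpos hsn]
        have hneg : (s + w) * s ≤ 0 := mul_nonpos_of_nonneg_of_nonpos hsw.le hsn
        have hqn : q x - Q ≤ 0 := h2.trans (mul_nonpos_of_nonneg_of_nonpos (by positivity) hneg)
        rw [abs_of_nonpos hqn]
        constructor <;> linarith
      · obtain ⟨h1, h2⟩ := hout x hx hle
        rw [exa, ← hs] at h1 h2
        have hsn : 0 ≤ s := by linarith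
        rw [abs_of_nonneg hsn]
        have hqn : 0 ≤ q x - Q := le_trans (by positivity) h1
        rw [abs_of_nonneg hqn]
        exact ⟨h1, h2⟩
    rw [e1, e1, ← sq_abs (q x - Q)]
    constructor
    · exact pow_le_pow_left₀ (by positivity) key.1 2
    · exact pow_le_pow_left₀ (abs_nonneg _) key.2 2
  have hDeq : D ^ 2 = (q x - Q) ^ 2 / (2 * V) := by
    rw [eq_div_iff (by positivity)]; exact hD
  rw [hDeq]
  constructor
  · calc (m / 2) ^ 2 * κ ^ 2 / (M * (1 / 2 + K / 3)) * w
        = ((m / 2) ^ 2 * (s ^ 2 * (κ * w) ^ 2)) /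
          (2 * (M / 2 * (s ^ 2 * (w * (1 / 2 + K / 3))))) := by
          field_simp
      _ ≤ (q x - Q) ^ 2 / (2 * V) := by
          refine div_le_div₀ (sq_nonneg _) ?_ (by positivity) (by linarith)
          refine le_trans ?_ hq2.1
          gcongr
  · calc (q x - Q) ^ 2 / (2 * V)
        ≤ ((M / 2) ^ 2 * (s ^ 2 * ((1 + K) * w) ^ 2)) / (2 * (m / 2 * (s ^ 2 * (w / 6)))) := by
          refine div_le_div₀ (by positivity) ?_ (by positivity) (by linarith)
          refine hq2.2.trans ?_
          gcongr
          linarith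
      _ = (M / 2) ^ 2 * (1 + K) ^ 2 / (m / 6) * w := by
          field_simp

end IsWell

end NLSOscillation

namespace NLSOscillation

open Filter Topology Function

/-! ### The kinetic energy -/

theorem hasDerivAt_comp_mk_snd {f : ℝ × ℝ → ℝ} {f' : ℝ × ℝ →L[ℝ] ℝ} {p : ℝ × ℝ}
    (h : HasFDerivAt f f' p) : HasDerivAt (fun l => f (p.1, l)) (f' (0, 1)) p.2 :=
  HasFDerivAt.comp_hasDerivAt (f := fun l => (p.1, l)) p.2 h
    ((hasDerivAt_const p.2 p.1).prodMk (hasDerivAt_id p.2))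

theorem hasDerivAt_comp_mk_fst {f : ℝ × ℝ → ℝ} {f' : ℝ × ℝ →L[ℝ] ℝ} {p : ℝ × ℝ}
    (h : HasFDerivAt f f' p) : HasDerivAt (fun ω => f (ω, p.2)) (f' (1, 0)) p.1 :=
  HasFDerivAt.comp_hasDerivAt (f := fun ω => (ω, p.2)) p.1 h
    ((hasDerivAt_id p.1).prodMk (hasDerivAt_const p.1 p.2))

/-- The open square of half side `δ` about `(ωs, 0)`. -/
def box (ωs δ : ℝ) : Set (ℝ × ℝ) := Set.Ioo (ωs - δ) (ωs + δ) ×ˢ Set.Ioo (-δ) δ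

theorem isOpen_box (ωs δ : ℝ) : IsOpen (box ωs δ) := isOpen_Ioo.prod isOpen_Ioo

/-- A kinetic energy `λ² κ(ω, λ)` close to `α λ² / 2`, with the symplectic weight `A`. -/
structure IsKinetic (A : ℝ → ℝ) (κ : ℝ × ℝ → ℝ) (ωs δ α : ℝ) : Prop where
  pos : 0 < α
  contDiffOn : ContDiffOn ℝ 1 κ (box ωs δ)
  lower : ∀ p ∈ box ωs δ, α / 4 ≤ κ p
  upper : ∀ p ∈ box ωs δ, κ p ≤ α
  slope : ∀ p ∈ box ωs δ, |p.2 * fderiv ℝ κ p (0, 1)| ≤ α / 8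
  cont : ContinuousOn A (Set.Ioo (ωs - δ) (ωs + δ))
  weight_lower : ∀ ω ∈ Set.Ioo (ωs - δ) (ωs + δ), α / 2 ≤ A ω
  weight_upper : ∀ ω ∈ Set.Ioo (ωs - δ) (ωs + δ), A ω ≤ 2 * α

/-- The coefficient of `λ²` in the finite dimensional energy. -/
noncomputable def kinetic (A : ℝ → ℝ) (N : ℕ) (e : ℕ → ℝ → ℝ → ℝ → ℝ) (Q : ℝ) (p : ℝ × ℝ) : ℝ :=
  1 / 2 * A p.1 + ∑ m ∈ Finset.Icc 2 N, p.2 ^ (m - 2) * e m Q p.1 0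

theorem finiteEnergy_eq (A d : ℝ → ℝ) (ωs : ℝ) (N : ℕ) (e : ℕ → ℝ → ℝ → ℝ → ℝ) (Q ω l : ℝ) :
    finiteEnergy A d ωs N e Q ω l 0 = potential d Q ω + l ^ 2 * kinetic A N e Q (ω, l) := by
  have : ∑ m ∈ Finset.Icc 2 N, l ^ m * e m Q ω 0
      = l ^ 2 * ∑ m ∈ Finset.Icc 2 N, l ^ (m - 2) * e m Q ω 0 := by
    rw [Finset.mul_sum]
    refine Finset.sum_congr rfl fun m hm => ?_
    rw [← mul_assoc, ← pow_add, Nat.add_sub_cancel' (Finset.mem_Icc.1 hm).1]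
  rw [finiteEnergy, kinetic, potential, this]
  ring

/-- At `ρ = 0`, the scaling `|Q - qs| < δ²` makes `√|Q - qs|` at most `δ`, so the symbol weight is
at most `2 δ`. -/
theorem IsSymbol.eventually_contDiffOn {qs ωs : ℝ} {i : ℕ} {f : ℝ → ℝ → ℝ → ℝ}
    (hf : IsSymbol qs ωs i f) :
    ∃ C : ℝ, 0 ≤ C ∧ ∀ᶠ δ in 𝓝[>] (0 : ℝ), ∀ Q, |Q - qs| < δ ^ 2 →
      ContDiffOn ℝ 1 (fun ω => f Q ω 0) (Set.Ioo (ωs - δ) (ωs + δ)) ∧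
      ∀ ω ∈ Set.Ioo (ωs - δ) (ωs + δ), |f Q ω 0| ≤ C * (2 * δ) ^ i := by
  obtain ⟨r, hr, hc, C, hC⟩ := hf
  refine ⟨|C|, abs_nonneg C, ?_⟩
  filter_upwards [self_mem_nhdsWithin, Ioo_mem_nhdsGT hr, Ioo_mem_nhdsGT one_pos]
    with δ hδ hδr hδ1 Q hQ
  have hδ0 : 0 < δ := hδ
  have hmem : ∀ ω ∈ Set.Ioo (ωs - δ) (ωs + δ),
      ((Q, ω, 0) : ℝ × ℝ × ℝ) ∈ Metric.ball (qs, ωs, 0) r := fun ω hω => by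
    have h1 : |ω - ωs| < δ := abs_lt.2 ⟨by linarith [hω.1], by linarith [hω.2]⟩
    have h2 : δ ^ 2 < δ := by nlinarith [hδ1.2]
    rw [Metric.mem_ball, Prod.dist_eq, Prod.dist_eq]
    simp only [Real.dist_eq, sub_zero, abs_zero]
    exact max_lt (by linarith [hδr.2]) (max_lt (by linarith [hδr.2]) hr)
  constructor
  · have h1 : ContDiff ℝ 1 (fun ω : ℝ => ((Q, ω, 0) : ℝ × ℝ × ℝ)) := by fun_prop
    exact (hc.of_le (by exact_mod_cast le_top)).comp h1.contDiffOn hmem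
  · intro ω hω
    have h1 : |ω - ωs| < δ := abs_lt.2 ⟨by linarith [hω.1], by linarith [hω.2]⟩
    have h2 : √|Q - qs| ≤ δ := Real.sqrt_le_iff.2 ⟨hδ0.le, hQ.le⟩
    refine (hC _ (hmem ω hω)).trans ?_
    simp only [abs_zero, Real.sqrt_zero, add_zero]
    refine mul_le_mul (le_abs_self C) (pow_le_pow_left₀ (by positivity) (by linarith) i)
      (by positivity) (abs_nonneg C)

/-- For `m = 2` there is no power of `λ` left and smallness comes from the first order vanishing of
`e 2`; for `m ≥ 3` it comes from a factor `λ`. -/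
theorem IsCoefficients.eventually_small {qs ωs : ℝ} {N : ℕ} {e : ℕ → ℝ → ℝ → ℝ → ℝ}
    (he : IsCoefficients qs ωs N e) {η : ℝ} (hη : 0 < η) {m : ℕ} (hm : m ∈ Finset.Icc 2 N) :
    ∀ᶠ δ in 𝓝[>] (0 : ℝ), ∀ Q, |Q - qs| < δ ^ 2 →
      ContDiffOn ℝ 1 (fun ω => e m Q ω 0) (Set.Ioo (ωs - δ) (ωs + δ)) ∧
      ∀ p ∈ box ωs δ, |p.2 ^ (m - 2) * e m Q p.1 0| ≤ η := by
  obtain ⟨h2, hN⟩ := Finset.mem_Icc.1 hm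
  have hlim : ∀ C : ℝ, ∀ᶠ δ in 𝓝[>] (0 : ℝ), C * δ ≤ η := fun C => by
    have : Tendsto (fun δ : ℝ => C * δ) (𝓝 0) (𝓝 (C * 0)) :=
      (continuous_const.mul continuous_id).tendsto 0
    rw [mul_zero] at this
    exact (this.mono_left nhdsWithin_le_nhds).eventually (eventually_le_nhds hη)
  rcases h2.eq_or_lt with rfl | h3
  · obtain ⟨C, hC, hev⟩ := he.1.eventually_contDiffOn
    filter_upwards [hev, hlim (2 * C)] with δ h1 h2 Q hQ
    refine ⟨(h1 Q hQ).1, fun p hp => ?_⟩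
    have := (h1 Q hQ).2 p.1 hp.1
    simp only [Nat.sub_self, pow_zero, one_mul]
    linarith
  · obtain ⟨C, hC, hev⟩ := (he.2 m h3 hN).eventually_contDiffOn
    filter_upwards [hev, hlim C, Ioo_mem_nhdsGT one_pos] with δ h1 h2 hδ1 Q hQ
    refine ⟨(h1 Q hQ).1, fun p hp => ?_⟩
    have h4 := (h1 Q hQ).2 p.1 hp.1
    rw [pow_zero, mul_one] at h4
    have h5 : |p.2| ≤ δ := abs_le.2 ⟨hp.2.1.le, hp.2.2.le⟩
    have h6 : |p.2| ^ (m - 2) ≤ |p.2| := by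
      have := pow_le_pow_of_le_one (abs_nonneg p.2) (h5.trans hδ1.2.le)
        (by omega : 1 ≤ m - 2)
      rwa [pow_one] at this
    rw [abs_mul, abs_pow]
    calc |p.2| ^ (m - 2) * |e m Q p.1 0| ≤ δ * C :=
          mul_le_mul (h6.trans h5) h4 (abs_nonneg _) hδ1.1.le
      _ ≤ η := by linarith

theorem IsCoefficients.eventually_isKinetic {qs ωs r : ℝ} {N : ℕ} {e : ℕ → ℝ → ℝ → ℝ → ℝ}
    (he : IsCoefficients qs ωs N e) {A : ℝ → ℝ} (hr : 0 < r)
    (hA : ContDiffOn ℝ 1 A (Metric.ball ωs r)) (hA0 : 0 < A ωs) :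
    ∀ᶠ δ in 𝓝[>] (0 : ℝ), ∀ Q, |Q - qs| < δ ^ 2 →
      IsKinetic A (kinetic A N e Q) ωs δ (A ωs) := by
  set α := A ωs with hα
  -- One factor `N + 1` bounds the number of terms; the other bounds the exponent `m - 2` produced
  -- by `λ ∂_λ`.
  set η := α / (8 * (N + 1) ^ 2) with hηdef
  have hη : 0 < η := by positivity
  have hAc : ContinuousAt A ωs := (hA.continuousOn).continuousAt (Metric.ball_mem_nhds ωs hr)
  have hAev : ∀ᶠ δ in 𝓝[>] (0 : ℝ), ∀ ω ∈ Set.Ioo (ωs - δ) (ωs + δ),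
      3 / 4 * α ≤ A ω ∧ A ω ≤ 5 / 4 * α := by
    have h1 : ∀ᶠ ω in 𝓝 ωs, 3 / 4 * α ≤ A ω ∧ A ω ≤ 5 / 4 * α :=
      (hAc.eventually (eventually_ge_nhds (by linarith))).and
        (hAc.eventually (eventually_le_nhds (by linarith)))
    obtain ⟨ρ, hρ, h2⟩ := Metric.eventually_nhds_iff.1 h1
    filter_upwards [Ioo_mem_nhdsGT hρ] with δ hδ ω hω
    refine h2 ?_
    rw [Real.dist_eq, abs_lt]
    constructor <;> linarith [hω.1, hω.2, hδ.2]
  have hall := (eventually_all_finset (Finset.Icc 2 N)).2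
    fun m hm => he.eventually_small hη hm
  filter_upwards [hall, hAev, Ioo_mem_nhdsGT hr] with δ hδ hAδ hδr Q hQ
  have hsub : Set.Ioo (ωs - δ) (ωs + δ) ⊆ Metric.ball ωs r := fun ω hω => by
    rw [Metric.mem_ball, Real.dist_eq, abs_lt]
    constructor <;> linarith [hω.1, hω.2, hδr.2]
  have hcard : ((Finset.Icc 2 N).card : ℝ) ≤ N + 1 := by
    rw [Nat.card_Icc]
    have : N + 1 - 2 ≤ N + 1 := by omega
    exact_mod_cast this
  have hsum : ∀ p ∈ box ωs δ, |∑ m ∈ Finset.Icc 2 N, p.2 ^ (m - 2) * e m Q p.1 0| ≤ α / 8 := by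
    intro p hp
    calc |∑ m ∈ Finset.Icc 2 N, p.2 ^ (m - 2) * e m Q p.1 0|
        ≤ ∑ m ∈ Finset.Icc 2 N, |p.2 ^ (m - 2) * e m Q p.1 0| := Finset.abs_sum_le_sum_abs _ _
      _ ≤ (Finset.Icc 2 N).card • η := Finset.sum_le_card_nsmul _ _ _ fun m hm =>
          (hδ m hm Q hQ).2 p hp
      _ ≤ (N + 1) * η := by rw [nsmul_eq_mul]; gcongr
      _ ≤ (N + 1) * ((N + 1) * η) := by
          have hN : (0 : ℝ) ≤ N := Nat.cast_nonneg N
          gcongr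
          nlinarith [mul_nonneg hN hη.le]
      _ = α / 8 := by rw [hηdef]; field_simp
  have hcd : ContDiffOn ℝ 1 (kinetic A N e Q) (box ωs δ) := by
    have hfst : Set.MapsTo (Prod.fst : ℝ × ℝ → ℝ) (box ωs δ) (Set.Ioo (ωs - δ) (ωs + δ)) :=
      fun p hp => hp.1
    refine ContDiffOn.add (contDiffOn_const.mul ((hA.mono hsub).comp contDiffOn_fst hfst)) ?_
    refine ContDiffOn.sum fun m hm => ?_
    exact (contDiffOn_snd.pow _).mul (((hδ m hm Q hQ).1).comp contDiffOn_fst hfst)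
  refine ⟨hA0, hcd, fun p hp => ?_, fun p hp => ?_, fun p hp => ?_,
    hA.continuousOn.mono hsub, fun ω hω => ?_, fun ω hω => ?_⟩
  · have h1 := abs_le.1 (hsum p hp)
    have h2 := hAδ p.1 hp.1
    rw [kinetic]
    linarith [h1.1, h2.1]
  · have h1 := abs_le.1 (hsum p hp)
    have h2 := hAδ p.1 hp.1
    rw [kinetic]
    linarith [h1.2, h2.2]
  · have hd := (hcd.differentiableOn one_ne_zero).differentiableAt ((isOpen_box ωs δ).mem_nhds hp)
    have h1 := hasDerivAt_comp_mk_snd hd.hasFDerivAt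
    have h2 : HasDerivAt (fun l => kinetic A N e Q (p.1, l))
        (∑ m ∈ Finset.Icc 2 N, ((m - 2 : ℕ) * p.2 ^ (m - 2 - 1)) * e m Q p.1 0) p.2 := by
      have h3 : ∀ m ∈ Finset.Icc 2 N, HasDerivAt (fun l : ℝ => l ^ (m - 2) * e m Q p.1 0)
          (((m - 2 : ℕ) * p.2 ^ (m - 2 - 1)) * e m Q p.1 0) p.2 := fun m _ =>
        (hasDerivAt_pow (m - 2) p.2).mul_const _
      exact (HasDerivAt.fun_sum h3).const_add (1 / 2 * A p.1)
    rw [h1.unique h2, Finset.mul_sum]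
    calc |∑ m ∈ Finset.Icc 2 N, p.2 * (((m - 2 : ℕ) * p.2 ^ (m - 2 - 1)) * e m Q p.1 0)|
        ≤ ∑ m ∈ Finset.Icc 2 N, |p.2 * (((m - 2 : ℕ) * p.2 ^ (m - 2 - 1)) * e m Q p.1 0)| :=
          Finset.abs_sum_le_sum_abs _ _
      _ ≤ (Finset.Icc 2 N).card • ((N + 1) * η) := Finset.sum_le_card_nsmul _ _ _ fun m hm => by
          -- Euler's relation for `λ ∂_λ`. When `m = 2` the exponent is truncated, but the
          -- coefficient is zero.
          have e1 : p.2 * (((m - 2 : ℕ) * p.2 ^ (m - 2 - 1)) * e m Q p.1 0)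
              = (m - 2 : ℕ) * (p.2 ^ (m - 2) * e m Q p.1 0) := by
            rcases Nat.eq_zero_or_pos (m - 2) with h0 | h0
            · simp [h0]
            · obtain ⟨k, hk⟩ := Nat.exists_eq_add_of_lt h0
              rw [hk, zero_add, Nat.add_sub_cancel, pow_succ]
              ring
          rw [e1, abs_mul, Nat.abs_cast]
          have hm2 : ((m - 2 : ℕ) : ℝ) ≤ N + 1 := by
            have : m - 2 ≤ N + 1 := by have := (Finset.mem_Icc.1 hm).2; omega
            exact_mod_cast this
          exact mul_le_mul hm2 ((hδ m hm Q hQ).2 p hp) (abs_nonneg _) (by positivity)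
      _ ≤ (N + 1) * ((N + 1) * η) := by rw [nsmul_eq_mul]; gcongr
      _ = α / 8 := by rw [hηdef]; field_simp
  · linarith [(hAδ ω hω).1]
  · linarith [(hAδ ω hω).2]

namespace IsKinetic

variable {A : ℝ → ℝ} {κ : ℝ × ℝ → ℝ} {ωs δ α : ℝ}

/-- The canonical momentum `λ √(2κ)` is a `C¹` function, increasing in `λ`. -/
theorem contDiffOn_momentum (h : IsKinetic A κ ωs δ α) :
    ContDiffOn ℝ 1 (fun p : ℝ × ℝ => p.2 * √(2 * κ p)) (box ωs δ) := by
  refine contDiffOn_snd.mul ((contDiffOn_const.mul h.contDiffOn).sqrt fun p hp => ?_)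
  have h1 := h.lower p hp
  have h2 := h.pos
  exact (by linarith : 0 < 2 * κ p).ne'

/-- With `s = √(2κ)` the slope is `s + λ ∂_λ κ / s`. The bound `α/8` on `λ ∂_λ κ` and `s² ≥ α/2`
make the correction at most `s/4`, and `s` lies between `2/3` and `3/2` of `√α`. -/
theorem momentum_slope (h : IsKinetic A κ ωs δ α) {p : ℝ × ℝ} (hp : p ∈ box ωs δ) :
    √α / 2 ≤ fderiv ℝ (fun p : ℝ × ℝ => p.2 * √(2 * κ p)) p (0, 1) ∧
      fderiv ℝ (fun p : ℝ × ℝ => p.2 * √(2 * κ p)) p (0, 1) ≤ 2 * √α := by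
  have hα := h.pos
  have hlow := h.lower p hp
  have hup := h.upper p hp
  have hbox := (isOpen_box ωs δ).mem_nhds hp
  have hd := (h.contDiffOn_momentum.differentiableOn one_ne_zero).differentiableAt hbox
  have hκ := hasDerivAt_comp_mk_snd
    ((h.contDiffOn.differentiableOn one_ne_zero).differentiableAt hbox).hasFDerivAt
  have h1 := hasDerivAt_comp_mk_snd hd.hasFDerivAt
  have hκ0 : 0 < κ p := by linarith
  have h2 := (hasDerivAt_id p.2).mul ((hκ.const_mul 2).sqrt (by positivity : 2 * κ p ≠ 0))
  have e1 := h1.unique h2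
  rw [e1]
  simp only [id, Prod.mk.eta, one_mul]
  set s := √(2 * κ p) with hs
  set t := √α with ht
  have hs0 : 0 < s := Real.sqrt_pos.2 (by positivity)
  have ht0 : 0 < t := Real.sqrt_pos.2 hα
  have hs2 : s ^ 2 = 2 * κ p := Real.sq_sqrt (by positivity)
  have ht2 : t ^ 2 = α := Real.sq_sqrt hα.le
  obtain ⟨hl, hu⟩ := abs_le.1 (h.slope p hp)
  set k := fderiv ℝ κ p (0, 1)
  have e2 : p.2 * (2 * k / (2 * s)) = p.2 * k / s := by field_simp
  rw [e2]
  have hst : 2 / 3 * t ≤ s := by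
    refine le_of_sq_le_sq ?_ hs0.le
    nlinarith
  have hst' : s ≤ 3 / 2 * t := by
    refine le_of_sq_le_sq ?_ (by positivity)
    nlinarith
  have h3 : p.2 * k / s ≤ s / 4 := by
    rw [div_le_iff₀ hs0]; nlinarith
  have h4 : -(s / 4) ≤ p.2 * k / s := by
    rw [le_div_iff₀ hs0]; nlinarith
  constructor <;> linarith

end IsKinetic

end NLSOscillation

namespace NLSOscillation

open Filter Topology Function

/-! ### The rotation chart of the reduced system -/

/-- An invertible lower triangular endomorphism of the plane. -/
theorem exists_triangular_equiv {a c : ℝ} (b : ℝ) (ha : a ≠ 0) (hc : c ≠ 0) :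
    ∃ L : (ℝ × ℝ) ≃L[ℝ] (ℝ × ℝ), ∀ v, L v = (a * v.1, b * v.1 + c * v.2) := by
  refine ⟨ContinuousLinearEquiv.equivOfInverse
    ((a • ContinuousLinearMap.fst ℝ ℝ ℝ).prod
      (b • ContinuousLinearMap.fst ℝ ℝ ℝ + c • ContinuousLinearMap.snd ℝ ℝ ℝ))
    ((a⁻¹ • ContinuousLinearMap.fst ℝ ℝ ℝ).prod
      ((-(c⁻¹ * b * a⁻¹)) • ContinuousLinearMap.fst ℝ ℝ ℝ +
        c⁻¹ • ContinuousLinearMap.snd ℝ ℝ ℝ)) ?_ ?_, ?_⟩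
  · intro v
    ext
    · simp [ha]
    · simp only [ContinuousLinearMap.prod_apply, add_apply, smul_apply,
        ContinuousLinearMap.coe_fst', ContinuousLinearMap.coe_snd', smul_eq_mul]
      field_simp
      ring
  · intro v
    ext
    · simp [ha]
    · simp only [ContinuousLinearMap.prod_apply, add_apply, smul_apply,
        ContinuousLinearMap.coe_fst', ContinuousLinearMap.coe_snd', smul_eq_mul]
      field_simp
      ring
  · intro v
    simp

theorem exists_angle {u v R : ℝ} (hR : 0 ≤ R) (h : u ^ 2 + v ^ 2 = R ^ 2) :
    ∃ θ : ℝ, u = R * Real.sin θ ∧ v = R * Real.cos θ := by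
  set z : ℂ := ⟨v, u⟩ with hz
  have hn : ‖z‖ = R := by
    rw [Complex.norm_def, Complex.normSq_mk, ← pow_two, ← pow_two, add_comm, h, Real.sqrt_sq hR]
  refine ⟨z.arg, ?_, ?_⟩
  · rw [← hn, Complex.norm_mul_sin_arg]
  · rw [← hn, Complex.norm_mul_cos_arg]

theorem clm_apply_eq (L : ℝ × ℝ →L[ℝ] ℝ) (v : ℝ × ℝ) : L v = L (1, 0) * v.1 + L (0, 1) * v.2 := by
  have : v = v.1 • ((1, 0) : ℝ × ℝ) + v.2 • ((0, 1) : ℝ × ℝ) := by ext <;> simp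
  conv_lhs => rw [this]
  rw [map_add, map_smul, map_smul, smul_eq_mul, smul_eq_mul]
  ring

namespace IsKinetic

variable {A : ℝ → ℝ} {κ : ℝ × ℝ → ℝ} {ωs δ α : ℝ}

theorem strictMonoOn_momentum (h : IsKinetic A κ ωs δ α) {ω : ℝ}
    (hω : ω ∈ Set.Ioo (ωs - δ) (ωs + δ)) :
    StrictMonoOn (fun l => l * √(2 * κ (ω, l))) (Set.Ioo (-δ) δ) := by
  have hd : ∀ l ∈ Set.Ioo (-δ) δ, HasDerivAt (fun l => l * √(2 * κ (ω, l)))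
      (fderiv ℝ (fun p : ℝ × ℝ => p.2 * √(2 * κ p)) (ω, l) (0, 1)) l := fun l hl =>
    hasDerivAt_comp_mk_snd (p := (ω, l))
      ((h.contDiffOn_momentum.differentiableOn one_ne_zero).differentiableAt
        ((isOpen_box ωs δ).mem_nhds ⟨hω, hl⟩)).hasFDerivAt
  refine strictMonoOn_of_deriv_pos (convex_Ioo _ _)
    (fun l hl => (hd l hl).continuousAt.continuousWithinAt) fun l hl => ?_
  rw [interior_Ioo] at hl
  rw [(hd l hl).deriv]
  have := Real.sqrt_pos.2 h.pos
  linarith [(h.momentum_slope (p := (ω, l)) ⟨hω, hl⟩).1]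

/-- Intermediate values between `λ = -δ/2` and `λ = δ/2`, where `2 κ λ² ≥ δ² α/8`. -/
theorem exists_momentum_eq (h : IsKinetic A κ ωs δ α) {ω z : ℝ}
    (hω : ω ∈ Set.Ioo (ωs - δ) (ωs + δ)) (hz : z ^ 2 < δ ^ 2 * α / 8) :
    ∃ l ∈ Set.Ioo (-δ) δ, l * √(2 * κ (ω, l)) = z := by
  have hδ : 0 < δ := by linarith [hω.1, hω.2]
  have hα := h.pos
  have hcont : ContinuousOn (fun l => l * √(2 * κ (ω, l))) (Set.Ioo (-δ) δ) := by
    refine h.contDiffOn_momentum.continuousOn.comp (f := fun l => (ω, l))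
      (by fun_prop) fun l hl => ⟨hω, hl⟩
  have hbig : ∀ l ∈ Set.Ioo (-δ) δ, l ^ 2 = δ ^ 2 / 4 → z ^ 2 ≤ (l * √(2 * κ (ω, l))) ^ 2 := by
    intro l hl hl2
    have hk := h.lower (ω, l) ⟨hω, hl⟩
    rw [mul_pow, Real.sq_sqrt (by linarith), hl2]
    have : 0 < δ ^ 2 := by positivity
    nlinarith
  have h1 : δ / 2 ∈ Set.Ioo (-δ) δ := ⟨by linarith, by linarith⟩
  have h2 : -(δ / 2) ∈ Set.Ioo (-δ) δ := ⟨by linarith, by linarith⟩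
  refine isPreconnected_Ioo.intermediate_value h2 h1 hcont ⟨?_, ?_⟩
  · have h3 : z ^ 2 ≤ ((δ / 2) * √(2 * κ (ω, -(δ / 2)))) ^ 2 := by
      refine (hbig _ h2 (by ring)).trans_eq (by ring)
    have := (abs_le_of_sq_le_sq' h3 (by positivity)).1
    linarith
  · exact (abs_le_of_sq_le_sq' (hbig _ h1 (by ring)) (by positivity)).2

end IsKinetic

/-- The Hamiltonian field of `H` for the symplectic form `A(ω) dω ∧ dλ`. -/
noncomputable def hamiltonianField (A : ℝ → ℝ) (H : ℝ × ℝ → ℝ) (p : ℝ × ℝ) : ℝ × ℝ :=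
  ((A p.1)⁻¹ * deriv (fun l => H (p.1, l)) p.2, -(A p.1)⁻¹ * deriv (fun ω => H (ω, p.2)) p.1)

/-- If `H = y²/2 + μ²/2` up to a constant, with `y` a function of `ω` only, then the Hamiltonian
field is a rotation in the coordinates `(y, μ)`. -/
theorem triangular_apply_hamiltonianField {A y : ℝ → ℝ} {H μ : ℝ × ℝ → ℝ} {p : ℝ × ℝ} {D C : ℝ}
    {μ' : ℝ × ℝ →L[ℝ] ℝ} (hy : HasDerivAt y D p.1) (hμ : HasFDerivAt μ μ' p)
    (hH : ∀ᶠ p' in 𝓝 p, H p' = C + y p'.1 ^ 2 / 2 + μ p' ^ 2 / 2) :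
    (D * (hamiltonianField A H p).1,
      μ' (1, 0) * (hamiltonianField A H p).1 + μ' (0, 1) * (hamiltonianField A H p).2)
      = ((A p.1)⁻¹ * D * μ' (0, 1)) • (μ p, -y p.1) := by
  have h1 : HasDerivAt (fun l => H (p.1, l)) (μ p * μ' (0, 1)) p.2 := by
    have hc : Tendsto (fun l : ℝ => (p.1, l)) (𝓝 p.2) (𝓝 p) :=
      (by fun_prop : Continuous fun l : ℝ => (p.1, l)).tendsto' _ _ rfl
    have h3 := (((hasDerivAt_comp_mk_snd hμ).pow 2).div_const 2).const_add (C + y p.1 ^ 2 / 2)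
    refine (h3.congr_of_eventuallyEq ?_).congr_deriv ?_
    · filter_upwards [hc.eventually hH] with l hl
      rw [hl]; rfl
    · simp only [Nat.cast_ofNat, Nat.add_one_sub_one, pow_one, Prod.mk.eta]
      ring
  have h2 : HasDerivAt (fun ω => H (ω, p.2)) (y p.1 * D + μ p * μ' (1, 0)) p.1 := by
    have hc : Tendsto (fun ω : ℝ => (ω, p.2)) (𝓝 p.1) (𝓝 p) :=
      (by fun_prop : Continuous fun ω : ℝ => (ω, p.2)).tendsto' _ _ rfl
    have h3 := (((hy.pow 2).div_const 2).const_add C).add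
      (((hasDerivAt_comp_mk_fst hμ).pow 2).div_const 2)
    refine (h3.congr_of_eventuallyEq ?_).congr_deriv ?_
    · filter_upwards [hc.eventually hH] with l hl
      rw [hl]; rfl
    · simp only [Nat.cast_ofNat, Nat.add_one_sub_one, pow_one, Prod.mk.eta]
      ring
  simp only [hamiltonianField, h1.deriv, h2.deriv]
  ext <;> simp only [Prod.smul_mk, smul_eq_mul] <;> ring

namespace IsWell

variable {q q₁ q₂ d : ℝ → ℝ} {ωs δ m M : ℝ}

/-- The height of the barrier in terms of its width. -/
theorem barrier_height (h : IsWell q q₁ q₂ d ωs δ m M) {Q a b : ℝ}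
    (ha : a ∈ Set.Ioo (ωs - δ) (ωs + δ)) (hb : b ∈ Set.Ioo (ωs - δ) (ωs + δ)) (hab : a < b)
    (hqa : q a = Q) (hqb : q b = Q) :
    potential d Q a - potential d Q b ≤ M / 12 * (b - a) ^ 3 := by
  have := (h.potential_bounds ha hb hab hqa hqb ha le_rfl).2
  refine this.trans_eq ?_
  ring

/-- Beyond a fixed multiple of its width the well is deeper than the barrier. -/
theorem barrier_le_potential (h : IsWell q q₁ q₂ d ωs δ m M) {Q a b x : ℝ}
    (ha : a ∈ Set.Ioo (ωs - δ) (ωs + δ)) (hb : b ∈ Set.Ioo (ωs - δ) (ωs + δ)) (hab : a < b)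
    (hqa : q a = Q) (hqb : q b = Q) (hx : x ∈ Set.Ioo (ωs - δ) (ωs + δ))
    (hbx : M / m * (b - a) ≤ x - b) :
    potential d Q a - potential d Q b ≤ potential d Q x - potential d Q b := by
  have hm := h.m_pos
  have hmM := h.m_le_M (by linarith [ha.1, ha.2] : 0 < δ)
  have hM := hm.trans_le hmM
  have hK : 1 ≤ M / m := (one_le_div hm).2 hmM
  have hw : 0 < b - a := by linarith
  have hwx : b - a ≤ x - b := le_trans (by nlinarith) hbx
  refine (h.barrier_height ha hb hab hqa hqb).trans ?_
  refine le_trans ?_ (h.potential_bounds ha hb hab hqa hqb hx (by linarith)).1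
  rw [div_mul_eq_mul_div, div_le_iff₀ hm] at hbx
  set w := b - a
  set s := x - b
  have h1 : M * w ^ 3 ≤ m * (s * w ^ 2) := by nlinarith [sq_nonneg w]
  have h2 : s * w ^ 2 ≤ s ^ 2 * w := by nlinarith [mul_pos (hw.trans_le hwx) hw]
  have h3 : 0 ≤ s ^ 2 * s := by
    have : 0 < s := hw.trans_le hwx
    positivity
  have h4 : 0 ≤ s ^ 2 * w := by positivity
  nlinarith [mul_le_mul_of_nonneg_left h2 hm.le, mul_nonneg hm.le h3, mul_nonneg hm.le h4]

variable {A : ℝ → ℝ} {κ : ℝ × ℝ → ℝ} {α : ℝ}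

set_option maxHeartbeats 1000000 in
/-- In the well the reduced system is a rotation on every level set of the energy below the
barrier. -/
theorem exists_rotationChart (h : IsWell q q₁ q₂ d ωs δ m M) (hk : IsKinetic A κ ωs δ α)
    (hδ : 0 < δ) {Q a b η E : ℝ} (haη : ωs - η < a) (has : a < ωs) (hsb : ωs < b) (hbη : b < ωs + η)
    (hqa : q a = Q) (hqb : q b = Q) (hη : (1 + 2 * (M / m)) * η ≤ δ) (hη' : 8 * M * η ≤ 3 * α)
    (hE : 0 < E) (hEh : E < potential d Q a - potential d Q b) :
    ∃ (Φ : ℝ × ℝ → ℝ × ℝ) (Φ' : ℝ × ℝ → (ℝ × ℝ) ≃L[ℝ] (ℝ × ℝ)) (F : ℝ × ℝ → ℝ) (P : ℝ → ℝ × ℝ)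
      (D : ℝ → ℝ),
      IsRotationChart (Set.Ioo a (ωs + δ) ×ˢ Set.Ioo (-δ) δ) Φ Φ'
        (hamiltonianField A fun p => potential d Q p.1 + p.2 ^ 2 * κ p) F √(2 * E) P ∧
      (∀ θ, potential d Q (P θ).1 - potential d Q b ≤ E) ∧
      (∀ p ∈ Set.Ioo a (ωs + δ) ×ˢ Set.Ioo (-δ) δ,
        potential d Q p.1 + p.2 ^ 2 * κ p - potential d Q b = E → ∃ θ, P θ = p) ∧
      D b ^ 2 = q₁ b ∧
      (∀ x ∈ Set.Ioo a (ωs + δ), 0 < D x ∧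
        D x ^ 2 * (2 * (potential d Q x - potential d Q b)) = (q x - Q) ^ 2) ∧
      ∀ p ∈ Set.Ioo a (ωs + δ) ×ˢ Set.Ioo (-δ) δ,
        1 / (4 * √α) * D p.1 ≤ F p ∧ F p ≤ 4 / √α * D p.1 := by
  have hm := h.m_pos
  have hη0 : 0 < η := by linarith
  have hα := hk.pos
  have hab : a < b := has.trans hsb
  have hmM := h.m_le_M hδ
  have hM := hm.trans_le hmM
  have hK : 1 ≤ M / m := (one_le_div hm).2 hmM
  have hηδ : 3 * η ≤ δ := by nlinarith
  have ha : a ∈ Set.Ioo (ωs - δ) (ωs + δ) := ⟨by linarith, by linarith⟩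
  have hb : b ∈ Set.Ioo (ωs - δ) (ωs + δ) := ⟨by linarith, by linarith⟩
  have hsub : Set.Ioo a (ωs + δ) ⊆ Set.Ioo (ωs - δ) (ωs + δ) := fun x hx =>
    ⟨ha.1.trans hx.1, hx.2⟩
  have hb' : b ∈ Set.Ioo a (ωs + δ) := ⟨hab, hb.2⟩
  obtain ⟨hin, hout⟩ := h.quadratic_bounds ha hb hab hqa hqb
  -- The minimum at `b` is nondegenerate because `b` lies to the right of `ωs`, so that `q₁ b ≥ m (b
  -- - ωs) > 0`.
  obtain ⟨y, D, hDc, hDb, hy⟩ := exists_signed_sqrt (V := fun x => potential d Q x - potential d Q b)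
    (V' := fun x => q x - Q) (k := q₁ b) hb'
    (fun x hx => (h.hasDerivAt_potential Q (hsub hx)).sub_const _)
    (fun x hx => ((h.hasDeriv_q x (hsub hx)).sub_const Q).continuousAt.continuousWithinAt)
    ((h.hasDeriv_q b hb).sub_const Q)
    (by
      have := (h.q₁_sub_bounds (a := ωs) (b := b) ⟨by linarith, by linarith⟩ hb hsb.le).1
      rw [h.crit, sub_zero] at this
      exact lt_of_lt_of_le (mul_pos hm (by linarith)) this)
    (sub_self _) (by rw [hqb, sub_self])
    (fun x hx hxb => lt_of_le_of_lt (hin x ⟨hx.1.le, hxb.le⟩).2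
      (mul_neg_of_pos_of_neg (by positivity)
        (mul_neg_of_pos_of_neg (by linarith [hx.1]) (by linarith))))
    (fun x hx hxb => lt_of_lt_of_le
      (mul_pos (by positivity) (mul_pos (by linarith [hx.1]) (by linarith)))
      (hout x (hsub hx) hxb.le).1)
  set U := Set.Ioo a (ωs + δ) ×ˢ Set.Ioo (-δ) δ with hU
  have hUo : IsOpen U := isOpen_Ioo.prod isOpen_Ioo
  have hUbox : U ⊆ box ωs δ := fun p hp => ⟨hsub hp.1, hp.2⟩
  set H : ℝ × ℝ → ℝ := fun p => potential d Q p.1 + p.2 ^ 2 * κ p with hH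
  set μ : ℝ × ℝ → ℝ := fun p => p.2 * √(2 * κ p) with hμ
  have hκ0 : ∀ p ∈ U, 0 < κ p := fun p hp => by linarith [hk.lower p (hUbox hp)]
  have hμ2 : ∀ p ∈ U, μ p ^ 2 = 2 * (p.2 ^ 2 * κ p) := fun p hp => by
    rw [hμ]
    simp only [mul_pow]
    rw [Real.sq_sqrt (by linarith [hκ0 p hp])]
    ring
  have hHeq : ∀ p ∈ U, H p = potential d Q b + y p.1 ^ 2 / 2 + μ p ^ 2 / 2 := fun p hp => by
    rw [hμ2 p hp, (hy p.1 hp.1).2.2.1]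
    simp only [hH]
    ring
  have hμs : ∀ p ∈ U, HasStrictFDerivAt μ (fderiv ℝ μ p) p := fun p hp =>
    (hk.contDiffOn_momentum.contDiffAt ((isOpen_box ωs δ).mem_nhds (hUbox hp))).hasStrictFDerivAt
      one_ne_zero
  have hμc : ContinuousOn (fun p => fderiv ℝ μ p (0, 1)) U :=
    ((hk.contDiffOn_momentum.continuousOn_fderiv_of_isOpen (isOpen_box ωs δ) le_rfl).mono
      hUbox).clm_apply continuousOn_const
  have hslope := fun p (hp : p ∈ U) => hk.momentum_slope (hUbox hp)
  have hsα : 0 < √α := Real.sqrt_pos.2 hα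
  have hys : ∀ x ∈ Set.Ioo a (ωs + δ), HasStrictDerivAt y (D x) x := fun x hx =>
    hasStrictDerivAt_of_hasDerivAt_of_continuousAt
      (by filter_upwards [Ioo_mem_nhds hx.1 hx.2] with z hz using (hy z hz).1)
      (hDc.continuousAt (Ioo_mem_nhds hx.1 hx.2))
  have hequiv : ∀ p, ∃ L : (ℝ × ℝ) ≃L[ℝ] (ℝ × ℝ), p ∈ U → ∀ v,
      L v = (D p.1 * v.1, fderiv ℝ μ p (1, 0) * v.1 + fderiv ℝ μ p (0, 1) * v.2) := by
    intro p
    by_cases hp : p ∈ U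
    · obtain ⟨L, hL⟩ := exists_triangular_equiv (fderiv ℝ μ p (1, 0)) (hy p.1 hp.1).2.1.ne'
        (lt_of_lt_of_le (by positivity) (hslope p hp).1).ne'
      exact ⟨L, fun _ => hL⟩
    · exact ⟨ContinuousLinearEquiv.refl ℝ _, fun hp' => absurd hp' hp⟩
  choose Φ' hΦ' using hequiv
  have hymono : StrictMonoOn y (Set.Ioo a (ωs + δ)) := by
    refine strictMonoOn_of_deriv_pos (convex_Ioo _ _)
      (fun x hx => (hy x hx).1.continuousAt.continuousWithinAt) fun x hx => ?_
    rw [interior_Ioo] at hx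
    rw [(hy x hx).1.deriv]
    exact (hy x hx).2.1
  -- The level closes up on both sides: near `a` the potential exceeds `E` because `E` is below the
  -- barrier, and at `b + (M/m)(b - a)` it is again at least the barrier height. The condition `(1 +
  -- 2M/m) η ≤ δ` keeps that point inside the interval.
  have hysurj : ∀ z : ℝ, z ^ 2 ≤ 2 * E → ∃ x ∈ Set.Ioo a (ωs + δ), y x = z := by
    intro z hz
    obtain ⟨x₁, hx₁, hx₁b, hVx₁⟩ : ∃ x₁ ∈ Set.Ioo a (ωs + δ), x₁ < b ∧
        E < potential d Q x₁ - potential d Q b := by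
      have hc : ContinuousAt (fun x => potential d Q x - potential d Q b) a :=
        ((h.hasDerivAt_potential Q ha).sub_const _).continuousAt
      have h1 := (hc.eventually (eventually_gt_nhds hEh)).filter_mono
        (nhdsWithin_le_nhds (s := Set.Ioi a))
      obtain ⟨x, hx1, hx2⟩ := (h1.and (Ioo_mem_nhdsGT hab)).exists
      exact ⟨x, ⟨hx2.1, by linarith [hx2.2, hb.2]⟩, hx2.2, hx1⟩
    have hx₂ : b + M / m * (b - a) ∈ Set.Ioo a (ωs + δ) := by
      have hw : b - a < 2 * η := by linarith
      have hw0 : 0 < b - a := by linarith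
      have : M / m * (b - a) < M / m * (2 * η) := mul_lt_mul_of_pos_left hw (by linarith)
      constructor
      · nlinarith
      · nlinarith
    have hV₂ := h.barrier_le_potential ha hb hab hqa hqb (hsub hx₂) (by linarith)
    have hx₂b : b < b + M / m * (b - a) := by
      have : 0 < M / m * (b - a) := mul_pos (by linarith) (by linarith)
      linarith
    refine isPreconnected_Ioo.intermediate_value hx₁ hx₂
      (fun x hx => (hy x hx).1.continuousAt.continuousWithinAt) ⟨?_, ?_⟩
    · obtain ⟨-, -, h2, -, -, h3⟩ := hy _ hx₁
      have h4 : z ^ 2 ≤ (-y x₁) ^ 2 := by rw [neg_sq, h2]; linarith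
      have := (abs_le_of_sq_le_sq' h4 (by linarith [h3 hx₁b])).1
      linarith
    · obtain ⟨-, -, h2, -, h3, -⟩ := hy _ hx₂
      exact (abs_le_of_sq_le_sq' (by rw [h2]; linarith) (h3 hx₂b).le).2
  -- With `w = b - a < 2η`, the condition `8 M η ≤ 3 α` gives `M w < 3 α/4`, so `2E < M w³/6` is
  -- below `δ² α/8`, the range reached by the momentum.
  have hE' : 2 * E < δ ^ 2 * α / 8 := by
    have h1 := h.barrier_height ha hb hab hqa hqb
    have hw0 : 0 < b - a := by linarith
    have hw : b - a < 2 * η := by linarith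
    set w := b - a
    have h2 : M * w < 3 * α / 4 := by nlinarith
    have h3 : w ^ 2 ≤ δ ^ 2 := pow_le_pow_left₀ hw0.le (by linarith) 2
    have h4 : 0 < w ^ 2 := by positivity
    nlinarith
  have hR : √(2 * E) ^ 2 = 2 * E := Real.sq_sqrt (by positivity)
  have hP : ∀ θ : ℝ, ∃ p ∈ U, y p.1 = √(2 * E) * Real.sin θ ∧ μ p = √(2 * E) * Real.cos θ := by
    intro θ
    have hsc := Real.sin_sq_add_cos_sq θ
    obtain ⟨x, hx, hyx⟩ := hysurj (√(2 * E) * Real.sin θ) (by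
      rw [mul_pow, hR]; nlinarith [sq_nonneg (Real.cos θ)])
    obtain ⟨l, hl, hμl⟩ := hk.exists_momentum_eq (hsub hx) (z := √(2 * E) * Real.cos θ) (by
      rw [mul_pow, hR]; nlinarith [sq_nonneg (Real.sin θ)])
    exact ⟨(x, l), ⟨hx, hl⟩, hyx, hμl⟩
  choose P hPU hPy hPμ using hP
  have hinj : Set.InjOn (fun p : ℝ × ℝ => (y p.1, μ p)) U := by
    rintro ⟨x, l⟩ hp ⟨x', l'⟩ hp' heq
    obtain ⟨h1, h2⟩ := Prod.ext_iff.1 heq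
    obtain rfl : x = x' := hymono.injOn hp.1 hp'.1 h1
    obtain rfl : l = l' := (hk.strictMonoOn_momentum (hsub hp.1)).injOn hp.2 hp'.2 h2
    rfl
  have hAb := fun p (hp : p ∈ U) => And.intro (hk.weight_lower p.1 (hsub hp.1))
    (hk.weight_upper p.1 (hsub hp.1))
  -- The momentum slope lies in `[√α/2, 2√α]` and `A` in `[α/2, 2α]`; the extreme quotients are
  -- `1/(4√α)` and `4/√α`.
  have hF : ∀ p ∈ U, 1 / (4 * √α) * D p.1 ≤ (A p.1)⁻¹ * D p.1 * fderiv ℝ μ p (0, 1) ∧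
      (A p.1)⁻¹ * D p.1 * fderiv ℝ μ p (0, 1) ≤ 4 / √α * D p.1 := by
    intro p hp
    have hD := (hy p.1 hp.1).2.1
    obtain ⟨hA1, hA2⟩ := hAb p hp
    obtain ⟨hs1, hs2⟩ := hslope p hp
    have hA0 : 0 < A p.1 := by linarith
    have hsq : √α ^ 2 = α := Real.sq_sqrt hα.le
    set s := √α
    set μ₂ := fderiv ℝ μ p (0, 1)
    have e1 : (A p.1)⁻¹ * D p.1 * μ₂ = μ₂ / A p.1 * D p.1 := by
      rw [div_eq_mul_inv]; ring
    rw [e1]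
    constructor
    · refine mul_le_mul_of_nonneg_right ?_ hD.le
      rw [div_le_div_iff₀ (by positivity) hA0]
      nlinarith
    · refine mul_le_mul_of_nonneg_right ?_ hD.le
      rw [div_le_div_iff₀ hA0 hsα]
      nlinarith
  refine ⟨fun p => (y p.1, μ p), Φ', fun p => (A p.1)⁻¹ * D p.1 * fderiv ℝ μ p (0, 1), P, D,
    ⟨hUo, fun p hp => ?_, hinj, ?_, fun p hp => ?_, fun p hp => ?_, Real.sqrt_pos.2 (by positivity),
      hPU, fun θ => by rw [hPy, hPμ]⟩, fun θ => ?_, fun p hp hpE => ?_, hDb, fun x hx => ?_, hF⟩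
  · have h1 : HasStrictFDerivAt (fun p : ℝ × ℝ => y p.1)
        (D p.1 • ContinuousLinearMap.fst ℝ ℝ ℝ) p :=
      (hys p.1 hp.1).comp_hasStrictFDerivAt p hasStrictFDerivAt_fst
    refine (h1.prodMk (hμs p hp)).congr_fderiv ?_
    refine ContinuousLinearMap.ext fun v => ?_
    rw [ContinuousLinearEquiv.coe_coe, hΦ' p hp v, ContinuousLinearMap.prod_apply,
      clm_apply_eq (fderiv ℝ μ p) v]
    simp
  · refine ContinuousOn.mul (ContinuousOn.mul (ContinuousOn.inv₀ ?_ fun p hp => ?_) ?_) hμc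
    · exact hk.cont.comp continuousOn_fst fun p hp => hsub hp.1
    · exact (by linarith [(hAb p hp).1] : 0 < A p.1).ne'
    · exact hDc.comp continuousOn_fst fun p hp => hp.1
  · exact lt_of_lt_of_le (mul_pos (by positivity) (hy p.1 hp.1).2.1) (hF p hp).1
  · rw [hΦ' p hp]
    refine triangular_apply_hamiltonianField (C := potential d Q b) (hy p.1 hp.1).1
      (hμs p hp).hasFDerivAt ?_
    filter_upwards [hUo.mem_nhds hp] with p' hp' using hHeq p' hp'
  · have h1 := (hy _ (hPU θ).1).2.2.1
    rw [hPy, mul_pow, hR] at h1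
    nlinarith [Real.sin_sq_add_cos_sq θ, sq_nonneg (Real.cos θ)]
  · obtain ⟨θ, h1, h2⟩ := exists_angle (u := y p.1) (v := μ p) (Real.sqrt_nonneg (2 * E)) (by
      have := hHeq p hp
      simp only [hH] at this
      rw [hR]
      linarith)
    refine ⟨θ, hinj (hPU θ) hp ?_⟩
    simp only
    rw [hPy, hPμ, ← h1, ← h2]
  · obtain ⟨-, h1, h2, h3, -⟩ := hy x hx
    refine ⟨h1, ?_⟩
    rw [← h2, ← h3]
    ring

end IsWell

end NLSOscillation

/-! ### The size of the period and the conclusion -/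

namespace NLSOscillation

open Filter Topology Function

namespace IsWell

variable {q q₁ q₂ d : ℝ → ℝ} {ωs δ m M : ℝ}

/-- Below the fraction `c` of the barrier, the speed in the well is comparable to
`(Q - q(ωs))^{1/4}`. -/
theorem speed_comparable (h : IsWell q q₁ q₂ d ωs δ m M) (hδ : 0 < δ) {c : ℝ} (hc : 0 < c)
    (hc1 : c < 1) :
    ∃ B₁ > 0, ∃ B₂ > 0, ∀ Q a b : ℝ, 0 < Q - q ωs → a ∈ Set.Ioo (ωs - δ) (ωs + δ) →
      b ∈ Set.Ioo (ωs - δ) (ωs + δ) → a < ωs → ωs < b → q a = Q → q b = Q →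
      ∀ x ∈ Set.Ioo (ωs - δ) (ωs + δ), a < x →
      potential d Q x - potential d Q b < c * (potential d Q a - potential d Q b) →
      ∀ D : ℝ, 0 < D → (x = b → D ^ 2 = q₁ b) →
        D ^ 2 * (2 * (potential d Q x - potential d Q b)) = (q x - Q) ^ 2 →
        B₁ * (Q - q ωs) ^ (1 / 4 : ℝ) ≤ D ∧ D ≤ B₂ * (Q - q ωs) ^ (1 / 4 : ℝ) := by
  have hm := h.m_pos
  have hmM := h.m_le_M hδ
  have hM := hm.trans_le hmM
  set K := M / m with hKdef
  have hK : 1 ≤ K := (one_le_div hm).2 hmM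
  have hK0 : 0 < K := by linarith
  obtain ⟨C₁, hC₁, C₂, hC₂, hsp⟩ := h.speed_bounds hc hc1 hK0
  set c₁ := min C₁ (m / (1 + K)) with hc₁
  set c₂ := max C₂ M with hc₂
  have hc₁0 : 0 < c₁ := lt_min hC₁ (by positivity)
  have hc₂0 : 0 < c₂ := lt_max_of_lt_right hM
  have hroot : ∀ z : ℝ, 0 < z → (z ^ (1 / 4 : ℝ)) ^ 4 = z := fun z hz => by
    rw [← Real.rpow_natCast, ← Real.rpow_mul hz.le]
    norm_num
  -- With `w = b - a` and `u = Q - q ωs`, `D²` lies in `[c₁ w, c₂ w]` and `w²` in `[2u/M, 8u/m]`, so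
  -- the bounds are proved for `D⁴`. The terms `m/(1 + K)` and `M` inside `c₁` and `c₂` cover `x =
  -- b`, where the identity for `D` degenerates.
  refine ⟨(c₁ ^ 2 * (2 / M)) ^ (1 / 4 : ℝ), by positivity,
    (c₂ ^ 2 * (8 / m)) ^ (1 / 4 : ℝ), by positivity, ?_⟩
  intro Q a b hQ ha hb has hsb hqa hqb x hx hax hlt D hD hDb hDx
  have hab : a < b := has.trans hsb
  obtain ⟨ha1, ha2⟩ := h.root_bounds ha hqa
  obtain ⟨hb1, hb2⟩ := h.root_bounds hb hqb
  set u := Q - q ωs with hu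
  have hDw : c₁ * (b - a) ≤ D ^ 2 ∧ D ^ 2 ≤ c₂ * (b - a) := by
    have hw : 0 < b - a := by linarith
    by_cases hxb : x = b
    · rw [hDb hxb]
      have hs : ωs ∈ Set.Ioo (ωs - δ) (ωs + δ) := ⟨by linarith, by linarith⟩
      obtain ⟨h1, h2⟩ := h.q₁_sub_bounds hs hb hsb.le
      rw [h.crit, sub_zero] at h1 h2
      -- Both roots have squared distance to `ωs` comparable to `u`, so `b - ωs`, which controls `q₁
      -- b`, is comparable to the full width.
      have h3 : ωs - a ≤ K * (b - ωs) := by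
        refine le_of_sq_le_sq ?_ (mul_nonneg hK0.le (by linarith))
        have e1 : 2 / m * u = K * (2 / M * u) := by rw [hKdef]; field_simp
        have h4 : (ωs - a) ^ 2 ≤ K * (b - ωs) ^ 2 := by
          calc (ωs - a) ^ 2 = (a - ωs) ^ 2 := by ring
            _ ≤ K * (2 / M * u) := by rw [← e1]; exact ha2
            _ ≤ K * (b - ωs) ^ 2 := by gcongr
        have : 0 ≤ (b - ωs) ^ 2 := sq_nonneg _
        rw [mul_pow]
        nlinarith [mul_nonneg (mul_nonneg hK0.le (by linarith : 0 ≤ K - 1)) this]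
      constructor
      · calc c₁ * (b - a) ≤ m / (1 + K) * (b - a) := by gcongr; exact min_le_right _ _
          _ ≤ m / (1 + K) * ((1 + K) * (b - ωs)) := by gcongr; linarith
          _ = m * (b - ωs) := by field_simp
          _ ≤ q₁ b := h1
      · calc q₁ b ≤ M * (b - ωs) := h2
          _ ≤ M * (b - a) := by gcongr
          _ ≤ c₂ * (b - a) := by gcongr; exact le_max_right _ _
    · have hh : 0 < potential d Q a - potential d Q b := by
        refine lt_of_lt_of_le ?_ (h.potential_bounds ha hb hab hqa hqb ha le_rfl).1
        have e1 : m / 2 * ((a - b) ^ 2 * ((b - a) / 2 + (a - b) / 3)) = m / 12 * (b - a) ^ 3 := by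
          ring
        rw [e1]
        positivity
      -- Further out the potential would exceed the whole barrier, contrary to `c < 1`.
      have hxK : x - b ≤ K * (b - a) := by
        by_contra hcon
        have := h.barrier_le_potential ha hb hab hqa hqb hx (not_le.1 hcon).le
        nlinarith
      obtain ⟨h1, h2⟩ := hsp Q a b ha hb hab hqa hqb x hx hax hxb hxK hlt D hDx
      constructor
      · refine le_trans ?_ h1
        gcongr
        exact min_le_left _ _
      · refine h2.trans ?_
        gcongr
        exact le_max_left _ _
  have hw0 : 0 < b - a := by linarith
  have hwl : 2 / M * u ≤ (b - a) ^ 2 := hb1.trans (pow_le_pow_left₀ (by linarith) (by linarith) 2)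
  have hwu : (b - a) ^ 2 ≤ 8 / m * u := by
    have e1 : 8 / m * u = 2 * (2 / m * u) + 2 * (2 / m * u) := by ring
    have e2 : (b - a) ^ 2 = 2 * (b - ωs) ^ 2 + 2 * (a - ωs) ^ 2 - ((b - ωs) + (a - ωs)) ^ 2 := by
      ring
    linarith [sq_nonneg ((b - ωs) + (a - ωs))]
  have hD4 : D ^ 4 = (D ^ 2) ^ 2 := by ring
  constructor
  · refine (pow_le_pow_iff_left₀ (by positivity) hD.le (by norm_num : (4 : ℕ) ≠ 0)).1 ?_
    rw [mul_pow, hroot _ hQ, hroot _ (by positivity), hD4, mul_assoc]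
    calc c₁ ^ 2 * (2 / M * u) ≤ c₁ ^ 2 * (b - a) ^ 2 := by gcongr
      _ = (c₁ * (b - a)) ^ 2 := by ring
      _ ≤ (D ^ 2) ^ 2 := pow_le_pow_left₀ (by positivity) hDw.1 2
  · refine (pow_le_pow_iff_left₀ hD.le (by positivity) (by norm_num : (4 : ℕ) ≠ 0)).1 ?_
    rw [mul_pow, hroot _ hQ, hroot _ (by positivity), hD4, mul_assoc]
    calc (D ^ 2) ^ 2 ≤ (c₂ * (b - a)) ^ 2 := pow_le_pow_left₀ (by positivity) hDw.2 2
      _ = c₂ ^ 2 * (b - a) ^ 2 := by ring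
      _ ≤ c₂ ^ 2 * (8 / m * u) := by gcongr

/-- Periodic motion in the well, with a two-sided bound on the least period. -/
theorem exists_unique_periodic (h : IsWell q q₁ q₂ d ωs δ m M) (hδ : 0 < δ) {A : ℝ → ℝ} {α c : ℝ}
    (hα : 0 < α) (hc : 0 < c) (hc1 : c < 1) :
    ∃ C > 0, ∀ (κ : ℝ × ℝ → ℝ) (Q a b η : ℝ) (p : ℝ × ℝ), IsKinetic A κ ωs δ α →
      0 < Q - q ωs → ωs - η < a → a < ωs → ωs < b → b < ωs + η → q a = Q → q b = Q →
      (1 + 2 * (M / m)) * η ≤ δ → 8 * M * η ≤ 3 * α → p ∈ box ωs δ → a < p.1 →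
      0 < potential d Q p.1 + p.2 ^ 2 * κ p - potential d Q b →
      potential d Q p.1 + p.2 ^ 2 * κ p - potential d Q b
        < c * (potential d Q a - potential d Q b) →
      ∃ γ : ℝ → ℝ × ℝ, γ 0 = p ∧
        (∀ t, HasDerivAt γ
          (hamiltonianField A (fun p => potential d Q p.1 + p.2 ^ 2 * κ p) (γ t)) t) ∧
        (∀ γ' : ℝ → ℝ × ℝ, γ' 0 = p → (∀ t, HasDerivAt γ'
          (hamiltonianField A (fun p => potential d Q p.1 + p.2 ^ 2 * κ p) (γ' t)) t) → γ' = γ) ∧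
        ∃ T : ℝ, IsLeast {T : ℝ | 0 < T ∧ Periodic γ T} T ∧
          C⁻¹ * (Q - q ωs) ^ (-(1 / 4) : ℝ) ≤ T ∧ T ≤ C * (Q - q ωs) ^ (-(1 / 4) : ℝ) := by
  obtain ⟨B₁, hB₁, B₂, hB₂, hsp⟩ := h.speed_comparable hδ hc hc1
  have hsα : 0 < √α := Real.sqrt_pos.2 hα
  have hπ := Real.pi_pos
  set k₁ := 2 * Real.pi / (4 / √α * B₂) with hk₁
  set k₂ := 2 * Real.pi / (1 / (4 * √α) * B₁) with hk₂
  have hk₁0 : 0 < k₁ := by positivity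
  have hk₂0 : 0 < k₂ := by positivity
  -- The period lies between `k₁` and `k₂` times `(Q - q ωs)^(-1/4)`; the maximum lets one constant
  -- serve both bounds. It depends on `c` only through `B₁` and `B₂`.
  refine ⟨max k₂ k₁⁻¹, lt_max_of_lt_left hk₂0, ?_⟩
  intro κ Q a b η p hk hQ haη has hsb hbη hqa hqb hη hη' hp hap hE hEc
  have hm := h.m_pos
  have hmM := h.m_le_M hδ
  have hK : 1 ≤ M / m := (one_le_div hm).2 hmM
  have hη0 : 0 < η := by linarith
  have hηδ : η ≤ δ := by nlinarith
  have ha : a ∈ Set.Ioo (ωs - δ) (ωs + δ) := ⟨by linarith, by linarith⟩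
  have hb : b ∈ Set.Ioo (ωs - δ) (ωs + δ) := ⟨by linarith, by linarith⟩
  set E := potential d Q p.1 + p.2 ^ 2 * κ p - potential d Q b with hEdef
  have hh : 0 < potential d Q a - potential d Q b := by
    by_contra hcon
    have := mul_nonpos_of_nonneg_of_nonpos hc.le (not_lt.1 hcon)
    linarith
  have hEh : E < potential d Q a - potential d Q b := by nlinarith
  obtain ⟨Φ, Φ', F, P, D, hchart, hPE, hPsurj, hDb, hD, hF⟩ := h.exists_rotationChart hk hδ haη has
    hsb hbη hqa hqb hη hη' hE hEh
  obtain ⟨θ₀, rfl⟩ := hPsurj p ⟨⟨hap, hp.1.2⟩, hp.2⟩ rfl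
  set σ := (Q - q ωs) ^ (1 / 4 : ℝ) with hσ
  have hσ0 : 0 < σ := Real.rpow_pos_of_pos hQ _
  have hDσ : ∀ θ, B₁ * σ ≤ D (P θ).1 ∧ D (P θ).1 ≤ B₂ * σ := fun θ => by
    have hx := (hchart.mem θ).1
    exact hsp Q a b hQ ha hb has hsb hqa hqb (P θ).1 ⟨ha.1.trans hx.1, hx.2⟩ hx.1
      ((hPE θ).trans_lt hEc) _ (hD _ hx).1 (fun hxb => by rw [hxb]; exact hDb) (hD _ hx).2
  obtain ⟨γ, hγ0, hγ, huniq, T, hT, hT1, hT2⟩ := hchart.exists_unique_periodic (θ₀ := θ₀)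
    (f₁ := 1 / (4 * √α) * (B₁ * σ)) (f₂ := 4 / √α * (B₂ * σ)) (by positivity)
    (fun θ => le_trans (by gcongr; exact (hDσ θ).1) (hF _ (hchart.mem θ)).1)
    (fun θ => (hF _ (hchart.mem θ)).2.trans (by gcongr; exact (hDσ θ).2))
  refine ⟨γ, hγ0, hγ, huniq, T, hT, ?_, ?_⟩
  · rw [Real.rpow_neg hQ.le, ← hσ]
    have h1 : (max k₂ k₁⁻¹)⁻¹ ≤ k₁ := by
      rw [inv_le_comm₀ (lt_max_of_lt_left hk₂0) hk₁0]
      exact le_max_right _ _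
    calc (max k₂ k₁⁻¹)⁻¹ * σ⁻¹ ≤ k₁ * σ⁻¹ := by gcongr
      _ = 2 * Real.pi / (4 / √α * (B₂ * σ)) := by rw [hk₁]; field_simp
      _ ≤ T := hT1
  · rw [Real.rpow_neg hQ.le, ← hσ]
    calc T ≤ 2 * Real.pi / (1 / (4 * √α) * (B₁ * σ)) := hT2
      _ = k₂ * σ⁻¹ := by rw [hk₂]; field_simp
      _ ≤ max k₂ k₁⁻¹ * σ⁻¹ := by gcongr; exact le_max_left _ _

end IsWell

theorem isReducedSolution_iff {A d : ℝ → ℝ} {ωs : ℝ} {N : ℕ} {e : ℕ → ℝ → ℝ → ℝ → ℝ} {Q ω₀ l₀ : ℝ}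
    {γ : ℝ → ℝ × ℝ} :
    IsReducedSolution A d ωs N e Q ω₀ l₀ γ ↔ γ 0 = (ω₀, l₀) ∧ ∀ t, HasDerivAt γ
      (hamiltonianField A (fun p => potential d Q p.1 + p.2 ^ 2 * kinetic A N e Q p) (γ t)) t := by
  simp only [IsReducedSolution, finiteEnergy_eq, hamiltonianField]

/-- Near a nondegenerate minimum of `q` the functions `q` and `d` form a potential well. -/
theorem IsGroundStateFamily.eventually_isWell {g : ℝ → ℝ} {O : Set ℝ} {φ : ℝ → H1 ℝ}
    (hφ : IsGroundStateFamily g O φ) (hg : IsNonlinearity g) {ωs : ℝ} (hωs : ωs ∈ O)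
    (hq' : deriv (qFun φ) ωs = 0) (hq'' : 0 < deriv (deriv (qFun φ)) ωs) :
    ∀ᶠ δ in 𝓝[>] (0 : ℝ), Metric.ball ωs δ ⊆ O ∧
      IsWell (qFun φ) (deriv (qFun φ)) (deriv (deriv (qFun φ))) (dFun g φ) ωs δ
        (deriv (deriv (qFun φ)) ωs / 2) (2 * deriv (deriv (qFun φ)) ωs) := by
  set k := deriv (deriv (qFun φ)) ωs
  have hq := hφ.contDiffOn_qFun
  have hq1 : ContDiffOn ℝ 1 (deriv (qFun φ)) O :=
    ((contDiffOn_succ_iff_deriv_of_isOpen (n := 1) hφ.isOpen).1 hq).2.2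
  have hq2 : ContinuousOn (deriv (deriv (qFun φ))) O :=
    hq1.continuousOn_deriv_of_isOpen hφ.isOpen le_rfl
  have hO := hφ.isOpen.mem_nhds hωs
  have hc := hq2.continuousAt hO
  have hev : ∀ᶠ ω in 𝓝 ωs, ω ∈ O ∧ k / 2 ≤ deriv (deriv (qFun φ)) ω ∧
      deriv (deriv (qFun φ)) ω ≤ 2 * k := by
    filter_upwards [hO, hc.eventually (eventually_ge_nhds (by linarith : k / 2 < k)),
      hc.eventually (eventually_le_nhds (by linarith : k < 2 * k))] with ω h1 h2 h3
      using ⟨h1, h2, h3⟩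
  obtain ⟨ρ, hρ, hball⟩ := Metric.eventually_nhds_iff_ball.1 hev
  filter_upwards [Ioo_mem_nhdsGT hρ] with δ hδ
  have hsub : Metric.ball ωs δ ⊆ Metric.ball ωs ρ := Metric.ball_subset_ball hδ.2.le
  have hmem : ∀ ω ∈ Set.Ioo (ωs - δ) (ωs + δ), ω ∈ Metric.ball ωs ρ := fun ω hω =>
    hsub (by rwa [Real.ball_eq_Ioo])
  refine ⟨fun ω hω => (hball ω (hsub hω)).1, by linarith, fun ω hω => ?_, fun ω hω => ?_,
    fun ω hω => (hball ω (hmem ω hω)).2.1, fun ω hω => (hball ω (hmem ω hω)).2.2, hq',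
    fun ω hω => hφ.hasDerivAt_dFun hg (hball ω (hmem ω hω)).1⟩
  · exact ((hq.differentiableOn two_ne_zero).differentiableAt
      (hφ.isOpen.mem_nhds (hball ω (hmem ω hω)).1)).hasDerivAt
  · exact ((hq1.differentiableOn one_ne_zero).differentiableAt
      (hφ.isOpen.mem_nhds (hball ω (hmem ω hω)).1)).hasDerivAt

end NLSOscillation

open NLSOscillation in
theorem proposition2p8
    (g : ℝ → ℝ) (hg : IsNonlinearity g)
    (O : Set ℝ) (φ : ℝ → H1 ℝ) (hφ : IsGroundStateFamily g O φ)
    (ωs : ℝ) (hωs : ωs ∈ O)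
    (hq' : deriv (qFun φ) ωs = 0) (hq'' : 0 < deriv (deriv (qFun φ)) ωs)
    (r : ℝ) (hr : 0 < r) (hrO : Metric.ball ωs r ⊆ O)
    (Ψ₃ Ψ₄ : ℝ → H1 ℂ) (hΨ : IsFrame g φ ωs r Ψ₃ Ψ₄)
    (N : ℕ) (hN : 2 ≤ N)
    (e : ℕ → ℝ → ℝ → ℝ → ℝ) (he : IsCoefficients (qFun φ ωs) ωs N e) :
    ∃ δ > 0, ∃ ε₀ > 0, ∃ ωm ωp : ℝ → ℝ,
      Metric.ball ωs δ ⊆ O ∧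
      -- the two solutions `ω_- < ω_* < ω_+` of `q(ω) = Q` near `ω_*`
      (∀ Q : ℝ, 0 < Q - qFun φ ωs → Q - qFun φ ωs < ε₀ ^ 2 →
        ωm Q < ωs ∧ ωs < ωp Q ∧
        {ω : ℝ | |ω - ωs| < δ ∧ qFun φ ω = Q} = {ωm Q, ωp Q}) ∧
      ∀ c : ℝ, 0 < c → c < 1 → ∃ C > 0,
        ∀ Q : ℝ, 0 < Q - qFun φ ωs → Q - qFun φ ωs < ε₀ ^ 2 →
        ∀ ω₀ l₀ : ℝ, |ω₀ - ωs| < δ → |l₀| < δ → ωm Q < ω₀ →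
          -- `0 < E_Q(ω₀, λ₀) < c (V_Q(ω_-) - V_Q(ω_+))`
          0 < finiteEnergy (AFun φ Ψ₃) (dFun g φ) ωs N e Q ω₀ l₀ 0
              - potential (dFun g φ) Q (ωp Q) →
          finiteEnergy (AFun φ Ψ₃) (dFun g φ) ωs N e Q ω₀ l₀ 0
              - potential (dFun g φ) Q (ωp Q)
            < c * (potential (dFun g φ) Q (ωm Q) - potential (dFun g φ) Q (ωp Q)) →
          ∃ γ : ℝ → ℝ × ℝ,
            IsReducedSolution (AFun φ Ψ₃) (dFun g φ) ωs N e Q ω₀ l₀ γ ∧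
            (∀ γ' : ℝ → ℝ × ℝ,
              IsReducedSolution (AFun φ Ψ₃) (dFun g φ) ωs N e Q ω₀ l₀ γ' → γ' = γ) ∧
            ∃ Tf : ℝ,
              IsLeast {T : ℝ | 0 < T ∧ Function.Periodic γ T} Tf ∧
              C⁻¹ * (Q - qFun φ ωs) ^ (-(1 / 4) : ℝ) ≤ Tf ∧
              Tf ≤ C * (Q - qFun φ ωs) ^ (-(1 / 4) : ℝ) := by
  -- Every smallness condition holds for all small `δ`, so one `δ` is fixed before `c` and `Q`
  -- appear.
  obtain ⟨δ, ⟨hball, hwell⟩, hkin, hδ⟩ := ((hφ.eventually_isWell hg hωs hq' hq'').and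
    ((he.eventually_isKinetic hr (contDiffOn_AFun hφ hrO hΨ)
      (AFun_pos hg hφ hωs hq' hr hΨ)).and self_mem_nhdsWithin)).exists
  have hδ0 : 0 < δ := hδ
  set k := deriv (deriv (qFun φ)) ωs with hk
  set α := AFun φ Ψ₃ ωs with hα
  have hα0 : 0 < α := AFun_pos hg hφ hωs hq' hr hΨ
  -- The well has `m = k/2` and `M = 2k`, so `M/m = 4`.
  have hK : (1 + 2 * (2 * k / (k / 2))) = 9 := by field_simp; norm_num
  obtain ⟨η, hη0, hη1, hη2⟩ : ∃ η : ℝ, 0 < η ∧ 9 * η ≤ δ ∧ 8 * (2 * k) * η ≤ 3 * α := by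
    refine ⟨min (δ / 9) (3 * α / (16 * k)), by positivity, ?_, ?_⟩
    · linarith [min_le_left (δ / 9) (3 * α / (16 * k))]
    · have := min_le_right (δ / 9) (3 * α / (16 * k))
      rw [le_div_iff₀ (by positivity)] at this
      linarith
  -- The first bound places both roots within `η` of `ωs`, since their squared distance is at most
  -- `(4/k)(Q - q ωs)`; the second is the range of `Q` for which the kinetic bounds hold.
  obtain ⟨ε, hε0, hε1, hε2⟩ : ∃ ε : ℝ, 0 < ε ∧ ε ^ 2 ≤ k / 4 * η ^ 2 ∧ ε ^ 2 ≤ δ ^ 2 := by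
    refine ⟨min (√(k / 4) * η) δ, lt_min (by positivity) hδ0, ?_, ?_⟩
    · calc min (√(k / 4) * η) δ ^ 2 ≤ (√(k / 4) * η) ^ 2 :=
            pow_le_pow_left₀ (le_min (by positivity) hδ0.le) (min_le_left _ _) 2
        _ = k / 4 * η ^ 2 := by rw [mul_pow, Real.sq_sqrt (by positivity)]
    · exact pow_le_pow_left₀ (le_min (by positivity) hδ0.le) (min_le_right _ _) 2
  -- The hypotheses on `Q` sit inside the existential so that the roots can be chosen as functions
  -- on the whole line, with irrelevant values elsewhere.
  have hroots : ∀ Q : ℝ, ∃ a b : ℝ, 0 < Q - qFun φ ωs → Q - qFun φ ωs < ε ^ 2 →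
      a < ωs ∧ ωs < b ∧ {ω : ℝ | |ω - ωs| < δ ∧ qFun φ ω = Q} = {a, b} := by
    intro Q
    by_cases hQ : 0 < Q - qFun φ ωs ∧ Q - qFun φ ωs < ε ^ 2
    · obtain ⟨a, b, hab⟩ := hwell.exists_roots hδ0 hQ.1 (by
        have : η ^ 2 ≤ δ ^ 2 / 81 := by nlinarith
        nlinarith [hQ.2, mul_le_mul_of_nonneg_left this hq''.le, mul_nonneg hq''.le (sq_nonneg δ)])
      exact ⟨a, b, fun _ _ => hab⟩
    · exact ⟨0, 0, fun h1 h2 => absurd ⟨h1, h2⟩ hQ⟩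
  choose ωm ωp hω using hroots
  refine ⟨δ, hδ0, ε, hε0, ωm, ωp, hball, hω, fun c hc hc1 => ?_⟩
  obtain ⟨C, hC, hmain⟩ := hwell.exists_unique_periodic hδ0 (A := AFun φ Ψ₃) hα0 hc hc1
  refine ⟨C, hC, fun Q hQ hQε ω₀ l₀ hω₀ hl₀ hmω hE hEc => ?_⟩
  obtain ⟨h1, h2, h3⟩ := hω Q hQ hQε
  have hmem : ∀ x ∈ ({ωm Q, ωp Q} : Set ℝ), |x - ωs| < η ∧ qFun φ x = Q := by
    intro x hx
    rw [← h3] at hx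
    obtain ⟨hx1, hx2⟩ := hx
    refine ⟨?_, hx2⟩
    have hx3 := (hwell.root_bounds (a := x) (by
      rw [abs_lt] at hx1
      exact ⟨by linarith [hx1.1], by linarith [hx1.2]⟩) hx2).2
    refine abs_lt_of_sq_lt_sq (hx3.trans_lt ?_) hη0.le
    have e1 : 2 / (k / 2) * (k / 4 * η ^ 2) = η ^ 2 := by field_simp; norm_num
    calc 2 / (k / 2) * (Q - qFun φ ωs) < 2 / (k / 2) * (k / 4 * η ^ 2) :=
          mul_lt_mul_of_pos_left (hQε.trans_le hε1) (by positivity)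
      _ = η ^ 2 := e1
  obtain ⟨ha, hqa⟩ := hmem (ωm Q) (by simp)
  obtain ⟨hb, hqb⟩ := hmem (ωp Q) (by simp)
  rw [abs_lt] at ha hb hω₀ hl₀
  rw [finiteEnergy_eq] at hE hEc
  obtain ⟨γ, hγ0, hγ, huniq, T, hT⟩ := hmain (kinetic (AFun φ Ψ₃) N e Q) Q (ωm Q) (ωp Q) η (ω₀, l₀)
    (hkin Q (by rw [abs_of_pos hQ]; exact hQε.trans_le hε2)) hQ (by linarith [ha.1]) h1 h2
    (by linarith [hb.2]) hqa hqb (by rw [hK]; exact hη1) hη2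
    ⟨⟨by linarith [hω₀.1], by linarith [hω₀.2]⟩, hl₀⟩ hmω hE hEc
  refine ⟨γ, isReducedSolution_iff.2 ⟨hγ0, hγ⟩, fun γ' hγ' => ?_, T, hT⟩
  obtain ⟨h4, h5⟩ := isReducedSolution_iff.1 hγ'
  exact huniq γ' h4 h5
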